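/- Let $n\ge 3$ and let $C_{\mathbf w}^n$ be the cycle with vertices $x_1,\dots,x_n$ and edges $e_i=x_ix_{i+1}$ (where $x_{n+1}=x_1$), with positive integer edge weights $\mathbf w_i=\mathbf w(e_i)$, $1\le i\le n$. Let $S=\mathbb K[x_1,\dots,x_n]$ be the standard graded polynomial ring over a field $\mathbb K$, and let $$I(C_{\mathbf w}^n)=\bigl(x_i^{\mathbf w_i}x_{i+1}^{\mathbf w_i}\ :\ 1\le i\le n\bigr)\subset S$$ be the edge ideal. Assume that $C_{\mathbf w}^n$ is non-trivial, that is, $\mathbf w_i\ge 2$ for some $i$, and integrally closed, that is, every $f\in S$ satisfying an equation $f^k+c_1f^{k-1}+\dots+c_k=0$ with $k\ge 1$ and $c_j\in I(C_{\mathbf w}^n)^j$ for all $j$ lies in $I(C_{\mathbf w}^n)$. Put $\omega=\max\{\mathbf w_1,\dots,\mathbf w_n\}$. Then for all $t\ge 1$ $$\operatorname{reg}\bigl(S/I(C_{\mathbf w}^n)^t\bigr)=2\omega t+\left\lfloor \frac n3\right\rfloor-2 .$$ Here $\operatorname{reg}(S/J)=\max\{j-i : \beta_{i,j}(S/J)\ne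 0\}$ for a homogeneous ideal $J\subsetneq S$, where $\beta_{i,j}(S/J)$ is the number of copies of $S(-j)$ in homological degree $i$ of a minimal graded free resolution of $S/J$. -/

import Mathlib

/-!
Edge ideals of edge-weighted graphs, integrally closed ideals, minimal graded free resolutions
of cyclic graded modules over a polynomial ring, graded Betti numbers and regularity.
-/

/-- The edge ideal `(x_u ^ w(uv) * x_v ^ w(uv) | uv an edge)` of a graph `G` with positive integer
edge weights `w`, in the polynomial ring over `𝕜` whose variables are the vertices of `G`. -/
noncomputable def weightedEdgeIdeal (𝕜 : Type*) [Field 𝕜] {V : Type*} {G : SimpleGraph V}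
    (w : G.edgeSet → ℕ+) : Ideal (MvPolynomial V 𝕜) :=
  Ideal.span {p | ∃ (u v : V) (h : G.Adj u v),
    p = MvPolynomial.X u ^ (w ⟨s(u, v), h⟩ : ℕ) * MvPolynomial.X v ^ (w ⟨s(u, v), h⟩ : ℕ)}

/-- An edge-weighted graph is non-trivial if some edge has weight greater than `1`. -/
def IsNontrivialWeight {V : Type*} {G : SimpleGraph V} (w : G.edgeSet → ℕ+) : Prop :=
  ∃ e, 1 < w e

/-- `f` is integral over the ideal `I`: it satisfies an equation
`f ^ k + c₁ f ^ (k - 1) + ⋯ + c_k = 0` with `k ≥ 1` and `c_i ∈ I ^ i`. -/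
def IsIntegralOverIdeal {R : Type*} [CommRing R] (I : Ideal R) (f : R) : Prop :=
  ∃ (k : ℕ) (c : ℕ → R), 1 ≤ k ∧ (∀ i ∈ Finset.Icc 1 k, c i ∈ I ^ i) ∧
    f ^ k + ∑ i ∈ Finset.Icc 1 k, c i * f ^ (k - i) = 0

/-- The ideal `I` is integrally closed: it equals the set of all elements integral over it. -/
def IsIntegrallyClosedIdeal {R : Type*} [CommRing R] (I : Ideal R) : Prop :=
  {f : R | IsIntegralOverIdeal I f} = (I : Set R)

/-- `p` is homogeneous of degree `d ∈ ℤ` in the standard grading. (The zero polynomial is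
homogeneous of every degree, and nothing else is homogeneous of a negative degree.) -/
def IsHomogeneousOfIntDegree {𝕜 σ : Type*} [Field 𝕜] (p : MvPolynomial σ 𝕜) (d : ℤ) : Prop :=
  ∀ m ∈ p.support, (m.degree : ℤ) = d

/-- On natural degrees, this is Mathlib's notion of a homogeneous polynomial. -/
theorem isHomogeneousOfIntDegree_natCast {𝕜 σ : Type*} [Field 𝕜] (p : MvPolynomial σ 𝕜) (d : ℕ) :
    IsHomogeneousOfIntDegree p (d : ℤ) ↔ p.IsHomogeneous d := by
  simp only [IsHomogeneousOfIntDegree, MvPolynomial.IsHomogeneous,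
    MvPolynomial.IsWeightedHomogeneous, MvPolynomial.mem_support_iff, Nat.cast_inj,
    Finsupp.degree_eq_weight_one]
  exact ⟨fun h m hm => h m hm, fun h m hm => h hm⟩

/-- A minimal graded free resolution `⋯ → F₂ → F₁ → F₀ → S/I → 0` of `S/I`, where `S` is the
polynomial ring over `𝕜` in the variables `σ`. Here `F i = ⨁ₐ S(-deg i a)` is free of finite rank,
with basis `e_a = Pi.single a 1` in degree `deg i a`, the map `F (i + 1) → F i` is `d i`, and
all maps preserve degrees. -/
structure MinimalGradedFreeResolution {𝕜 σ : Type*} [Field 𝕜]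
    (I : Ideal (MvPolynomial σ 𝕜)) where
  /-- the rank of `F i` -/
  rank : ℕ → ℕ
  /-- the degrees of the basis elements of `F i` -/
  deg : (i : ℕ) → Fin (rank i) → ℤ
  /-- the differentials -/
  d : (i : ℕ) → (Fin (rank (i + 1)) → MvPolynomial σ 𝕜) →ₗ[MvPolynomial σ 𝕜]
    (Fin (rank i) → MvPolynomial σ 𝕜)
  /-- the augmentation -/
  aug : (Fin (rank 0) → MvPolynomial σ 𝕜) →ₗ[MvPolynomial σ 𝕜] (MvPolynomial σ 𝕜 ⧸ I)
  aug_surjective : Function.Surjective aug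
  exact_zero : Function.Exact (d 0) aug
  exact_succ : ∀ i, Function.Exact (d (i + 1)) (d i)
  /-- `aug` sends `e_a` to the class of a homogeneous polynomial of degree `deg 0 a`. -/
  aug_graded : ∀ a, ∃ p : MvPolynomial σ 𝕜, IsHomogeneousOfIntDegree p (deg 0 a) ∧
    aug (Pi.single a 1) = Ideal.Quotient.mk I p
  /-- The `(a, b)` entry of the matrix of `d i` is homogeneous of degree
  `deg (i + 1) b - deg i a`. -/
  d_graded : ∀ i b a,
    IsHomogeneousOfIntDegree (d i (Pi.single b 1) a) (deg (i + 1) b - deg i a)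
  /-- Minimality: all entries of the matrices of the differentials lie in the maximal ideal
  generated by the variables. -/
  minimal : ∀ i b a, MvPolynomial.constantCoeff (d i (Pi.single b 1) a) = 0

/-- The graded Betti number `β i j`: the number of copies of `S(-j)` in `F i`. -/
def MinimalGradedFreeResolution.betti {𝕜 σ : Type*} [Field 𝕜] {I : Ideal (MvPolynomial σ 𝕜)}
    (F : MinimalGradedFreeResolution I) (i : ℕ) (j : ℤ) : ℕ :=
  Fintype.card {a : Fin (F.rank i) // F.deg i a = j}

/-- `reg (S/I) = r`: a minimal graded free resolution of `S/I` exists, and (for every one of them,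
as the Betti numbers do not depend on the choice) `r` is the maximum of all `j - i` with
`β i j ≠ 0`. -/
def QuotientHasRegularity {𝕜 σ : Type*} [Field 𝕜] (I : Ideal (MvPolynomial σ 𝕜)) (r : ℤ) : Prop :=
  Nonempty (MinimalGradedFreeResolution I) ∧
    ∀ F : MinimalGradedFreeResolution I,
      IsGreatest {s : ℤ | ∃ (i : ℕ) (j : ℤ), F.betti i j ≠ 0 ∧ s = j - i} r

/-! Regularity is read off from Koszul homology. Dimension shifting along a minimal resolution shows
that β_{i,j}(S/J) ≠ 0 exactly when the Koszul homology of S/J is nonzero in homological degree i and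
internal degree j (`MinimalGradedFreeResolution.betti_eq_zero_iff`). The theorem thus splits into a
vanishing statement, `RegLE`, and one nonzero class, both for monomial ideals encoded by their sets
of exponents.

Integral closedness enters only through `IsWeightedCycle.heavyLinked`: any two heavy edges (weight
at least 2) are joined by a light one (weight 1). Let L be the ideal of the light edges and f_i the
monomial of a heavy edge. Cutting the cycle at a heavy edge makes L the edge ideal of a path that
may lack the second edge from either end. Such a graph is bipartite, so x^g lies in L^k iff g has
weight at least k on every vertex cover. Linking gives f_i f_j ∈ L^2; hence I^t is the sum of the
ideals (f_i, L)^t, any two of which meet in L^t.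

Upper bound: Mayer–Vietoris reduces to a single heavy f (`regLE_iUnion_heavySet`). Filter (f, L)^t
by the number of factors f (`regLE_heavySet`). The stage s and the new summand f^{s+1} L^{t-s-1}
meet in f^{s+1} times an ideal of cover type, in which covers meeting an end of f owe one unit less.
The regularity of that ideal is bounded in `regLE_markedEnds` by repeatedly setting a variable to
zero or passing to the colon by it. The last stage, s + 1 = t, produces the bound.

Lower bound: put exponent ωt on the ends of an edge of maximal weight and 1 on further pairs of
neighbours, spaced with period 3 around the cycle. In this multidegree the Koszul complex of S/I^t
carries a class supported on a cross-polytope (`not_koszulVanishing_of_pairing`), in homological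
degree ⌊n/3⌋ and internal degree 2ωt + 2⌊n/3⌋ - 2. -/

open Finset

set_option linter.unusedSectionVars false

/-! ### The Koszul complex and its acyclicity over S. -/

section Koszul

variable {𝕜 V M M' : Type*} [Field 𝕜] [Fintype V] [DecidableEq V]
  [AddCommGroup M] [Module (MvPolynomial V 𝕜) M] [AddCommGroup M'] [Module (MvPolynomial V 𝕜) M']

/-- The sign with which `v` enters `τ`, when the vertices are ordered by `ρ`. -/
noncomputable def koszulSign (𝕜 : Type*) {V : Type*} [Field 𝕜] (ρ : V → ℕ) (v : V) (τ : Finset V) :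
    MvPolynomial V 𝕜 :=
  (-1) ^ (τ.filter fun u => ρ u < ρ v).card

theorem koszulSign_mul_self (ρ : V → ℕ) (v : V) (τ : Finset V) :
    koszulSign 𝕜 ρ v τ * koszulSign 𝕜 ρ v τ = 1 := by
  rw [koszulSign, ← mul_pow]; simp

theorem koszulSign_insert {ρ : V → ℕ} {u v : V} {τ : Finset V} (hv : v ∉ τ) :
    koszulSign 𝕜 ρ u (insert v τ) = (if ρ v < ρ u then -1 else 1) * koszulSign 𝕜 ρ u τ := by
  unfold koszulSign
  rw [filter_insert]
  split_ifs with h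
  · rw [card_insert_of_notMem (by simp [hv]), pow_succ]; ring
  · simp

theorem koszulSign_swap {ρ : V → ℕ} (hρ : Function.Injective ρ) {u v : V} {τ : Finset V}
    (hu : u ∉ τ) (hv : v ∉ τ) (huv : u ≠ v) :
    koszulSign 𝕜 ρ v τ * koszulSign 𝕜 ρ u (insert v τ) =
      -(koszulSign 𝕜 ρ u τ * koszulSign 𝕜 ρ v (insert u τ)) := by
  rw [koszulSign_insert hv, koszulSign_insert hu]
  rcases lt_or_gt_of_ne (hρ.ne huv) with h | h
  · simp only [h, not_lt_of_gt h, if_true, if_false]; ring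
  · simp only [h, not_lt_of_gt h, if_true, if_false]; ring

theorem koszulSign_swap' {ρ : V → ℕ} (hρ : Function.Injective ρ) {u v : V} {τ : Finset V}
    (hu : u ∉ τ) (hv : v ∉ τ) (huv : u ≠ v) :
    koszulSign 𝕜 ρ v (insert u τ) * koszulSign 𝕜 ρ u (insert v τ) =
      -(koszulSign 𝕜 ρ v τ * koszulSign 𝕜 ρ u τ) := by
  rw [koszulSign_insert hv, koszulSign_insert hu]
  rcases lt_or_gt_of_ne (hρ.ne huv) with h | h
  · simp only [h, not_lt_of_gt h, if_true, if_false]; ring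
  · simp only [h, not_lt_of_gt h, if_true, if_false]; ring

/-- The Koszul differential on `M ⊗ ⋀ Sⱽ`; a chain lists the coefficients of the wedges `e_σ`. -/
noncomputable def koszulD (ρ : V → ℕ) :
    (Finset V → M) →ₗ[MvPolynomial V 𝕜] (Finset V → M) :=
  LinearMap.pi fun τ => ∑ v ∈ τᶜ,
    (koszulSign 𝕜 ρ v τ * MvPolynomial.X v) • LinearMap.proj (insert v τ)

theorem koszulD_apply (ρ : V → ℕ) (z : Finset V → M) (τ : Finset V) :
    koszulD (𝕜 := 𝕜) ρ z τ =
      ∑ v ∈ τᶜ, (koszulSign 𝕜 ρ v τ * MvPolynomial.X v) • z (insert v τ) := by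
  simp [koszulD]

theorem koszulD_comp (ρ : V → ℕ) (φ : M →ₗ[MvPolynomial V 𝕜] M') (z : Finset V → M) :
    koszulD (𝕜 := 𝕜) ρ (fun σ => φ (z σ)) = fun σ => φ (koszulD (𝕜 := 𝕜) ρ z σ) := by
  ext τ
  simp [koszulD_apply]

/-- Adjoining u then v and v then u give the same entry with opposite signs, by `koszulSign_swap`.
-/
theorem koszulD_koszulD {ρ : V → ℕ} (hρ : Function.Injective ρ) (z : Finset V → M) :
    koszulD (𝕜 := 𝕜) ρ (koszulD (𝕜 := 𝕜) ρ z) = 0 := by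
  ext τ
  simp only [koszulD_apply, smul_sum, Pi.zero_apply, smul_smul]
  rw [sum_sigma']
  refine sum_involution (fun p _ => ⟨p.2, p.1⟩) ?_ ?_ ?_ ?_
  · rintro ⟨v, u⟩ h
    simp only [mem_sigma, mem_compl, mem_insert, not_or] at h
    obtain ⟨hv, huv, hu⟩ := h
    rw [insert_comm u v, ← add_smul]
    convert zero_smul (MvPolynomial V 𝕜) _
    linear_combination (MvPolynomial.X u * MvPolynomial.X v) *
      koszulSign_swap (𝕜 := 𝕜) hρ hu hv huv
  · rintro ⟨v, u⟩ h _ h'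
    simp only [mem_sigma, mem_compl, mem_insert, not_or] at h
    simp only [Sigma.mk.injEq, heq_eq_eq] at h'
    exact h.2.1 h'.1
  · rintro ⟨v, u⟩ h
    simp only [mem_sigma, mem_compl, mem_insert, not_or] at h ⊢
    exact ⟨h.2.2, fun e => h.2.1 e.symm, h.1⟩
  · rintro ⟨v, u⟩ h
    rfl

/-- The polynomials that are homogeneous of degree `d`. -/
def polyDegree (𝕜 V : Type*) [Field 𝕜] (d : ℤ) : AddSubgroup (MvPolynomial V 𝕜) where
  carrier := {p | IsHomogeneousOfIntDegree p d}
  zero_mem' := by simp [IsHomogeneousOfIntDegree]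
  add_mem' {p q} hp hq m hm := by
    classical
    rcases mem_union.1 (MvPolynomial.support_add hm) with h | h
    exacts [hp m h, hq m h]
  neg_mem' {p} hp m hm := hp m (by simpa using hm)

theorem mem_polyDegree {p : MvPolynomial V 𝕜} {d : ℤ} :
    p ∈ polyDegree 𝕜 V d ↔ ∀ m, p.coeff m ≠ 0 → (m.degree : ℤ) = d := by
  simp [polyDegree, IsHomogeneousOfIntDegree, MvPolynomial.mem_support_iff]

theorem mul_mem_polyDegree {p q : MvPolynomial V 𝕜} {d e : ℤ} (hp : p ∈ polyDegree 𝕜 V d)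
    (hq : q ∈ polyDegree 𝕜 V e) : p * q ∈ polyDegree 𝕜 V (d + e) := by
  intro m hm
  obtain ⟨a, ha, b, hb, rfl⟩ := mem_add.1 (MvPolynomial.support_mul p q hm)
  rw [← hp a ha, ← hq b hb, map_add]; push_cast; rfl

theorem monomial_mem_polyDegree (m : V →₀ ℕ) (c : 𝕜) :
    MvPolynomial.monomial m c ∈ polyDegree 𝕜 V m.degree := by
  intro m' hm'
  rw [mem_singleton.1 (MvPolynomial.support_monomial_subset hm')]

theorem X_mem_polyDegree (v : V) : (MvPolynomial.X v : MvPolynomial V 𝕜) ∈ polyDegree 𝕜 V 1 := by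
  have := monomial_mem_polyDegree (Finsupp.single v 1) (1 : 𝕜)
  rwa [Finsupp.degree_single] at this

theorem constantCoeff_eq_zero_of_mem_polyDegree {p : MvPolynomial V 𝕜} {d : ℤ}
    (hp : p ∈ polyDegree 𝕜 V d) (hd : d ≠ 0) : MvPolynomial.constantCoeff p = 0 := by
  by_contra h
  have := mem_polyDegree.1 hp 0 (by simpa [MvPolynomial.constantCoeff_eq] using h)
  simp at this
  exact hd this.symm

theorem koszulSign_mem_polyDegree (ρ : V → ℕ) (v : V) (τ : Finset V) :
    koszulSign 𝕜 ρ v τ ∈ polyDegree 𝕜 V 0 := by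
  have h1 : (1 : MvPolynomial V 𝕜) ∈ polyDegree 𝕜 V 0 := by
    simpa using monomial_mem_polyDegree (0 : V →₀ ℕ) (1 : 𝕜)
  unfold koszulSign
  rcases neg_one_pow_eq_or (MvPolynomial V 𝕜) (τ.filter fun u => ρ u < ρ v).card with h | h <;>
    rw [h]
  · exact h1
  · exact neg_mem h1

/-- Compatibility of a family of additive subgroups of `M` with the grading of `S`. -/
def IsGradedFamily (𝒜 : ℤ → AddSubgroup M) : Prop :=
  ∀ (d e : ℤ) (p : MvPolynomial V 𝕜) (m : M),
    p ∈ polyDegree 𝕜 V d → m ∈ 𝒜 e → p • m ∈ 𝒜 (d + e)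

theorem isGradedFamily_polyDegree :
    IsGradedFamily (𝕜 := 𝕜) (V := V) (polyDegree 𝕜 V) :=
  fun _ _ _ _ hp hq => mul_mem_polyDegree hp hq

/-- The Koszul chains of homological degree `i` and internal degree `j`. -/
def koszulChain (V : Type*) {M : Type*} [AddCommGroup M] (𝒜 : ℤ → AddSubgroup M) (i : ℕ) (j : ℤ) :
    AddSubgroup (Finset V → M) where
  carrier := {z | (∀ σ, σ.card = i → z σ ∈ 𝒜 (j - i)) ∧ ∀ σ, σ.card ≠ i → z σ = 0}
  zero_mem' := by simp
  add_mem' := by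
    rintro x y ⟨hx, hx'⟩ ⟨hy, hy'⟩
    exact ⟨fun σ h => add_mem (hx σ h) (hy σ h), fun σ h => by simp [hx' σ h, hy' σ h]⟩
  neg_mem' := by
    rintro x ⟨hx, hx'⟩
    exact ⟨fun σ h => neg_mem (hx σ h), fun σ h => by simp [hx' σ h]⟩

theorem koszulD_mem_koszulChain {𝒜 : ℤ → AddSubgroup M} (h𝒜 : IsGradedFamily (𝕜 := 𝕜) (V := V) 𝒜)
    (ρ : V → ℕ) {i : ℕ} {j : ℤ} {z : Finset V → M} (hz : z ∈ koszulChain V 𝒜 (i + 1) j) :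
    koszulD (𝕜 := 𝕜) ρ z ∈ koszulChain V 𝒜 i j := by
  refine ⟨fun τ hτ => ?_, fun τ hτ => ?_⟩
  · rw [koszulD_apply]
    refine sum_mem fun v hv => ?_
    rw [mem_compl] at hv
    have := hz.1 (insert v τ) (by rw [card_insert_of_notMem hv, hτ])
    have h2 := h𝒜 (0 + 1) _ _ _
      (mul_mem_polyDegree (koszulSign_mem_polyDegree (𝕜 := 𝕜) ρ v τ) (X_mem_polyDegree v)) this
    convert h2 using 1
    push_cast; congr 1; ring
  · rw [koszulD_apply]
    refine sum_eq_zero fun v hv => ?_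
    rw [mem_compl] at hv
    rw [hz.2 (insert v τ) (by rw [card_insert_of_notMem hv]; omega), smul_zero]

theorem koszulD_eq_zero_of_zero_chain {𝒜 : ℤ → AddSubgroup M}
    (ρ : V → ℕ) {j : ℤ} {z : Finset V → M} (hz : z ∈ koszulChain V 𝒜 0 j) :
    koszulD (𝕜 := 𝕜) ρ z = 0 := by
  ext τ
  rw [koszulD_apply]
  refine sum_eq_zero fun v hv => ?_
  rw [hz.2 (insert v τ) (by rw [card_insert_of_notMem (mem_compl.1 hv)]; omega), smul_zero]

/-- The contracting homotopy in the direction of the variable `v`. -/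
noncomputable def koszulHomotopy (ρ : V → ℕ) (v : V) (z : Finset V → MvPolynomial V 𝕜) :
    Finset V → MvPolynomial V 𝕜 := fun τ =>
  if v ∈ τ then koszulSign 𝕜 ρ v (τ.erase v) *
    MvPolynomial.divMonomial (z (τ.erase v)) (Finsupp.single v 1) else 0

theorem divMonomial_mem_polyDegree {p : MvPolynomial V 𝕜} {d : ℤ} (hp : p ∈ polyDegree 𝕜 V d)
    (v : V) : p.divMonomial (Finsupp.single v 1) ∈ polyDegree 𝕜 V (d - 1) := by
  rw [mem_polyDegree]
  intro m hm
  rw [MvPolynomial.coeff_divMonomial] at hm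
  have := mem_polyDegree.1 hp _ hm
  rw [map_add, Finsupp.degree_single] at this
  push_cast at this
  omega

theorem koszulHomotopy_mem {ρ : V → ℕ} {v : V} {z : Finset V → MvPolynomial V 𝕜} {i : ℕ} {j : ℤ}
    (hz : z ∈ koszulChain V (polyDegree 𝕜 V) i j) :
    koszulHomotopy ρ v z ∈ koszulChain V (polyDegree 𝕜 V) (i + 1) j := by
  refine ⟨fun τ hτ => ?_, fun τ hτ => ?_⟩
  · unfold koszulHomotopy
    split_ifs with h
    · have h1 := hz.1 (τ.erase v) (by rw [card_erase_of_mem h, hτ]; rfl)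
      have h2 := mul_mem_polyDegree (koszulSign_mem_polyDegree (𝕜 := 𝕜) ρ v (τ.erase v))
        (divMonomial_mem_polyDegree h1 v)
      convert h2 using 2
      push_cast; ring
    · exact zero_mem _
  · unfold koszulHomotopy
    split_ifs with h
    · rw [hz.2 (τ.erase v) (by rw [card_erase_of_mem h]; have := card_pos.2 ⟨v, h⟩; omega)]
      simp
    · rfl

theorem X_mul_divMonomial_of_ne {u v : V} (h : u ≠ v) (p : MvPolynomial V 𝕜) :
    (MvPolynomial.X u * p).divMonomial (Finsupp.single v 1) =
      MvPolynomial.X u * p.divMonomial (Finsupp.single v 1) := by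
  ext m
  rw [MvPolynomial.coeff_divMonomial, MvPolynomial.coeff_X_mul', MvPolynomial.coeff_X_mul']
  have hm : u ∈ (Finsupp.single v 1 + m).support ↔ u ∈ m.support := by
    simp [h.symm]
  simp only [hm]
  split_ifs with hu
  · rw [MvPolynomial.coeff_divMonomial]
    congr 1
    ext w
    simp only [Finsupp.coe_tsub, Finsupp.coe_add, Pi.sub_apply, Pi.add_apply,
      Finsupp.single_apply]
    rw [Finsupp.mem_support_iff] at hu
    split_ifs with h1 h2 h2 <;> first | omega | (exfalso; exact h (h2.trans h1.symm))
  · rfl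

theorem divMonomial_sum {ι : Type*} (s : Finset ι) (f : ι → MvPolynomial V 𝕜) (m : V →₀ ℕ) :
    (∑ a ∈ s, f a).divMonomial m = ∑ a ∈ s, (f a).divMonomial m := by
  ext n
  simp [MvPolynomial.coeff_divMonomial, MvPolynomial.coeff_sum]

theorem koszulSign_mul_divMonomial (ρ : V → ℕ) (u : V) (τ : Finset V) (p : MvPolynomial V 𝕜)
    (m : V →₀ ℕ) :
    (koszulSign 𝕜 ρ u τ * p).divMonomial m = koszulSign 𝕜 ρ u τ * p.divMonomial m := by
  unfold koszulSign
  rcases neg_one_pow_eq_or (MvPolynomial V 𝕜) (τ.filter fun w => ρ w < ρ u).card with h | h <;>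
    rw [h]
  · simp
  · ext n; simp [MvPolynomial.coeff_divMonomial]

/-- On a cycle, subtracting the boundary of the homotopy kills the part involving `e_v`. -/
theorem sub_koszulD_koszulHomotopy_of_mem {ρ : V → ℕ} (hρ : Function.Injective ρ) {v : V}
    {z : Finset V → MvPolynomial V 𝕜} (hz : koszulD (𝕜 := 𝕜) ρ z = 0) {σ : Finset V}
    (hv : v ∈ σ) : (z - koszulD (𝕜 := 𝕜) ρ (koszulHomotopy ρ v z)) σ = 0 := by
  obtain ⟨τ, hτ, rfl⟩ : ∃ τ, v ∉ τ ∧ insert v τ = σ :=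
    ⟨σ.erase v, notMem_erase v σ, insert_erase hv⟩
  have h0 : (koszulD (𝕜 := 𝕜) ρ z τ).divMonomial (Finsupp.single v 1) = 0 := by
    rw [hz]; simp
  rw [koszulD_apply, divMonomial_sum] at h0
  -- Dividing the cycle condition at τ by the variable v isolates the entry at `insert v τ`.
  have hsplit : τᶜ = insert v (insert v τ)ᶜ := by
    ext u; by_cases h : u = v <;> simp [h, hτ]
  rw [hsplit, sum_insert (by simp)] at h0
  rw [Pi.sub_apply, koszulD_apply, sub_eq_zero]
  simp only [smul_eq_mul, mul_assoc, koszulSign_mul_divMonomial, MvPolynomial.X_mul_divMonomial]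
    at h0 ⊢
  have h1 := congrArg (fun p => koszulSign 𝕜 ρ v τ * p) h0
  simp only [mul_add, ← mul_assoc, koszulSign_mul_self, one_mul, mul_zero] at h1
  rw [eq_neg_of_add_eq_zero_left h1, mul_sum, ← sum_neg_distrib]
  refine sum_congr rfl fun u hu => ?_
  simp only [mem_compl, mem_insert, not_or] at hu
  obtain ⟨huv, hu⟩ := hu
  rw [X_mul_divMonomial_of_ne huv, koszulHomotopy, if_pos (by simp),
    show (insert u (insert v τ)).erase v = insert u τ by
      rw [insert_comm, erase_insert (by simp [hτ, Ne.symm huv])]]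
  linear_combination (-(MvPolynomial.X u *
    (z (insert u τ)).divMonomial (Finsupp.single v 1))) * koszulSign_swap' (𝕜 := 𝕜) hρ hu hτ huv

/-- Only the term adjoining v survives in the boundary of the homotopy, and it removes exactly the
multiples of the variable v. -/
theorem sub_koszulD_koszulHomotopy_of_notMem {ρ : V → ℕ} {v : V}
    {z : Finset V → MvPolynomial V 𝕜} {σ : Finset V} (hv : v ∉ σ) :
    (z - koszulD (𝕜 := 𝕜) ρ (koszulHomotopy ρ v z)) σ =
      (z σ).modMonomial (Finsupp.single v 1) := by
  rw [Pi.sub_apply, koszulD_apply, sum_eq_single v]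
  · rw [koszulHomotopy, if_pos (mem_insert_self _ _), erase_insert hv, smul_eq_mul,
      sub_eq_iff_eq_add]
    have := MvPolynomial.modMonomial_add_divMonomial_single (z σ) v
    conv_lhs => rw [← this]
    linear_combination (-(MvPolynomial.X v *
      (z σ).divMonomial (Finsupp.single v 1))) * koszulSign_mul_self (𝕜 := 𝕜) ρ v σ
  · intro u hu huv
    rw [koszulHomotopy, if_neg (by simp [hv, Ne.symm huv]), smul_zero]
  · intro h; simp [hv] at h

/-- Elimination of the variables one at a time: after T has been treated, nothing involving a wedge
factor from T remains, and the entry at ∅ has lost all monomials divisible by a variable of T. For T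
= `univ` only a constant is left. -/
theorem koszul_primitive_aux {ρ : V → ℕ} (hρ : Function.Injective ρ) {i : ℕ} {j : ℤ}
    {z : Finset V → MvPolynomial V 𝕜} (hz : z ∈ koszulChain V (polyDegree 𝕜 V) i j)
    (hd : koszulD (𝕜 := 𝕜) ρ z = 0) (T : Finset V) :
    ∃ y ∈ koszulChain V (polyDegree 𝕜 V) (i + 1) j,
      (∀ σ, (∃ v ∈ T, v ∈ σ) → (z - koszulD (𝕜 := 𝕜) ρ y) σ = 0) ∧
      ∀ m : V →₀ ℕ, ((z - koszulD (𝕜 := 𝕜) ρ y) ∅).coeff m =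
        if ∃ v ∈ T, m v ≠ 0 then 0 else (z ∅).coeff m := by
  induction T using Finset.induction_on with
  | empty => exact ⟨0, zero_mem _, by simp, by simp⟩
  | insert v T hv ih =>
    obtain ⟨y, hy, h1, h2⟩ := ih
    set w := z - koszulD (𝕜 := 𝕜) ρ y with hw
    have hwc : w ∈ koszulChain V (polyDegree 𝕜 V) i j :=
      sub_mem hz (koszulD_mem_koszulChain isGradedFamily_polyDegree ρ hy)
    have hwd : koszulD (𝕜 := 𝕜) ρ w = 0 := by
      rw [hw, map_sub, hd, koszulD_koszulD hρ, sub_zero]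
    refine ⟨y + koszulHomotopy ρ v w, add_mem hy (koszulHomotopy_mem hwc), ?_, ?_⟩
    · rintro σ ⟨u, hu, huσ⟩
      rw [map_add, ← sub_sub, ← hw]
      by_cases hvσ : v ∈ σ
      · exact sub_koszulD_koszulHomotopy_of_mem hρ hwd hvσ
      · rw [sub_koszulD_koszulHomotopy_of_notMem hvσ]
        have hu' : u ∈ T := by
          rcases mem_insert.1 hu with rfl | h
          exacts [absurd huσ hvσ, h]
        rw [h1 σ ⟨u, hu', huσ⟩]
        ext m
        by_cases hm : Finsupp.single v 1 ≤ m
        · rw [MvPolynomial.coeff_modMonomial_of_le _ hm]; simp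
        · rw [MvPolynomial.coeff_modMonomial_of_not_le _ hm]
    · intro m
      rw [map_add, ← sub_sub, ← hw, sub_koszulD_koszulHomotopy_of_notMem (notMem_empty v)]
      by_cases hm : Finsupp.single v 1 ≤ m
      · rw [MvPolynomial.coeff_modMonomial_of_le _ hm, if_pos]
        exact ⟨v, mem_insert_self _ _, by simpa [Nat.one_le_iff_ne_zero] using hm⟩
      · rw [MvPolynomial.coeff_modMonomial_of_not_le _ hm, h2]
        have : m v = 0 := by
          by_contra h
          exact hm (by simpa [Nat.one_le_iff_ne_zero] using h)
        simp [this]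

/-- The Koszul complex of `S` is a resolution of the residue field. -/
theorem exists_koszul_primitive {ρ : V → ℕ} (hρ : Function.Injective ρ) {i : ℕ} {j : ℤ}
    {z : Finset V → MvPolynomial V 𝕜} (hz : z ∈ koszulChain V (polyDegree 𝕜 V) i j)
    (hd : koszulD (𝕜 := 𝕜) ρ z = 0) (h0 : MvPolynomial.constantCoeff (z ∅) = 0) :
    ∃ y ∈ koszulChain V (polyDegree 𝕜 V) (i + 1) j, koszulD (𝕜 := 𝕜) ρ y = z := by
  obtain ⟨y, hy, h1, h2⟩ := koszul_primitive_aux hρ hz hd univ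
  refine ⟨y, hy, ?_⟩
  ext1 σ
  rcases σ.eq_empty_or_nonempty with rfl | ⟨v, hv⟩
  · have : (z - koszulD (𝕜 := 𝕜) ρ y) ∅ = 0 := by
      ext m
      rw [h2]
      split_ifs with h
      · simp
      · push Not at h
        have hm : m = 0 := by ext v; exact h v (mem_univ v)
        rw [hm, ← MvPolynomial.constantCoeff_eq, h0]; simp
    exact (sub_eq_zero.1 this).symm
  · exact (sub_eq_zero.1 (h1 σ ⟨v, mem_univ v, hv⟩)).symm

end Koszul

/-! ### Koszul homology of graded quotients, dimension shifting and Betti numbers. -/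

section KoszulVanishing

variable {𝕜 V M M' : Type*} [Field 𝕜] [Fintype V] [DecidableEq V]
  [AddCommGroup M] [Module (MvPolynomial V 𝕜) M] [AddCommGroup M'] [Module (MvPolynomial V 𝕜) M']

/-- The Koszul homology of `M / N` vanishes in homological degree `i` and internal degree `j`. -/
def KoszulVanishing (ρ : V → ℕ) (𝒜 : ℤ → AddSubgroup M) (N : Submodule (MvPolynomial V 𝕜) M)
    (i : ℕ) (j : ℤ) : Prop :=
  ∀ z ∈ koszulChain V 𝒜 i j, (∀ τ, koszulD (𝕜 := 𝕜) ρ z τ ∈ N) →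
    ∃ y ∈ koszulChain V 𝒜 (i + 1) j, ∀ σ, (z - koszulD (𝕜 := 𝕜) ρ y) σ ∈ N

theorem koszulD_mem_submodule (ρ : V → ℕ) {N : Submodule (MvPolynomial V 𝕜) M} {z : Finset V → M}
    (hz : ∀ σ, z σ ∈ N) (τ : Finset V) : koszulD (𝕜 := 𝕜) ρ z τ ∈ N := by
  rw [koszulD_apply]
  exact sum_mem fun v _ => N.smul_mem _ (hz _)

/-- Lift a chain entrywise. -/
theorem exists_koszulChain_lift {𝒜 : ℤ → AddSubgroup M} {ℬ : ℤ → AddSubgroup M'}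
    (R : M' → M → Prop) (h0 : R 0 0) {i : ℕ} {j : ℤ}
    (h : ∀ x ∈ ℬ (j - i), ∃ y ∈ 𝒜 (j - i), R x y) {z : Finset V → M'}
    (hz : z ∈ koszulChain V ℬ i j) :
    ∃ y ∈ koszulChain V 𝒜 i j, ∀ σ, R (z σ) (y σ) := by
  have : ∀ σ : Finset V, ∃ y : M, (σ.card = i → y ∈ 𝒜 (j - i)) ∧ (σ.card ≠ i → y = 0) ∧
      R (z σ) y := by
    intro σ
    by_cases hσ : σ.card = i
    · obtain ⟨y, hy, hR⟩ := h (z σ) (hz.1 σ hσ)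
      exact ⟨y, fun _ => hy, fun h => absurd hσ h, hR⟩
    · exact ⟨0, fun h => absurd h hσ, fun _ => rfl, by rw [hz.2 σ hσ]; exact h0⟩
  choose y h1 h2 h3 using this
  exact ⟨y, ⟨h1, h2⟩, h3⟩

theorem map_mem_koszulChain {𝒜 : ℤ → AddSubgroup M} {ℬ : ℤ → AddSubgroup M'}
    (φ : M →ₗ[MvPolynomial V 𝕜] M') {i : ℕ} {j : ℤ}
    (hφ : ∀ d, ∀ x ∈ 𝒜 d, φ x ∈ ℬ d) {z : Finset V → M} (hz : z ∈ koszulChain V 𝒜 i j) :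
    (fun σ => φ (z σ)) ∈ koszulChain V ℬ i j :=
  ⟨fun σ hσ => hφ _ _ (hz.1 σ hσ), fun σ hσ => by simp [hz.2 σ hσ]⟩

/-- Koszul vanishing only depends on the graded quotient module. -/
theorem koszulVanishing_iff_of_quotient {𝒜 : ℤ → AddSubgroup M} {ℬ : ℤ → AddSubgroup M'}
    (ρ : V → ℕ) (φ : M →ₗ[MvPolynomial V 𝕜] M') (hφ : ∀ d, ∀ x ∈ 𝒜 d, φ x ∈ ℬ d)
    {N : Submodule (MvPolynomial V 𝕜) M} {N' : Submodule (MvPolynomial V 𝕜) M'}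
    (hN : ∀ x, φ x ∈ N' ↔ x ∈ N) (hlift : ∀ d, ∀ x ∈ ℬ d, ∃ y ∈ 𝒜 d, x - φ y ∈ N')
    (i : ℕ) (j : ℤ) :
    KoszulVanishing ρ 𝒜 N i j ↔ KoszulVanishing ρ ℬ N' i j := by
  constructor
  · intro h z hz hdz
    obtain ⟨z', hz', hzz⟩ := exists_koszulChain_lift (𝒜 := 𝒜) (fun x y => x - φ y ∈ N')
      (by simp) (hlift (j - i)) hz
    have hd' : ∀ τ, koszulD (𝕜 := 𝕜) ρ z' τ ∈ N := by
      intro τ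
      rw [← hN, ← congrFun (koszulD_comp ρ φ z') τ]
      have h1 := koszulD_mem_submodule ρ (z := z - fun σ => φ (z' σ)) hzz τ
      rw [map_sub] at h1
      have := N'.sub_mem (hdz τ) h1
      simpa using this
    obtain ⟨y, hy, hyz⟩ := h z' hz' hd'
    refine ⟨fun σ => φ (y σ), map_mem_koszulChain φ hφ hy, fun σ => ?_⟩
    rw [koszulD_comp]
    have h1 := (hN _).2 (hyz σ)
    have := N'.add_mem (hzz σ) h1
    simpa using this
  · intro h z hz hdz
    obtain ⟨y, hy, hyz⟩ := h (fun σ => φ (z σ)) (map_mem_koszulChain φ hφ hz) (fun τ => by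
      rw [koszulD_comp]; exact (hN _).2 (hdz τ))
    obtain ⟨y', hy', hyy⟩ := exists_koszulChain_lift (𝒜 := 𝒜) (fun x y => x - φ y ∈ N')
      (by simp) (hlift _) hy
    refine ⟨y', hy', fun σ => ?_⟩
    rw [← hN]
    have h1 := koszulD_mem_submodule ρ (z := y - fun σ => φ (y' σ)) hyy σ
    rw [map_sub, koszulD_comp] at h1
    have := N'.add_mem (hyz σ) h1
    simpa using this

/-- The grading of the free module `⨁ S(-deg a)`. -/
def freeDegree (𝕜 V : Type*) [Field 𝕜] {ι : Type*} (deg : ι → ℤ) (d : ℤ) :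
    AddSubgroup (ι → MvPolynomial V 𝕜) where
  carrier := {f | ∀ a, f a ∈ polyDegree 𝕜 V (d - deg a)}
  zero_mem' := fun _ => zero_mem _
  add_mem' := fun hf hg a => add_mem (hf a) (hg a)
  neg_mem' := fun hf a => neg_mem (hf a)

theorem isGradedFamily_freeDegree {ι : Type*} (deg : ι → ℤ) :
    IsGradedFamily (𝕜 := 𝕜) (V := V) (freeDegree 𝕜 V deg) := by
  intro d e p m hp hm a
  have := mul_mem_polyDegree hp (hm a)
  rwa [add_sub_assoc]

theorem exists_koszul_primitive_free {ι : Type*} {deg : ι → ℤ} {ρ : V → ℕ}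
    (hρ : Function.Injective ρ) {i : ℕ} {j : ℤ} {z : Finset V → ι → MvPolynomial V 𝕜}
    (hz : z ∈ koszulChain V (freeDegree 𝕜 V deg) i j) (hd : koszulD (𝕜 := 𝕜) ρ z = 0)
    (h0 : ∀ a, MvPolynomial.constantCoeff (z ∅ a) = 0) :
    ∃ y ∈ koszulChain V (freeDegree 𝕜 V deg) (i + 1) j, koszulD (𝕜 := 𝕜) ρ y = z := by
  have key : ∀ a, ∃ y ∈ koszulChain V (polyDegree 𝕜 V) (i + 1) (j - deg a),
      koszulD (𝕜 := 𝕜) ρ y = fun σ => z σ a := by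
    intro a
    refine exists_koszul_primitive hρ ⟨fun σ hσ => ?_, fun σ hσ => ?_⟩ ?_ (h0 a)
    · have := hz.1 σ hσ a
      rwa [sub_right_comm] at this
    · change z σ a = 0
      rw [hz.2 σ hσ]; rfl
    · have := koszulD_comp ρ (LinearMap.proj (R := MvPolynomial V 𝕜)
        (φ := fun _ : ι => MvPolynomial V 𝕜) a) z
      simp only [LinearMap.proj_apply] at this
      rw [this, hd]; rfl
  choose y hy hyz using key
  refine ⟨fun σ a => y a σ, ⟨fun σ hσ a => ?_, fun σ hσ => ?_⟩, ?_⟩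
  · have := (hy a).1 σ hσ
    rwa [sub_right_comm] at this
  · ext1 a; exact (hy a).2 σ hσ
  · ext1 σ; ext1 a
    have := koszulD_comp ρ (LinearMap.proj (R := MvPolynomial V 𝕜)
        (φ := fun _ : ι => MvPolynomial V 𝕜) a) fun σ a => y a σ
    simp only [LinearMap.proj_apply] at this
    rw [← congrFun this σ, hyz a]

/-- The component of degree `d ∈ ℤ` of a polynomial. -/
noncomputable def intComponent (d : ℤ) (p : MvPolynomial V 𝕜) : MvPolynomial V 𝕜 :=
  if 0 ≤ d then MvPolynomial.homogeneousComponent d.toNat p else 0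

theorem coeff_intComponent (d : ℤ) (p : MvPolynomial V 𝕜) (m : V →₀ ℕ) :
    (intComponent d p).coeff m = if (m.degree : ℤ) = d then p.coeff m else 0 := by
  unfold intComponent
  split_ifs with h1 h2 h2
  · rw [MvPolynomial.coeff_homogeneousComponent, if_pos (by omega)]
  · rw [MvPolynomial.coeff_homogeneousComponent, if_neg (by omega)]
  · omega
  · simp

theorem intComponent_mem (d : ℤ) (p : MvPolynomial V 𝕜) :
    intComponent d p ∈ polyDegree 𝕜 V d := by
  rw [mem_polyDegree]
  intro m hm
  rw [coeff_intComponent] at hm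
  by_contra h
  simp [h] at hm

theorem intComponent_eq_self {d : ℤ} {p : MvPolynomial V 𝕜} (hp : p ∈ polyDegree 𝕜 V d) :
    intComponent d p = p := by
  ext m
  rw [coeff_intComponent]
  split_ifs with h
  · rfl
  · by_contra h'
    exact h (mem_polyDegree.1 hp m (Ne.symm h'))

theorem intComponent_sub (d : ℤ) (p q : MvPolynomial V 𝕜) :
    intComponent d (p - q) = intComponent d p - intComponent d q := by
  ext m
  simp only [coeff_intComponent, MvPolynomial.coeff_sub]
  split_ifs <;> simp

theorem intComponent_sum {ι : Type*} (s : Finset ι) (d : ℤ) (f : ι → MvPolynomial V 𝕜) :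
    intComponent d (∑ a ∈ s, f a) = ∑ a ∈ s, intComponent d (f a) := by
  ext m
  simp only [coeff_intComponent, MvPolynomial.coeff_sum]
  split_ifs <;> simp

theorem intComponent_mul {d e : ℤ} {q : MvPolynomial V 𝕜} (hq : q ∈ polyDegree 𝕜 V d)
    (p : MvPolynomial V 𝕜) : intComponent (d + e) (q * p) = q * intComponent e p := by
  ext m
  rw [coeff_intComponent, MvPolynomial.coeff_mul, MvPolynomial.coeff_mul]
  have key : ∀ x ∈ antidiagonal m, q.coeff x.1 ≠ 0 →
      ((m.degree : ℤ) = d + e ↔ (x.2.degree : ℤ) = e) := by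
    intro x hx hq'
    have h1 := mem_polyDegree.1 hq _ hq'
    rw [← mem_antidiagonal.1 hx, map_add]
    push_cast
    omega
  have h0 : ∀ (P : Prop) [Decidable P] (c : 𝕜), (if P then c else 0) = c * if P then 1 else 0 := by
    intros; split_ifs <;> simp
  rw [h0, sum_mul]
  refine sum_congr rfl fun x hx => ?_
  rw [coeff_intComponent]
  by_cases hq' : q.coeff x.1 = 0
  · simp [hq']
  · simp only [key x hx hq', mul_ite, mul_zero, mul_one]

theorem linearMap_pi_apply {ι : Type*} [Fintype ι] [DecidableEq ι]
    (φ : (ι → MvPolynomial V 𝕜) →ₗ[MvPolynomial V 𝕜] M) (f : ι → MvPolynomial V 𝕜) :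
    φ f = ∑ b, f b • φ (Pi.single b 1) := by
  conv_lhs => rw [← univ_sum_single f, map_sum]
  refine sum_congr rfl fun b _ => ?_
  rw [← map_smul]
  congr 1
  rw [← Pi.single_smul', smul_eq_mul, mul_one]

/-- The component of degree `d` of an element of a graded free module. -/
noncomputable def freeComponent {ι : Type*} (deg : ι → ℤ) (d : ℤ) (f : ι → MvPolynomial V 𝕜) :
    ι → MvPolynomial V 𝕜 := fun a => intComponent (d - deg a) (f a)

theorem freeComponent_mem {ι : Type*} (deg : ι → ℤ) (d : ℤ) (f : ι → MvPolynomial V 𝕜) :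
    freeComponent deg d f ∈ freeDegree 𝕜 V deg d := fun _ => intComponent_mem _ _

theorem freeComponent_eq_self {ι : Type*} {deg : ι → ℤ} {d : ℤ} {f : ι → MvPolynomial V 𝕜}
    (hf : f ∈ freeDegree 𝕜 V deg d) : freeComponent deg d f = f :=
  funext fun a => intComponent_eq_self (hf a)

section Graded

variable {ι ι' : Type*} [Fintype ι'] [DecidableEq ι'] {deg : ι → ℤ} {deg' : ι' → ℤ}
  {δ : (ι' → MvPolynomial V 𝕜) →ₗ[MvPolynomial V 𝕜] (ι → MvPolynomial V 𝕜)}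

/-- This allows any preimage of a homogeneous element to be replaced by a homogeneous one. -/
theorem map_freeComponent (hδ : ∀ b a, δ (Pi.single b 1) a ∈ polyDegree 𝕜 V (deg' b - deg a))
    (d : ℤ) (f : ι' → MvPolynomial V 𝕜) :
    δ (freeComponent deg' d f) = freeComponent deg d (δ f) := by
  ext1 a
  rw [linearMap_pi_apply, freeComponent, linearMap_pi_apply δ f, Finset.sum_apply,
    Finset.sum_apply, intComponent_sum]
  refine sum_congr rfl fun b _ => ?_
  rw [Pi.smul_apply, Pi.smul_apply, smul_eq_mul, smul_eq_mul, mul_comm, mul_comm (f b),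
    show d - deg a = (deg' b - deg a) + (d - deg' b) by ring, intComponent_mul (hδ b a)]
  rfl

theorem map_mem_freeDegree (hδ : ∀ b a, δ (Pi.single b 1) a ∈ polyDegree 𝕜 V (deg' b - deg a))
    {d : ℤ} {f : ι' → MvPolynomial V 𝕜} (hf : f ∈ freeDegree 𝕜 V deg' d) :
    δ f ∈ freeDegree 𝕜 V deg d := by
  rw [← freeComponent_eq_self hf, map_freeComponent hδ]
  exact freeComponent_mem _ _ _

/-- Dimension shift along `0 → ker δ → F' → N → 0` inside the free module `F ⊇ N`. -/
theorem koszulVanishing_ker_iff {ρ : V → ℕ} (hρ : Function.Injective ρ)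
    (hδ : ∀ b a, δ (Pi.single b 1) a ∈ polyDegree 𝕜 V (deg' b - deg a))
    {N : Submodule (MvPolynomial V 𝕜) (ι → MvPolynomial V 𝕜)} (hN : ∀ x, x ∈ N ↔ ∃ y, δ y = x)
    (hmin : ∀ x ∈ N, ∀ a, MvPolynomial.constantCoeff (x a) = 0) (p : ℕ) (j : ℤ) :
    KoszulVanishing ρ (freeDegree 𝕜 V deg') (LinearMap.ker δ) p j ↔
      KoszulVanishing ρ (freeDegree 𝕜 V deg) N (p + 1) j := by
  have hlift : ∀ e, ∀ x ∈ freeDegree 𝕜 V deg e, x ∈ N → ∃ y ∈ freeDegree 𝕜 V deg' e, x = δ y := by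
    intro e x hx hxN
    obtain ⟨y, rfl⟩ := (hN x).1 hxN
    exact ⟨freeComponent deg' e y, freeComponent_mem _ _ _, by
      rw [map_freeComponent hδ, freeComponent_eq_self hx]⟩
  have chain_lift : ∀ {i : ℕ} {z : Finset V → ι → MvPolynomial V 𝕜},
      z ∈ koszulChain V (freeDegree 𝕜 V deg) i j → (∀ σ, z σ ∈ N) →
      ∃ y ∈ koszulChain V (freeDegree 𝕜 V deg') i j, z = fun σ => δ (y σ) := by
    intro i z hz hzN
    obtain ⟨y, hy, h⟩ := exists_koszulChain_lift (𝒜 := freeDegree 𝕜 V deg')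
      (fun x y => x ∈ N → x = δ y) (by simp) (fun x hx => by
        by_cases hxN : x ∈ N
        · obtain ⟨y, hy, h⟩ := hlift _ x hx hxN
          exact ⟨y, hy, fun _ => h⟩
        · exact ⟨0, zero_mem _, fun h => absurd h hxN⟩) hz
    exact ⟨y, hy, funext fun σ => h σ (hzN σ)⟩
  have hmap : ∀ {i : ℕ} {z : Finset V → ι' → MvPolynomial V 𝕜},
      z ∈ koszulChain V (freeDegree 𝕜 V deg') i j →
      (fun σ => δ (z σ)) ∈ koszulChain V (freeDegree 𝕜 V deg) i j := fun hz =>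
    map_mem_koszulChain δ (fun d x hx => map_mem_freeDegree hδ hx) hz
  have hδN : ∀ y, δ y ∈ N := fun y => (hN _).2 ⟨y, rfl⟩
  constructor
  -- The connecting map: the boundary of w lies in N and lifts to F', where it is a cycle modulo
  -- `ker δ`. Bounding the lift corrects w to a cycle of F, which is a boundary because the
  -- homological degree is positive.
  · intro h w hw hdw
    obtain ⟨z, hz, hwz⟩ := chain_lift
      (koszulD_mem_koszulChain (isGradedFamily_freeDegree deg) ρ hw) hdw
    have hdz : ∀ τ, koszulD (𝕜 := 𝕜) ρ z τ ∈ LinearMap.ker δ := by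
      intro τ
      rw [LinearMap.mem_ker, ← congrFun (koszulD_comp ρ δ z) τ, ← hwz, koszulD_koszulD hρ]
      rfl
    obtain ⟨u, hu, huz⟩ := h z hz hdz
    have h1 : koszulD (𝕜 := 𝕜) ρ (w - fun σ => δ (u σ)) = 0 := by
      rw [map_sub, hwz, koszulD_comp]
      ext1 σ
      have := huz σ
      rw [LinearMap.mem_ker, Pi.sub_apply, map_sub] at this
      exact this
    have hc := sub_mem hw (hmap hu)
    obtain ⟨y, hy, hyw⟩ := exists_koszul_primitive_free hρ hc h1 (fun a => by
      rw [hc.2 ∅ (by simp)]; simp)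
    refine ⟨y, hy, fun σ => ?_⟩
    rw [hyw]
    simpa using hδN (u σ)
  -- Conversely δ z is a cycle of F; `hmin` makes it a boundary even when p = 0.
  · intro h z hz hdz
    have hcyc : koszulD (𝕜 := 𝕜) ρ (fun σ => δ (z σ)) = 0 := by
      rw [koszulD_comp]
      exact funext fun τ => hdz τ
    obtain ⟨w, hw, hwz⟩ := exists_koszul_primitive_free hρ (hmap hz) hcyc
      (fun a => hmin _ (hδN _) a)
    obtain ⟨y, hy, hyw⟩ := h w hw (fun τ => by rw [hwz]; exact hδN _)
    obtain ⟨u, hu, hwu⟩ := chain_lift (sub_mem hw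
      (koszulD_mem_koszulChain (isGradedFamily_freeDegree deg) ρ hy)) hyw
    refine ⟨u, hu, fun σ => ?_⟩
    have h1 : koszulD (𝕜 := 𝕜) ρ (fun σ => δ (u σ)) = fun σ => δ (z σ) := by
      rw [← hwu, map_sub, hwz, koszulD_koszulD hρ, sub_zero]
    rw [koszulD_comp] at h1
    rw [LinearMap.mem_ker, Pi.sub_apply, map_sub, ← congrFun h1 σ, sub_self]

end Graded

/-- Since N lies in 𝔪F, the zeroth Koszul homology of F/N is F/𝔪F, whose degrees are those of the
basis. -/
theorem koszulVanishing_zero_iff {ι : Type*} {deg : ι → ℤ} {ρ : V → ℕ}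
    (hρ : Function.Injective ρ)
    {N : Submodule (MvPolynomial V 𝕜) (ι → MvPolynomial V 𝕜)}
    (hmin : ∀ x ∈ N, ∀ a, MvPolynomial.constantCoeff (x a) = 0) (j : ℤ) :
    KoszulVanishing ρ (freeDegree 𝕜 V deg) N 0 j ↔ ∀ a, deg a ≠ j := by
  classical
  constructor
  · rintro h a rfl
    set z : Finset V → ι → MvPolynomial V 𝕜 := fun σ => if σ = ∅ then Pi.single a 1 else 0
    have hz : z ∈ koszulChain V (freeDegree 𝕜 V deg) 0 (deg a) := by
      refine ⟨fun σ hσ b => ?_, fun σ hσ => if_neg (by rintro rfl; simp at hσ)⟩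
      rw [card_eq_zero] at hσ
      simp only [z, if_pos hσ]
      by_cases hb : b = a
      · subst hb
        simpa using monomial_mem_polyDegree (0 : V →₀ ℕ) (1 : 𝕜)
      · rw [Pi.single_eq_of_ne hb]; exact zero_mem _
    obtain ⟨y, -, hy⟩ := h z hz (fun τ => by
      rw [koszulD_eq_zero_of_zero_chain ρ hz]; exact zero_mem _)
    have := hmin _ (hy ∅) a
    simp [z, koszulD_apply] at this
  · intro h z hz _
    obtain ⟨y, hy, hyz⟩ := exists_koszul_primitive_free hρ hz (koszulD_eq_zero_of_zero_chain ρ hz)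
      (fun a => constantCoeff_eq_zero_of_mem_polyDegree (hz.1 ∅ rfl a) (by
        have := h a
        simp only [Nat.cast_zero, sub_zero]
        exact fun h' => this (sub_eq_zero.1 h').symm))
    exact ⟨y, hy, fun σ => by simp [hyz]⟩

/-- The submodule `N i ⊆ F i` with `F i / N i` the `i`-th syzygy module. -/
noncomputable def MinimalGradedFreeResolution.syzygy {I : Ideal (MvPolynomial V 𝕜)}
    (F : MinimalGradedFreeResolution I) :
    (i : ℕ) → Submodule (MvPolynomial V 𝕜) (Fin (F.rank i) → MvPolynomial V 𝕜)
  | 0 => LinearMap.ker F.aug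
  | i + 1 => LinearMap.ker (F.d i)

theorem MinimalGradedFreeResolution.mem_syzygy_iff {I : Ideal (MvPolynomial V 𝕜)}
    (F : MinimalGradedFreeResolution I) (i : ℕ) (x : Fin (F.rank i) → MvPolynomial V 𝕜) :
    x ∈ F.syzygy i ↔ ∃ y, F.d i y = x := by
  cases i with
  | zero => exact F.exact_zero x
  | succ i => exact F.exact_succ i x

theorem MinimalGradedFreeResolution.constantCoeff_eq_zero {I : Ideal (MvPolynomial V 𝕜)}
    (F : MinimalGradedFreeResolution I) (i : ℕ) (x : Fin (F.rank i) → MvPolynomial V 𝕜)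
    (hx : x ∈ F.syzygy i) (a : Fin (F.rank i)) : MvPolynomial.constantCoeff (x a) = 0 := by
  obtain ⟨y, rfl⟩ := (F.mem_syzygy_iff i x).1 hx
  rw [linearMap_pi_apply, Finset.sum_apply, map_sum]
  exact sum_eq_zero fun b _ => by simp [F.minimal i b a]

theorem MinimalGradedFreeResolution.koszulVanishing_syzygy {I : Ideal (MvPolynomial V 𝕜)}
    (F : MinimalGradedFreeResolution I) {ρ : V → ℕ} (hρ : Function.Injective ρ) (i p : ℕ) (j : ℤ) :
    KoszulVanishing ρ (freeDegree 𝕜 V (F.deg i)) (F.syzygy i) p j ↔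
      KoszulVanishing ρ (freeDegree 𝕜 V (F.deg 0)) (F.syzygy 0) (p + i) j := by
  induction i generalizing p with
  | zero => rfl
  | succ i ih =>
    rw [show p + (i + 1) = p + 1 + i by ring, ← ih]
    exact koszulVanishing_ker_iff hρ (F.d_graded i) (F.mem_syzygy_iff i)
      (F.constantCoeff_eq_zero i) p j

/-- The Betti numbers of `S / I` detect the Koszul homology of `S / I`. -/
theorem MinimalGradedFreeResolution.betti_eq_zero_iff {I : Ideal (MvPolynomial V 𝕜)}
    (hI : ∀ p ∈ I, ∀ d, intComponent d p ∈ I) (F : MinimalGradedFreeResolution I)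
    {ρ : V → ℕ} (hρ : Function.Injective ρ) (i : ℕ) (j : ℤ) :
    F.betti i j = 0 ↔ KoszulVanishing ρ (polyDegree 𝕜 V) I i j := by
  choose q hq hqI using F.aug_graded
  -- A graded lift of the augmentation to S, identifying F₀ modulo the first syzygies with S/I.
  set ψ : (Fin (F.rank 0) → MvPolynomial V 𝕜) →ₗ[MvPolynomial V 𝕜] MvPolynomial V 𝕜 :=
    ∑ a, (LinearMap.proj a).smulRight (q a) with hψ
  have hψ' : ∀ f, ψ f = ∑ a, f a * q a := by intro f; simp [hψ]
  have haug : ∀ f, F.aug f = Ideal.Quotient.mk I (ψ f) := by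
    intro f
    rw [linearMap_pi_apply, hψ', map_sum]
    refine sum_congr rfl fun a _ => ?_
    rw [hqI, map_mul]; rfl
  have hcomp : ∀ d f, ψ (freeComponent (F.deg 0) d f) = intComponent d (ψ f) := by
    intro d f
    rw [hψ', hψ', intComponent_sum]
    refine sum_congr rfl fun a _ => ?_
    rw [mul_comm, mul_comm (f a), freeComponent]
    conv_rhs => rw [show d = F.deg 0 a + (d - F.deg 0 a) by ring]
    rw [intComponent_mul (hq a)]
  have hquot := koszulVanishing_iff_of_quotient (𝒜 := freeDegree 𝕜 V (F.deg 0))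
    (ℬ := polyDegree 𝕜 V) ρ ψ (N := F.syzygy 0) (N' := I) (fun d x hx => by
      rw [← freeComponent_eq_self hx, hcomp]; exact intComponent_mem _ _)
    (fun x => by
      change _ ↔ F.aug x = 0
      rw [haug, Ideal.Quotient.eq_zero_iff_mem])
    (fun d x hx => by
      obtain ⟨f, hf⟩ := F.aug_surjective (Ideal.Quotient.mk I x)
      refine ⟨freeComponent (F.deg 0) d f, freeComponent_mem _ _ _, ?_⟩
      rw [haug, eq_comm, Ideal.Quotient.eq] at hf
      rw [hcomp, ← intComponent_eq_self hx, ← intComponent_sub]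
      exact hI _ hf d) i j
  rw [← hquot, ← zero_add i, ← F.koszulVanishing_syzygy hρ,
    koszulVanishing_zero_iff hρ (F.constantCoeff_eq_zero _), zero_add,
    MinimalGradedFreeResolution.betti, Fintype.card_eq_zero_iff]
  exact ⟨fun h a ha => h.false ⟨a, ha⟩, fun h => ⟨fun a => h a.1 a.2⟩⟩

end KoszulVanishing

/-! ### Existence of minimal graded free resolutions. -/

section Existence

variable {𝕜 V : Type*} [Field 𝕜] [Fintype V] [DecidableEq V]

/-- A family `g` of homogeneous generators of `N`, of degrees `e`. -/
def IsHomogeneousGenerating {ι κ : Type*} (deg : ι → ℤ)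
    (N : Submodule (MvPolynomial V 𝕜) (ι → MvPolynomial V 𝕜))
    (e : κ → ℤ) (g : κ → ι → MvPolynomial V 𝕜) : Prop :=
  (∀ b, g b ∈ freeDegree 𝕜 V deg (e b)) ∧ Submodule.span (MvPolynomial V 𝕜) (Set.range g) = N

theorem exists_sum_freeComponent {ι : Type*} [Fintype ι] (deg : ι → ℤ)
    (x : ι → MvPolynomial V 𝕜) :
    ∃ T : Finset ℤ, ∀ T' : Finset ℤ, T ⊆ T' → x = ∑ d ∈ T', freeComponent deg d x := by
  refine ⟨univ.biUnion fun a => (x a).support.image fun m => (m.degree : ℤ) + deg a,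
    fun T' hT => ?_⟩
  ext a m
  rw [Finset.sum_apply, MvPolynomial.coeff_sum]
  simp only [freeComponent, coeff_intComponent]
  by_cases h : (x a).coeff m = 0
  · simp [h]
  · have : (m.degree : ℤ) + deg a ∈ T' := hT (mem_biUnion.2 ⟨a, mem_univ a,
      mem_image.2 ⟨m, MvPolynomial.mem_support_iff.2 h, rfl⟩⟩)
    rw [sum_eq_single_of_mem _ this (fun d _ hd => if_neg (by intro h; apply hd; omega))]
    simp

/-- By Noetherianity there is a finite generating set; the homogeneous components of its members lie
in N and still generate. -/
theorem exists_isHomogeneousGenerating {r : ℕ} (deg : Fin r → ℤ)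
    (N : Submodule (MvPolynomial V 𝕜) (Fin r → MvPolynomial V 𝕜))
    (hN : ∀ x ∈ N, ∀ d, freeComponent deg d x ∈ N) :
    ∃ (k : ℕ) (e : Fin k → ℤ) (g : Fin k → Fin r → MvPolynomial V 𝕜),
      IsHomogeneousGenerating deg N e g := by
  obtain ⟨s, hs⟩ : N.FG := IsNoetherian.noetherian N
  choose T hT using exists_sum_freeComponent (𝕜 := 𝕜) (V := V) deg
  set D := s.biUnion T
  let φ := (Fintype.equivFin (s × D)).symm
  refine ⟨Fintype.card (s × D), fun b => (φ b).2.1,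
    fun b => freeComponent deg (φ b).2.1 (φ b).1.1, fun b => freeComponent_mem _ _ _, ?_⟩
  apply le_antisymm
  · rw [Submodule.span_le]
    rintro _ ⟨b, rfl⟩
    exact hN _ (hs ▸ Submodule.subset_span (φ b).1.2) _
  · rw [← hs, Submodule.span_le]
    intro x hx
    rw [SetLike.mem_coe, hT x D (subset_biUnion_of_mem T hx)]
    refine sum_mem fun d hd => Submodule.subset_span ⟨φ.symm (⟨x, hx⟩, ⟨d, hd⟩), ?_⟩
    simp

/-- A graded submodule of a graded free module, contained in its product with the irrelevant
ideal. -/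
structure SyzygyStage (𝕜 V : Type*) [Field 𝕜] [Fintype V] [DecidableEq V] where
  rank : ℕ
  deg : Fin rank → ℤ
  N : Submodule (MvPolynomial V 𝕜) (Fin rank → MvPolynomial V 𝕜)
  graded : ∀ x ∈ N, ∀ d, freeComponent deg d x ∈ N
  minimal : ∀ x ∈ N, ∀ a, MvPolynomial.constantCoeff (x a) = 0

theorem constantCoeff_intComponent_zero (p : MvPolynomial V 𝕜) :
    MvPolynomial.constantCoeff (intComponent 0 p) = MvPolynomial.constantCoeff p := by
  simp [MvPolynomial.constantCoeff_eq, coeff_intComponent]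

theorem eq_C_of_mem_polyDegree_zero {p : MvPolynomial V 𝕜} (hp : p ∈ polyDegree 𝕜 V 0) :
    p = MvPolynomial.C (MvPolynomial.constantCoeff p) := by
  ext m
  rw [MvPolynomial.coeff_C]
  split_ifs with h
  · rw [← h]; rfl
  · by_contra h'
    have := mem_polyDegree.1 hp m h'
    rw [Nat.cast_eq_zero, Finsupp.degree_eq_zero_iff] at this
    exact h this.symm

/-- Take homogeneous generators of least possible number. A syzygy with a nonzero constant
coefficient would express one generator through the others, so all syzygies lie in 𝔪F'. -/
theorem SyzygyStage.exists_next (s : SyzygyStage 𝕜 V) :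
    ∃ (s' : SyzygyStage 𝕜 V) (δ : (Fin s'.rank → MvPolynomial V 𝕜) →ₗ[MvPolynomial V 𝕜]
        (Fin s.rank → MvPolynomial V 𝕜)),
      (∀ b a, δ (Pi.single b 1) a ∈ polyDegree 𝕜 V (s'.deg b - s.deg a)) ∧
      (∀ x, x ∈ s.N ↔ ∃ y, δ y = x) ∧ s'.N = LinearMap.ker δ := by
  classical
  have hex := exists_isHomogeneousGenerating s.deg s.N s.graded
  obtain ⟨e, g, hg, hspan⟩ := Nat.find_spec hex
  have hmin := fun k => Nat.find_min (m := k) hex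
  revert e g hmin
  generalize Nat.find hex = k
  intro e g hg hspan hmin
  set δ : (Fin k → MvPolynomial V 𝕜) →ₗ[MvPolynomial V 𝕜] (Fin s.rank → MvPolynomial V 𝕜) :=
    Fintype.linearCombination (MvPolynomial V 𝕜) g with hδdef
  have hδ1 : ∀ b, δ (Pi.single b 1) = g b := by
    intro b; simp [hδdef, Fintype.linearCombination_apply_single]
  have hδ : ∀ b a, δ (Pi.single b 1) a ∈ polyDegree 𝕜 V (e b - s.deg a) := by
    intro b a; rw [hδ1]; exact hg b a
  have hrange : ∀ x, x ∈ s.N ↔ ∃ y, δ y = x := by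
    intro x
    rw [← hspan, ← Fintype.range_linearCombination, LinearMap.mem_range]
  refine ⟨⟨k, e, LinearMap.ker δ, ?_, ?_⟩, δ, hδ, hrange, rfl⟩
  · intro x hx d
    rw [LinearMap.mem_ker] at hx ⊢
    rw [map_freeComponent hδ, hx]
    ext a m
    simp [freeComponent, coeff_intComponent]
  · intro x hx a
    by_contra hc
    obtain ⟨k, rfl⟩ : ∃ k', k = k' + 1 := ⟨k - 1, by have := a.pos; omega⟩
    have hx' : δ (freeComponent e (e a) x) = 0 := by
      rw [map_freeComponent hδ, LinearMap.mem_ker.1 hx]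
      ext a m
      simp [freeComponent, coeff_intComponent]
    -- In degree `e a` the coefficient of the generator `g a` is a nonzero constant, so the relation
    -- can be solved for `g a`.
    set y := freeComponent e (e a) x with hy
    have hya : y a = MvPolynomial.C (MvPolynomial.constantCoeff (x a)) := by
      have h1 : y a = intComponent 0 (x a) := by rw [hy, freeComponent, sub_self]
      rw [h1, ← constantCoeff_intComponent_zero (x a)]
      exact eq_C_of_mem_polyDegree_zero (intComponent_mem _ _)
    have hga : g a ∈ Submodule.span (MvPolynomial V 𝕜) (Set.range fun b => g (a.succAbove b)) := by
      have h1 := hx'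
      rw [hδdef, Fintype.linearCombination_apply, Fin.sum_univ_succAbove _ a, hya] at h1
      have h2 : g a = (MvPolynomial.C (MvPolynomial.constantCoeff (x a))⁻¹ : MvPolynomial V 𝕜) •
          (MvPolynomial.C (MvPolynomial.constantCoeff (x a)) : MvPolynomial V 𝕜) • g a := by
        rw [smul_smul, ← MvPolynomial.C_mul, inv_mul_cancel₀ hc, MvPolynomial.C_1, one_smul]
      rw [h2, eq_neg_of_add_eq_zero_left h1]
      refine Submodule.smul_mem _ _ (neg_mem (sum_mem fun b _ => Submodule.smul_mem _ _ ?_))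
      exact Submodule.subset_span ⟨b, rfl⟩
    refine hmin k (Nat.lt_succ_self k) ⟨fun b => e (a.succAbove b), fun b => g (a.succAbove b),
      fun b => hg _, ?_⟩
    apply le_antisymm
    · rw [← hspan]
      exact Submodule.span_mono (by rintro _ ⟨b, rfl⟩; exact ⟨_, rfl⟩)
    · rw [← hspan, Submodule.span_le]
      rintro _ ⟨b, rfl⟩
      rcases Fin.eq_self_or_eq_succAbove a b with rfl | ⟨c, rfl⟩
      · exact hga
      · exact Submodule.subset_span ⟨c, rfl⟩

/-- A proper homogeneous ideal has a minimal graded free resolution. -/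
theorem nonempty_minimalGradedFreeResolution {I : Ideal (MvPolynomial V 𝕜)}
    (hI : ∀ p ∈ I, ∀ d, intComponent d p ∈ I) (hI1 : ∀ p ∈ I, MvPolynomial.constantCoeff p = 0) :
    Nonempty (MinimalGradedFreeResolution I) := by
  choose next δ hδ hrange hker using SyzygyStage.exists_next (𝕜 := 𝕜) (V := V)
  let π : (Fin 1 → MvPolynomial V 𝕜) →ₗ[MvPolynomial V 𝕜] MvPolynomial V 𝕜 := LinearMap.proj 0
  let s₀ : SyzygyStage 𝕜 V :=
    { rank := 1
      deg := fun _ => 0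
      N := Submodule.comap π I
      graded := fun x hx d => hI _ hx _
      minimal := fun x hx a => by
        rw [Subsingleton.elim a 0]; exact hI1 _ hx }
  let stage : ℕ → SyzygyStage 𝕜 V := fun i => Nat.rec s₀ (fun _ s => next s) i
  exact ⟨{
    rank := fun i => (stage i).rank
    deg := fun i => (stage i).deg
    d := fun i => δ (stage i)
    aug := (Submodule.mkQ I).comp π
    aug_surjective := by
      intro q
      obtain ⟨p, rfl⟩ := Submodule.mkQ_surjective I q
      exact ⟨fun _ => p, rfl⟩
    exact_zero := by
      intro x
      rw [LinearMap.comp_apply, Submodule.mkQ_apply, Submodule.Quotient.mk_eq_zero]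
      exact hrange s₀ x
    exact_succ := by
      intro i x
      rw [← LinearMap.mem_ker, ← hker (stage i)]
      exact hrange (stage (i + 1)) x
    aug_graded := fun a => ⟨1, by
      have h : (1 : MvPolynomial V 𝕜) ∈ polyDegree 𝕜 V 0 := by
        simpa using monomial_mem_polyDegree (0 : V →₀ ℕ) (1 : 𝕜)
      exact h, by
      rw [Subsingleton.elim (α := Fin 1) a 0]
      simp [π]⟩
    d_graded := fun i => hδ (stage i)
    minimal := fun i b a => (stage i).minimal _ ((hrange (stage i) _).2 ⟨_, rfl⟩) a }⟩

end Existence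

/-! ### Regularity bounds for monomial ideals from short exact sequences. -/

section MonomialIdeals

variable {𝕜 V : Type*} [Field 𝕜] [Fintype V] [DecidableEq V]

/-- The monomial ideal with exponent set `U`. -/
noncomputable def monomialIdeal (𝕜 : Type*) {V : Type*} [Field 𝕜] (U : Set (V →₀ ℕ)) :
    Ideal (MvPolynomial V 𝕜) :=
  Ideal.span ((fun g => MvPolynomial.monomial g (1 : 𝕜)) '' U)

theorem mem_monomialIdeal {U : Set (V →₀ ℕ)} (hU : IsUpperSet U) {p : MvPolynomial V 𝕜} :
    p ∈ monomialIdeal 𝕜 U ↔ ∀ m, p.coeff m ≠ 0 → m ∈ U := by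
  rw [monomialIdeal, MvPolynomial.mem_ideal_span_monomial_image]
  simp only [MvPolynomial.mem_support_iff]
  exact ⟨fun h m hm => let ⟨g, hg, hgm⟩ := h m hm; hU hgm hg, fun h m hm => ⟨m, h m hm, le_rfl⟩⟩

theorem monomialIdeal_mono {U U' : Set (V →₀ ℕ)} (h : U ⊆ U') :
    monomialIdeal 𝕜 U ≤ monomialIdeal 𝕜 U' :=
  Ideal.span_mono (Set.image_mono h)

theorem intComponent_mem_monomialIdeal {U : Set (V →₀ ℕ)} (hU : IsUpperSet U)
    {p : MvPolynomial V 𝕜} (hp : p ∈ monomialIdeal 𝕜 U) (d : ℤ) :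
    intComponent d p ∈ monomialIdeal 𝕜 U := by
  rw [mem_monomialIdeal hU] at hp ⊢
  intro m hm
  rw [coeff_intComponent] at hm
  exact hp m fun h => hm (by simp [h])

/-- Exponents of the colon ideal by the monomial with exponent `f`. -/
def colonSet (U : Set (V →₀ ℕ)) (f : V →₀ ℕ) : Set (V →₀ ℕ) := {g | f + g ∈ U}

theorem IsUpperSet.colonSet {U : Set (V →₀ ℕ)} (hU : IsUpperSet U) (f : V →₀ ℕ) :
    IsUpperSet (colonSet U f) := fun _ _ h hg => hU (add_le_add_right h f) hg

theorem monomial_mul_mem_monomialIdeal {U : Set (V →₀ ℕ)} (hU : IsUpperSet U) (f : V →₀ ℕ)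
    {p : MvPolynomial V 𝕜} :
    MvPolynomial.monomial f 1 * p ∈ monomialIdeal 𝕜 U ↔ p ∈ monomialIdeal 𝕜 (colonSet U f) := by
  rw [mem_monomialIdeal hU, mem_monomialIdeal (hU.colonSet f)]
  constructor
  · intro h m hm
    refine h (f + m) ?_
    rwa [MvPolynomial.coeff_monomial_mul, one_mul]
  · intro h m hm
    rw [MvPolynomial.coeff_monomial_mul'] at hm
    split_ifs at hm with hfm
    · rw [one_mul] at hm
      have := h _ hm
      rwa [colonSet, Set.mem_ofPred_eq, add_tsub_cancel_of_le hfm] at this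
    · exact absurd rfl hm

theorem divMonomial_mem_polyDegree' {p : MvPolynomial V 𝕜} {d : ℤ} (hp : p ∈ polyDegree 𝕜 V d)
    (f : V →₀ ℕ) : p.divMonomial f ∈ polyDegree 𝕜 V (d - f.degree) := by
  rw [mem_polyDegree]
  intro m hm
  rw [MvPolynomial.coeff_divMonomial] at hm
  have := mem_polyDegree.1 hp _ hm
  rw [map_add] at this
  push_cast at this
  omega

theorem divMonomial_mem_koszulChain {z : Finset V → MvPolynomial V 𝕜} {i : ℕ} {j : ℤ}
    (hz : z ∈ koszulChain V (polyDegree 𝕜 V) i j) (f : V →₀ ℕ) :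
    (fun σ => (z σ).divMonomial f) ∈ koszulChain V (polyDegree 𝕜 V) i (j - f.degree) := by
  refine ⟨fun σ hσ => ?_, fun σ hσ => ?_⟩
  · have := divMonomial_mem_polyDegree' (hz.1 σ hσ) f
    rwa [sub_right_comm] at this
  · change (z σ).divMonomial f = 0
    rw [hz.2 σ hσ, MvPolynomial.zero_divMonomial]

theorem monomial_smul_mem_koszulChain {z : Finset V → MvPolynomial V 𝕜} {i : ℕ} {j : ℤ}
    {f : V →₀ ℕ} (hz : z ∈ koszulChain V (polyDegree 𝕜 V) i (j - f.degree)) :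
    (MvPolynomial.monomial f (1 : 𝕜)) • z ∈ koszulChain V (polyDegree 𝕜 V) i j := by
  refine ⟨fun σ hσ => ?_, fun σ hσ => ?_⟩
  · have := mul_mem_polyDegree (monomial_mem_polyDegree f (1 : 𝕜)) (hz.1 σ hσ)
    rw [show (f.degree : ℤ) + (j - f.degree - i) = j - i by ring] at this
    exact this
  · rw [Pi.smul_apply, hz.2 σ hσ, smul_zero]

theorem isUpperSet_multiples (f : V →₀ ℕ) : IsUpperSet {g : V →₀ ℕ | f ≤ g} :=
  fun _ _ h h' => le_trans h' h

theorem sub_monomial_mul_divMonomial_mem {U : Set (V →₀ ℕ)} (hU : IsUpperSet U) {f : V →₀ ℕ}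
    {p : MvPolynomial V 𝕜} (hp : p ∈ monomialIdeal 𝕜 (U ∪ {g | f ≤ g})) :
    p - MvPolynomial.monomial f 1 * p.divMonomial f ∈ monomialIdeal 𝕜 U := by
  have h1 : p - MvPolynomial.monomial f 1 * p.divMonomial f = p.modMonomial f := by
    rw [sub_eq_iff_eq_add, MvPolynomial.modMonomial_add_divMonomial]
  rw [h1, mem_monomialIdeal hU]
  rw [mem_monomialIdeal (hU.union (isUpperSet_multiples f))] at hp
  intro m hm
  by_cases hfm : f ≤ m
  · rw [MvPolynomial.coeff_modMonomial_of_le _ hfm] at hm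
    exact absurd rfl hm
  · rw [MvPolynomial.coeff_modMonomial_of_not_le _ hfm] at hm
    exact (hp m hm).resolve_right hfm

/-- `reg (S / I) ≤ r` for the monomial ideal `I` with exponent set `U`, in terms of Koszul
homology. -/
def RegLE (𝕜 : Type*) {V : Type*} [Field 𝕜] [Fintype V] [DecidableEq V] (U : Set (V →₀ ℕ))
    (r : ℤ) : Prop :=
  ∀ ρ : V → ℕ, Function.Injective ρ → ∀ (i : ℕ) (j : ℤ), i + r < j →
    KoszulVanishing ρ (polyDegree 𝕜 V) (monomialIdeal 𝕜 U) i j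

theorem RegLE.mono {U : Set (V →₀ ℕ)} {r r' : ℤ} (h : RegLE 𝕜 U r) (hr : r ≤ r') :
    RegLE 𝕜 U r' := fun ρ hρ i j hij => h ρ hρ i j (by omega)

theorem regLE_of_zero_mem {U : Set (V →₀ ℕ)} (h : 0 ∈ U) (r : ℤ) : RegLE 𝕜 U r := by
  intro ρ _ i j _ z _ _
  have : monomialIdeal 𝕜 U = ⊤ := by
    rw [Ideal.eq_top_iff_one]
    exact Ideal.subset_span ⟨0, h, rfl⟩
  exact ⟨0, zero_mem _, fun σ => by rw [this]; trivial⟩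

theorem regLE_empty {r : ℤ} (hr : 0 ≤ r) : RegLE 𝕜 (∅ : Set (V →₀ ℕ)) r := by
  intro ρ hρ i j hij z hz hdz
  have hbot : monomialIdeal 𝕜 (∅ : Set (V →₀ ℕ)) = ⊥ := by simp [monomialIdeal]
  simp only [hbot, Ideal.mem_bot] at hdz ⊢
  obtain ⟨y, hy, rfl⟩ := exists_koszul_primitive hρ hz (funext hdz) (by
    by_cases hi : i = 0
    · subst hi
      exact constantCoeff_eq_zero_of_mem_polyDegree (hz.1 ∅ rfl)
        (by simp only [Nat.cast_zero] at hij ⊢; omega)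
    · rw [hz.2 ∅ (by simpa using Ne.symm hi), map_zero])
  exact ⟨y, hy, by simp⟩

/-- The middle term of 0 → S/(I : f)(-deg f) → S/I → S/(I, f) → 0 is controlled by the outer two. -/
theorem regLE_of_colonSet {U : Set (V →₀ ℕ)} (hU : IsUpperSet U) (f : V →₀ ℕ) {r : ℤ}
    (h1 : RegLE 𝕜 (colonSet U f) (r - f.degree)) (h2 : RegLE 𝕜 (U ∪ {g | f ≤ g}) r) :
    RegLE 𝕜 U r := by
  intro ρ hρ i j hij z hz hdz
  obtain ⟨y, hy, hyz⟩ := h2 ρ hρ i j hij z hz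
    (fun τ => monomialIdeal_mono Set.subset_union_left (hdz τ))
  set w := z - koszulD (𝕜 := 𝕜) ρ y with hw
  have hwc : w ∈ koszulChain V (polyDegree 𝕜 V) i j :=
    sub_mem hz (koszulD_mem_koszulChain isGradedFamily_polyDegree ρ hy)
  set s : Finset V → MvPolynomial V 𝕜 := fun σ => (w σ).divMonomial f
  have hsub : ∀ σ, (w - MvPolynomial.monomial f (1 : 𝕜) • s) σ ∈ monomialIdeal 𝕜 U :=
    fun σ => sub_monomial_mul_divMonomial_mem hU (hyz σ)
  obtain ⟨u, hu, hus⟩ := h1 ρ hρ i (j - f.degree) (by omega) s (divMonomial_mem_koszulChain hwc f)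
    (by
      intro τ
      rw [← monomial_mul_mem_monomialIdeal hU]
      have h3 := koszulD_mem_submodule ρ hsub τ
      rw [map_sub, hw, map_sub, koszulD_koszulD hρ, sub_zero, map_smul] at h3
      have h4 := Ideal.sub_mem _ (hdz τ) h3
      simpa using h4)
  refine ⟨y + MvPolynomial.monomial f (1 : 𝕜) • u,
    add_mem hy (monomial_smul_mem_koszulChain hu), fun σ => ?_⟩
  have h3 := (monomial_mul_mem_monomialIdeal hU f).2 (hus σ)
  have h4 := Ideal.add_mem _ (hsub σ) h3
  rw [map_add, ← sub_sub, ← hw, map_smul]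
  convert h4 using 1
  simp only [Pi.sub_apply, Pi.smul_apply, smul_eq_mul]
  ring

/-- The same sequence, now bounding the right-hand term; the connecting map lowers the homological
degree, whence the extra 1 for the colon ideal. -/
theorem regLE_union_multiples {U : Set (V →₀ ℕ)} (hU : IsUpperSet U) (f : V →₀ ℕ) {r : ℤ}
    (h1 : RegLE 𝕜 U r) (h2 : RegLE 𝕜 (colonSet U f) (r + 1 - f.degree)) :
    RegLE 𝕜 (U ∪ {g | f ≤ g}) r := by
  intro ρ hρ i j hij z hz hdz
  have hle := monomialIdeal_mono (𝕜 := 𝕜) (U := U) (U' := U ∪ {g | f ≤ g}) Set.subset_union_left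
  rcases i with _ | i
  · obtain ⟨y, hy, hyz⟩ := h1 ρ hρ 0 j hij z hz (fun τ => by
      rw [koszulD_eq_zero_of_zero_chain ρ hz]; exact zero_mem _)
    exact ⟨y, hy, fun σ => hle (hyz σ)⟩
  · set w := koszulD (𝕜 := 𝕜) ρ z with hw
    have hwc : w ∈ koszulChain V (polyDegree 𝕜 V) i j :=
      koszulD_mem_koszulChain isGradedFamily_polyDegree ρ hz
    set s : Finset V → MvPolynomial V 𝕜 := fun σ => (w σ).divMonomial f
    have hsub : ∀ σ, (w - MvPolynomial.monomial f (1 : 𝕜) • s) σ ∈ monomialIdeal 𝕜 U :=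
      fun σ => sub_monomial_mul_divMonomial_mem hU (hdz σ)
    push_cast at hij
    obtain ⟨u, hu, hus⟩ := h2 ρ hρ i (j - f.degree) (by omega) s
      (divMonomial_mem_koszulChain hwc f) (by
        intro τ
        rw [← monomial_mul_mem_monomialIdeal hU]
        have h3 := koszulD_mem_submodule ρ hsub τ
        rw [map_sub, hw, koszulD_koszulD hρ, zero_sub, map_smul] at h3
        have h4 := neg_mem h3
        simpa using h4)
    obtain ⟨y, hy, hyz⟩ := h1 ρ hρ (i + 1) j (by push_cast; omega)
      (z - MvPolynomial.monomial f (1 : 𝕜) • u) (sub_mem hz (monomial_smul_mem_koszulChain hu)) (by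
        intro τ
        have h3 := (monomial_mul_mem_monomialIdeal hU f).2 (hus τ)
        have h4 := Ideal.add_mem _ (hsub τ) h3
        rw [map_sub, ← hw, map_smul]
        convert h4 using 1
        simp only [Pi.sub_apply, Pi.smul_apply, smul_eq_mul]
        ring)
    refine ⟨y, hy, fun σ => ?_⟩
    have h3 : MvPolynomial.monomial f (1 : 𝕜) * u σ ∈ monomialIdeal 𝕜 (U ∪ {g | f ≤ g}) :=
      Ideal.mul_mem_right _ _ (Ideal.subset_span ⟨f, Or.inr (le_refl f), rfl⟩)
    have h4 := Ideal.add_mem _ (hle (hyz σ)) h3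
    convert h4 using 1
    simp only [Pi.sub_apply, Pi.smul_apply, smul_eq_mul]
    ring

open Classical in
/-- The part of a polynomial with exponents in `U`. -/
noncomputable def supportPart (U : Set (V →₀ ℕ)) (p : MvPolynomial V 𝕜) : MvPolynomial V 𝕜 :=
  ∑ m ∈ p.support with m ∈ U, MvPolynomial.monomial m (p.coeff m)

open Classical in
theorem coeff_supportPart (U : Set (V →₀ ℕ)) (p : MvPolynomial V 𝕜) (m : V →₀ ℕ) :
    (supportPart U p).coeff m = if m ∈ U then p.coeff m else 0 := by
  simp only [supportPart, MvPolynomial.coeff_sum, MvPolynomial.coeff_monomial]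
  rw [sum_ite_eq' (s := {m ∈ p.support | m ∈ U})]
  by_cases h : p.coeff m = 0 <;> simp [h]

/-- Mayer–Vietoris for 0 → S/(I ∩ J) → S/I ⊕ S/J → S/(I + J) → 0. -/
theorem regLE_union {U U' : Set (V →₀ ℕ)} (hU : IsUpperSet U) (hU' : IsUpperSet U') {r : ℤ}
    (h1 : RegLE 𝕜 U r) (h2 : RegLE 𝕜 U' r) (h3 : RegLE 𝕜 (U ∩ U') (r + 1)) :
    RegLE 𝕜 (U ∪ U') r := by
  intro ρ hρ i j hij z hz hdz
  have hle := monomialIdeal_mono (𝕜 := 𝕜) (U := U) (U' := U ∪ U') Set.subset_union_left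
  have hle' := monomialIdeal_mono (𝕜 := 𝕜) (U := U') (U' := U ∪ U') Set.subset_union_right
  have hinf : ∀ p, p ∈ monomialIdeal 𝕜 U → p ∈ monomialIdeal 𝕜 U' →
      p ∈ monomialIdeal 𝕜 (U ∩ U') := by
    intro p hp hp'
    rw [mem_monomialIdeal hU] at hp
    rw [mem_monomialIdeal hU'] at hp'
    rw [mem_monomialIdeal (hU.inter hU')]
    exact fun m hm => ⟨hp m hm, hp' m hm⟩
  rcases i with _ | i
  · obtain ⟨y, hy, hyz⟩ := h1 ρ hρ 0 j hij z hz (fun τ => by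
      rw [koszulD_eq_zero_of_zero_chain ρ hz]; exact zero_mem _)
    exact ⟨y, hy, fun σ => hle (hyz σ)⟩
  · push_cast at hij
    set w := koszulD (𝕜 := 𝕜) ρ z with hw
    have hwc : w ∈ koszulChain V (polyDegree 𝕜 V) i j :=
      koszulD_mem_koszulChain isGradedFamily_polyDegree ρ hz
    -- Splitting the boundary of z into its part in I and a rest in J: the part in I is a cycle
    -- modulo I ∩ J representing the connecting class.
    set q : Finset V → MvPolynomial V 𝕜 := fun σ => supportPart U (w σ) with hq
    have hqU : ∀ σ, q σ ∈ monomialIdeal 𝕜 U := by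
      intro σ
      rw [mem_monomialIdeal hU]
      intro m hm
      rw [hq, coeff_supportPart] at hm
      by_contra h
      simp [h] at hm
    have hwqU : ∀ σ, (w - q) σ ∈ monomialIdeal 𝕜 U' := by
      intro σ
      rw [mem_monomialIdeal hU']
      intro m hm
      rw [Pi.sub_apply, MvPolynomial.coeff_sub, hq, coeff_supportPart] at hm
      by_cases h : m ∈ U
      · simp [h] at hm
      · simp only [h, if_false, sub_zero] at hm
        exact ((mem_monomialIdeal (hU.union hU')).1 (hdz σ) m hm).resolve_left h
    have hqc : q ∈ koszulChain V (polyDegree 𝕜 V) i j := by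
      refine ⟨fun σ hσ => ?_, fun σ hσ => ?_⟩
      · rw [mem_polyDegree]
        intro m hm
        rw [hq, coeff_supportPart] at hm
        exact mem_polyDegree.1 (hwc.1 σ hσ) m fun h => hm (by simp [h])
      · ext m
        rw [hq, coeff_supportPart, hwc.2 σ hσ]
        simp
    obtain ⟨y, hy, hyq⟩ := h3 ρ hρ i j (by omega) q hqc (fun τ => by
      refine hinf _ (koszulD_mem_submodule ρ hqU τ) ?_
      have h4 := koszulD_mem_submodule ρ hwqU τ
      rw [map_sub, hw, koszulD_koszulD hρ, zero_sub] at h4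
      have h5 := neg_mem h4
      simpa using h5)
    have hyU : ∀ τ, koszulD (𝕜 := 𝕜) ρ y τ ∈ monomialIdeal 𝕜 U := by
      intro τ
      have h4 := Ideal.sub_mem _ (hqU τ) (monomialIdeal_mono Set.inter_subset_left (hyq τ))
      simpa using h4
    obtain ⟨u, hu, huy⟩ := h1 ρ hρ (i + 1) j (by push_cast; omega) y hy hyU
    obtain ⟨u', hu', huy'⟩ := h2 ρ hρ (i + 1) j (by push_cast; omega) (z - y) (sub_mem hz hy) (by
      intro τ
      have h4 := Ideal.add_mem _ (hwqU τ) (monomialIdeal_mono Set.inter_subset_right (hyq τ))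
      rw [map_sub, ← hw]
      simpa using h4)
    refine ⟨u + u', add_mem hu hu', fun σ => ?_⟩
    have h4 := Ideal.add_mem _ (hle (huy σ)) (hle' (huy' σ))
    rw [map_add]
    convert h4 using 1
    simp only [Pi.sub_apply, Pi.add_apply]
    ring

theorem regLE_multiples (f : V →₀ ℕ) : RegLE 𝕜 {g | f ≤ g} (f.degree - 1) := by
  by_cases hf : f = 0
  · exact regLE_of_zero_mem (by simp [hf]) _
  · have : 0 < f.degree := by
      rw [Nat.pos_iff_ne_zero]; exact fun h => hf ((Finsupp.degree_eq_zero_iff f).1 h)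
    rw [← Set.empty_union {g | f ≤ g}]
    exact regLE_union_multiples isUpperSet_empty f (regLE_empty (by omega))
      (regLE_empty (by omega))

theorem isUpperSet_image_add {U : Set (V →₀ ℕ)} (hU : IsUpperSet U) (f : V →₀ ℕ) :
    IsUpperSet ((fun g => f + g) '' U) := by
  rintro _ m h ⟨g, hg, rfl⟩
  obtain ⟨k, rfl⟩ := exists_add_of_le h
  exact ⟨g + k, hU (by simp) hg, by simp only [add_assoc]⟩

/-- The colon of f·J by f is J, and adding f gives the principal ideal (f), of regularity at most
deg f - 1; this is why r ≥ -1 is needed. -/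
theorem RegLE.image_add {U : Set (V →₀ ℕ)} (hU : IsUpperSet U) {r : ℤ} (h : RegLE 𝕜 U r)
    (hr : -1 ≤ r) (f : V →₀ ℕ) : RegLE 𝕜 ((fun g => f + g) '' U) (f.degree + r) := by
  apply regLE_of_colonSet (isUpperSet_image_add hU f) f
  · have : colonSet ((fun g => f + g) '' U) f = U := by
      ext g; simp [colonSet]
    rw [this]
    exact h.mono (by omega)
  · have : (fun g => f + g) '' U ∪ {g | f ≤ g} = {g | f ≤ g} := by
      apply Set.union_eq_right.2
      rintro _ ⟨g, -, rfl⟩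
      simp
    rw [this]
    exact (regLE_multiples f).mono (by omega)

/-- Exponents divisible by some variable in `K`. -/
def killSet (K : Finset V) : Set (V →₀ ℕ) := {g | ∃ v ∈ K, g v ≠ 0}

theorem isUpperSet_killSet (K : Finset V) : IsUpperSet (killSet K) := by
  rintro a b h ⟨v, hv, ha⟩
  exact ⟨v, hv, fun hb => ha (by have := h v; omega)⟩

theorem killSet_insert (K : Finset V) (v : V) :
    killSet (insert v K) = killSet K ∪ {g : V →₀ ℕ | Finsupp.single v 1 ≤ g} := by
  ext g
  simp [killSet, Nat.one_le_iff_ne_zero, or_comm]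

theorem colonSet_killSet {K : Finset V} {v : V} (hv : v ∉ K) :
    colonSet (killSet K) (Finsupp.single v 1) = killSet K := by
  ext g
  simp only [colonSet, killSet, Set.mem_ofPred_eq]
  refine exists_congr fun u => and_congr_right fun hu => ?_
  rw [Finsupp.add_apply, Finsupp.single_eq_of_ne (show u ≠ v by rintro rfl; exact hv hu), zero_add]

theorem regLE_killSet (K : Finset V) {r : ℤ} (hr : 0 ≤ r) : RegLE 𝕜 (killSet K) r := by
  induction K using Finset.induction_on with
  | empty =>
    have : killSet (∅ : Finset V) = ∅ := by ext; simp [killSet]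
    rw [this]
    exact regLE_empty hr
  | insert v K hv ih =>
    rw [killSet_insert]
    refine regLE_union_multiples (isUpperSet_killSet K) _ ih ?_
    rw [colonSet_killSet hv, Finsupp.degree_single]
    exact ih.mono (by simp)

/-- Branching on the variable `v`: either set it to zero or pass to the colon ideal. -/
theorem regLE_branch {U : Set (V →₀ ℕ)} (hU : IsUpperSet U) {K : Finset V} {v : V} (hv : v ∉ K)
    {r : ℤ} (h1 : RegLE 𝕜 (U ∪ killSet (insert v K)) r)
    (h2 : RegLE 𝕜 (colonSet U (Finsupp.single v 1) ∪ killSet K) (r - 1)) :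
    RegLE 𝕜 (U ∪ killSet K) r := by
  refine regLE_of_colonSet (hU.union (isUpperSet_killSet K)) (Finsupp.single v 1) ?_ ?_
  · have : colonSet (U ∪ killSet K) (Finsupp.single v 1) =
        colonSet U (Finsupp.single v 1) ∪ killSet K := by
      conv_rhs => rw [← colonSet_killSet hv]
      rfl
    rw [this, Finsupp.degree_single]
    exact h2
  · rwa [Set.union_assoc, ← killSet_insert]

end MonomialIdeals

/-! ### Ideals defined by vertex covers; powers of edge ideals of linear forests. -/

section Covers

variable {𝕜 V : Type*} [Field 𝕜] [Fintype V] [DecidableEq V]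

/-- The exponents `g` whose weight on every member `C` of `𝒞` is at least `k - φ C`. -/
def coverSet (𝒞 : Set (Finset V)) (φ : Finset V → ℕ) (k : ℕ) : Set (V →₀ ℕ) :=
  {g | ∀ C ∈ 𝒞, k ≤ φ C + ∑ v ∈ C, g v}

theorem isUpperSet_coverSet (𝒞 : Set (Finset V)) (φ : Finset V → ℕ) (k : ℕ) :
    IsUpperSet (coverSet 𝒞 φ k) := fun _ _ h hg C hC =>
  (hg C hC).trans (add_le_add_right (sum_le_sum fun v _ => h v) _)

theorem zero_mem_coverSet {𝒞 : Set (Finset V)} {φ : Finset V → ℕ} {k : ℕ}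
    (h : ∀ C ∈ 𝒞, k ≤ φ C) : (0 : V →₀ ℕ) ∈ coverSet 𝒞 φ k := fun C hC => by
  simpa using h C hC

theorem sum_single_add (C : Finset V) (v : V) (g : V →₀ ℕ) :
    ∑ u ∈ C, (Finsupp.single v 1 + g : V →₀ ℕ) u = (if v ∈ C then 1 else 0) + ∑ u ∈ C, g u := by
  simp only [Finsupp.add_apply, sum_add_distrib, Finsupp.single_apply]
  rw [sum_ite_eq]

/-- Ideals of cover type are closed under colon by a variable: only the discount φ changes, which
makes branching on variables an induction inside this class. -/
theorem colonSet_coverSet (𝒞 : Set (Finset V)) (φ : Finset V → ℕ) (k : ℕ) (v : V) :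
    colonSet (coverSet 𝒞 φ k) (Finsupp.single v 1) =
      coverSet 𝒞 (fun C => φ C + if v ∈ C then 1 else 0) k := by
  ext g
  refine forall₂_congr fun C _ => ?_
  rw [sum_single_add, add_assoc]

theorem regLE_coverSet_branch {𝒞 : Set (Finset V)} {φ : Finset V → ℕ} {k : ℕ} {K : Finset V}
    {v : V} (hv : v ∉ K) {r : ℤ}
    (h1 : RegLE 𝕜 (coverSet 𝒞 φ k ∪ killSet (insert v K)) r)
    (h2 : RegLE 𝕜 (coverSet 𝒞 (fun C => φ C + if v ∈ C then 1 else 0) k ∪ killSet K) (r - 1)) :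
    RegLE 𝕜 (coverSet 𝒞 φ k ∪ killSet K) r :=
  regLE_branch (isUpperSet_coverSet _ _ _) hv h1 (by rwa [colonSet_coverSet])

/-- Vertices of K carry exponent 0 outside the ideal of the killed variables, so a cover may use
them for free; each inequality then follows from the one for a cheaper cover. -/
theorem coverSet_union_killSet_subset {𝒞 𝒞' : Set (Finset V)} {φ φ' : Finset V → ℕ} {k k' : ℕ}
    {K : Finset V} (h : ∀ C ∈ 𝒞, ∃ C' ∈ 𝒞', C' ⊆ C ∪ K ∧ k + φ' C' ≤ k' + φ C) :
    coverSet 𝒞' φ' k' ∪ killSet K ⊆ coverSet 𝒞 φ k ∪ killSet K := by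
  rintro g (hg | hg)
  · by_cases hK : g ∈ killSet K
    · exact Or.inr hK
    refine Or.inl fun C hC => ?_
    obtain ⟨C', hC', hsub, hle⟩ := h C hC
    have h1 := hg C' hC'
    have h2 : ∑ v ∈ C', g v ≤ ∑ v ∈ C, g v := by
      refine sum_le_sum_of_ne_zero fun v hv hgv => ?_
      rcases mem_union.1 (hsub hv) with h | h
      · exact h
      · exact absurd ⟨v, h, hgv⟩ hK
    omega
  · exact Or.inr hg

theorem regLE_coverSet_congr {𝒞 𝒞' : Set (Finset V)} {φ φ' : Finset V → ℕ} {k k' : ℕ}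
    {K : Finset V} {r : ℤ} (h : RegLE 𝕜 (coverSet 𝒞' φ' k' ∪ killSet K) r)
    (h1 : ∀ C ∈ 𝒞, ∃ C' ∈ 𝒞', C' ⊆ C ∪ K ∧ k + φ' C' ≤ k' + φ C)
    (h2 : ∀ C ∈ 𝒞', ∃ C' ∈ 𝒞, C' ⊆ C ∪ K ∧ k' + φ C' ≤ k + φ' C) :
    RegLE 𝕜 (coverSet 𝒞 φ k ∪ killSet K) r := by
  rwa [(coverSet_union_killSet_subset h2).antisymm (coverSet_union_killSet_subset h1)]

theorem regLE_coverSet_of_empty_mem {𝒞 : Set (Finset V)} {φ : Finset V → ℕ} {k : ℕ}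
    (K : Finset V) {r : ℤ} (hr : 0 ≤ r) (h : ∃ C ∈ 𝒞, C ⊆ K ∧ φ C < k) :
    RegLE 𝕜 (coverSet 𝒞 φ k ∪ killSet K) r := by
  obtain ⟨C, hC, hCK, hφ⟩ := h
  have : coverSet 𝒞 φ k ∪ killSet K = killSet K := by
    refine Set.union_eq_right.2 fun g hg => ?_
    by_contra hK
    have h1 := hg C hC
    have h2 : ∑ v ∈ C, g v = 0 := sum_eq_zero fun v hv => by
      by_contra h
      exact hK ⟨v, hCK hv, h⟩
    omega
  rw [this]
  exact regLE_killSet K hr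

theorem regLE_coverSet_of_le {𝒞 : Set (Finset V)} {φ : Finset V → ℕ} {k : ℕ}
    (K : Finset V) (r : ℤ) (h : ∀ C ∈ 𝒞, k ≤ φ C) :
    RegLE 𝕜 (coverSet 𝒞 φ k ∪ killSet K) r :=
  regLE_of_zero_mem (Or.inl (zero_mem_coverSet h)) r

/-- The vertex covers of the graph with edges `y i — y (i + 1)`, `i ∈ I`. -/
def lineCovers (y : ℕ → V) (I : Finset ℕ) : Set (Finset V) :=
  {C | ∀ i ∈ I, y i ∈ C ∨ y (i + 1) ∈ C}

theorem lineCovers_anti (y : ℕ → V) {I J : Finset ℕ} (h : I ⊆ J) :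
    lineCovers y J ⊆ lineCovers y I := fun _ hC i hi => hC i (h hi)

/-- Powers of edge ideals of linear forests on `ℓ` vertices. -/
theorem regLE_lineCovers (y : ℕ → V) (ℓ : ℕ) (hy : Set.InjOn y (Set.Iio ℓ)) (I : Finset ℕ)
    (hI : ∀ i ∈ I, i + 1 < ℓ) (k : ℕ) (K : Finset V) (hK : ∀ i < ℓ, y i ∉ K) :
    RegLE 𝕜 (coverSet (lineCovers y I) (fun _ => 0) (k + 1) ∪ killSet K)
      (2 * (k : ℤ) + ((2 * ℓ - I.card) / 3 : ℕ)) := by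
  -- Here 2ℓ - |I| is the number of vertices plus the number of components, so a full path gets the
  -- value ⌊(ℓ + 1)/3⌋.
  induction ℓ using Nat.strong_induction_on generalizing I k K with
  | _ ℓ ih =>
  rcases I.eq_empty_or_nonempty with rfl | ⟨i₀, hi₀⟩
  · exact regLE_coverSet_of_empty_mem K (by positivity) ⟨∅, by simp [lineCovers], by simp, by simp⟩
  obtain ⟨m, rfl⟩ : ∃ m, ℓ = m + 2 := ⟨ℓ - 2, by have := hI i₀ hi₀; omega⟩
  have hinj : ∀ {a b : ℕ}, a < m + 2 → b < m + 2 → y a = y b → a = b :=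
    fun ha hb h => hy ha hb h
  have hsubinj : ∀ {n : ℕ}, n ≤ m + 2 → Set.InjOn y (Set.Iio n) :=
    fun hn => hy.mono (Set.Iio_subset_Iio hn)
  have hcardI : I.card ≤ m + 1 := by
    have : I ⊆ range (m + 1) := fun i hi => mem_range.2 (by have := hI i hi; omega)
    simpa using card_le_card this
  by_cases htop : m ∈ I
  swap
  · refine (ih (m + 1) (by omega) (hsubinj (by omega)) I (fun i hi => ?_) k K
      (fun i hi => hK i (by omega))).mono ?_
    · have h1 := hI i hi
      have h2 : i ≠ m := fun h => htop (h ▸ hi)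
      omega
    · gcongr; omega
  have huv : y (m + 1) ≠ y m := fun h => by have := hinj (by omega) (by omega) h; omega
  induction k using Nat.strong_induction_on with
  | _ k ihk =>
  have hlow : ∀ c : ℕ, I.card ≤ c + (I.filter fun i => i + c < m + 1).card := by
    intro c
    have h1 : I ⊆ (I.filter fun i => i + c < m + 1) ∪ Ico (m + 1 - c) (m + 1) := by
      intro i hi
      have := hI i hi
      simp only [mem_union, mem_filter, mem_Ico]
      by_cases h : i + c < m + 1
      · exact Or.inl ⟨hi, h⟩
      · right; omega
    have h2 := (card_le_card h1).trans (card_union_le _ _)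
    rw [Nat.card_Ico] at h2
    omega
  have hKu : y (m + 1) ∉ K := hK _ (by omega)
  have hKv : y m ∉ K := hK _ (by omega)
  have hKinsert : ∀ {n : ℕ} {K' : Finset V} {j : ℕ}, n ≤ j → j < m + 2 → (∀ i < n, y i ∉ K') →
      ∀ i < n, y i ∉ insert (y j) K' := by
    intro n K' j hnj hj hK' i hi h
    rcases mem_insert.1 h with h | h
    · have := hinj (by omega) hj h; omega
    · exact hK' i hi h
  refine regLE_coverSet_branch hKv ?_ (regLE_coverSet_branch hKu ?_ ?_)
  -- The neighbour of the leaf is zero: two vertices and at most two edges disappear.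
  · have hc := hlow 2
    refine (regLE_coverSet_congr (ih m (by omega) (hsubinj (by omega))
      (I.filter fun i => i + 2 < m + 1) (fun i hi => ?_) k (insert (y m) K)
      (hKinsert le_rfl (by omega) fun i hi => hK i (by omega))) ?_ ?_).mono ?_
    · have := (mem_filter.1 hi).2; omega
    · exact fun C hC => ⟨C, lineCovers_anti y (filter_subset _ _) hC, subset_union_left, le_rfl⟩
    · refine fun C hC => ⟨insert (y m) C, fun i hi => ?_, ?_, le_rfl⟩
      · have h1 := hI i hi
        by_cases h2 : i + 2 < m + 1
        · exact (hC i (mem_filter.2 ⟨hi, h2⟩)).imp (mem_insert_of_mem) (mem_insert_of_mem)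
        · obtain rfl | rfl : i = m ∨ i + 1 = m := by omega
          · exact Or.inl (mem_insert_self _ _)
          · exact Or.inr (mem_insert_self _ _)
      · intro x hx; simp at hx ⊢; tauto
    · gcongr 2 * (k : ℤ) + ?_
      norm_cast
      omega
  · by_cases hw : m ≠ 0 ∧ m - 1 ∈ I
    · obtain ⟨hm, hw⟩ := hw
      obtain ⟨n, rfl⟩ : ∃ n, m = n + 1 := ⟨m - 1, by omega⟩
      rw [Nat.add_sub_cancel] at hw
      have hvw : y (n + 1) ≠ y n := fun h => by have := hinj (by omega) (by omega) h; omega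
      have hKw : y n ∉ insert (y (n + 1 + 1)) K :=
        hKinsert (n := n + 1) (by omega) (by omega) (fun i hi => hK i (by omega)) n (by omega)
      refine regLE_coverSet_branch hKw ?_ ?_
      -- With `y n` and the leaf zero, covers can use both and drop `y (n + 1)`, so the discount
      -- disappears. Three vertices and at most three edges are lost, which lowers the quotient by 1
      -- and pays for the colon.
      · have hc := hlow 3
        refine (regLE_coverSet_congr (ih n (by omega) (hsubinj (by omega))
          (I.filter fun i => i + 3 < n + 1 + 1) (fun i hi => ?_) k
          (insert (y n) (insert (y (n + 1 + 1)) K))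
          (hKinsert le_rfl (by omega) (hKinsert (by omega) (by omega)
            fun i hi => hK i (by omega)))) ?_ ?_).mono ?_
        · have := (mem_filter.1 hi).2; omega
        · exact fun C hC => ⟨C, lineCovers_anti y (filter_subset _ _) hC, subset_union_left,
            by simp⟩
        · refine fun C hC => ⟨insert (y n) (insert (y (n + 1 + 1)) (C.erase (y (n + 1)))),
            fun i hi => ?_, ?_, ?_⟩
          · have h1 := hI i hi
            by_cases h2 : i + 3 < n + 1 + 1
            · have h3 : y i ≠ y (n + 1) := fun h => by
                have := hinj (by omega) (by omega) h; omega
              have h4 : y (i + 1) ≠ y (n + 1) := fun h => by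
                have := hinj (by omega) (by omega) h; omega
              have := hC i (mem_filter.2 ⟨hi, h2⟩)
              simp only [mem_insert, mem_erase]
              tauto
            · obtain rfl | rfl | rfl : i = n + 1 ∨ i = n ∨ i + 1 = n := by omega
              all_goals simp
          · intro x hx; simp at hx ⊢; tauto
          · simp [huv.symm, hvw]
        · have : ((2 * (n + 1 + 2) - I.card) / 3 : ℕ) ≥
              (2 * n - (I.filter fun i => i + 3 < n + 1 + 1).card) / 3 + 1 := by omega
          omega
      -- The colon by both ends of the edge at n discounts every cover by at least 1. Since the leaf
      -- is zero, a cover with both ends can drop `y (n + 1)`; what remains is the next lower power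
      -- on a shorter path.
      · rcases k with _ | k
        · apply regLE_coverSet_of_le
          intro C hC
          have := hC n hw
          rcases this with h | h <;> simp [h]
        · have hcard : (I.erase (n + 1)).card = I.card - 1 := card_erase_of_mem htop
          refine (regLE_coverSet_congr (ih (n + 1 + 1) (by omega) (hsubinj (by omega))
            (I.erase (n + 1)) (fun i hi => ?_) k (insert (y (n + 1 + 1)) K)
            (hKinsert le_rfl (by omega) fun i hi => hK i (by omega))) ?_ ?_).mono ?_
          · have h1 := hI i (mem_of_mem_erase hi)
            have h2 := ne_of_mem_erase hi
            omega
          · refine fun C hC => ⟨C, lineCovers_anti y (erase_subset _ _) hC, subset_union_left, ?_⟩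
            rcases hC n hw with h | h <;> simp [h]
          · intro C hC
            by_cases hb : y n ∈ C ∧ y (n + 1) ∈ C
            · refine ⟨insert (y (n + 1 + 1)) (C.erase (y (n + 1))), fun i hi => ?_, ?_, ?_⟩
              · by_cases h2 : i = n + 1
                · subst h2; simp
                · have h1 := hI i hi
                  have := hC i (mem_erase.2 ⟨h2, hi⟩)
                  have h3 : y i ≠ y (n + 1) := fun h => by
                    have := hinj (by omega) (by omega) h; omega
                  by_cases h4 : i = n
                  · subst h4
                    left; simp [hb.1, hvw.symm]
                  · have h4 : y (i + 1) ≠ y (n + 1) := fun h => by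
                      have := hinj (by omega) (by omega) h; omega
                    simp only [mem_insert, mem_erase]
                    tauto
              · intro x hx; simp at hx ⊢; tauto
              · simp [huv.symm]
                split_ifs <;> omega
            · refine ⟨insert (y (n + 1 + 1)) C, fun i hi => ?_, ?_, ?_⟩
              · by_cases h2 : i = n + 1
                · subst h2; simp
                · exact (hC i (mem_erase.2 ⟨h2, hi⟩)).imp (mem_insert_of_mem) (mem_insert_of_mem)
              · intro x hx; simp at hx ⊢; tauto
              · have h5 : y n ≠ y (n + 1 + 1) := fun h => by
                  have := hinj (by omega) (by omega) h; omega
                simp only [mem_insert, huv.symm, h5, false_or]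
                split_ifs <;> first | omega | tauto
          · push_cast
            have : ((2 * (n + 1 + 2) - I.card) / 3 : ℕ) ≥
              (2 * (n + 1 + 1) - (I.erase (n + 1)).card) / 3 := by omega
            omega
    -- The last edge is an isolated component: once the leaf is zero, `y m` is never needed in a
    -- cover.
    · have hcard : (I.erase m).card = I.card - 1 := card_erase_of_mem htop
      have hpos : 0 < I.card := card_pos.2 ⟨m, htop⟩
      have hlt : ∀ i ∈ I.erase m, i + 1 < m := by
        intro i hi
        have h1 := hI i (mem_of_mem_erase hi)
        have h2 := ne_of_mem_erase hi
        have h3 : i + 1 ≠ m := by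
          rintro rfl
          exact hw ⟨by omega, by simpa using mem_of_mem_erase hi⟩
        omega
      refine (regLE_coverSet_congr (ih m (by omega) (hsubinj (by omega))
        (I.erase m) hlt k (insert (y (m + 1)) K)
        (hKinsert (by omega) (by omega) fun i hi => hK i (by omega))) ?_ ?_).mono ?_
      · exact fun C hC => ⟨C, lineCovers_anti y (erase_subset _ _) hC, subset_union_left,
          by simp⟩
      · refine fun C hC => ⟨insert (y (m + 1)) (C.erase (y m)), fun i hi => ?_, ?_, ?_⟩
        · by_cases h2 : i = m
          · subst h2; simp
          · have h1 := hlt i (mem_erase.2 ⟨h2, hi⟩)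
            have := hC i (mem_erase.2 ⟨h2, hi⟩)
            have h3 : y i ≠ y m := fun h => by
              have := hinj (by omega) (by omega) h; omega
            have h4 : y (i + 1) ≠ y m := fun h => by
              have := hinj (by omega) (by omega) h; omega
            simp only [mem_insert, mem_erase]
            tauto
        · intro x hx; simp at hx ⊢; tauto
        · simp [huv.symm]
      · have : ((2 * (m + 2) - I.card) / 3 : ℕ) ≥ (2 * m - (I.erase m).card) / 3 + 1 := by omega
        omega
  -- The colon by a leaf edge: every cover meets it, and one containing both ends can drop the leaf,
  -- so the colon of a power is the preceding power.
  · rcases k with _ | k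
    · apply regLE_coverSet_of_le
      intro C hC
      rcases hC m htop with h | h <;> simp [h]
    · refine (regLE_coverSet_congr (ihk k (by omega)) ?_ ?_).mono ?_
      · refine fun C hC => ⟨C, hC, subset_union_left, ?_⟩
        rcases hC m htop with h | h <;> simp [h]
      · intro C hC
        by_cases hb : y m ∈ C ∧ y (m + 1) ∈ C
        · refine ⟨C.erase (y (m + 1)), fun i hi => ?_, (erase_subset _ _).trans subset_union_left,
            ?_⟩
          · have h1 := hI i hi
            by_cases h2 : i = m
            · subst h2; left; simp [hb.1, huv.symm]
            · have h3 : y i ≠ y (m + 1) := fun h => by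
                have := hinj (by omega) (by omega) h; omega
              have h4 : y (i + 1) ≠ y (m + 1) := fun h => by
                have := hinj (by omega) (by omega) h; omega
              have := hC i hi
              simp only [mem_erase]
              tauto
          · simp
            split_ifs <;> omega
        · refine ⟨C, hC, subset_union_left, ?_⟩
          split_ifs <;> first | omega | tauto
      · push_cast
        omega

end Covers

/-! ### Paths with discounted end vertices. -/

section MarkedPaths

variable {𝕜 V : Type*} [Field 𝕜] [Fintype V] [DecidableEq V]

/-- A path whose last vertex is marked. -/
theorem regLE_markedEnd (y : ℕ → V) (m : ℕ) (hy : Set.InjOn y (Set.Iio (m + 1))) (I : Finset ℕ)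
    (hI : ∀ i ∈ I, i < m) (hlast : ∀ i, i + 1 = m → i ∈ I) (hinner : ∀ i, i + 2 < m → i ∈ I)
    (k : ℕ) (K : Finset V) (hK : ∀ i < m + 1, y i ∉ K) :
    RegLE 𝕜 (coverSet (lineCovers y I) (fun C => if y m ∈ C then 1 else 0) (k + 1) ∪ killSet K)
      (2 * (k : ℤ) + (m / 3 : ℕ)) := by
  have hinj : ∀ {a b : ℕ}, a < m + 1 → b < m + 1 → (y a = y b ↔ a = b) :=
    fun ha hb => ⟨fun h => hy ha hb h, fun h => h ▸ rfl⟩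
  rcases m with _ | m
  · have hI0 : I = ∅ := eq_empty_of_forall_notMem fun i hi => by have := hI i hi; omega
    subst hI0
    exact regLE_coverSet_of_empty_mem K (by positivity) ⟨∅, by simp [lineCovers], by simp, by simp⟩
  have hm : m ∈ I := hlast m rfl
  have hcard : m - 1 + 1 ≤ I.card ∨ m = 0 := by
    by_cases h : m = 0
    · exact Or.inr h
    left
    have h1 : insert m (range (m - 1)) ⊆ I := by
      intro i hi
      rcases mem_insert.1 hi with rfl | h
      · exact hm
      · exact hinner i (by have := mem_range.1 h; omega)
    have h2 := card_le_card h1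
    rwa [card_insert_of_notMem (by simp), card_range] at h2
  have hpp : y m ≠ y (m + 1) := by rw [Ne, hinj (by omega) (by omega)]; omega
  induction k using Nat.strong_induction_on with
  | _ k ihk =>
  have hKv : y m ∉ K := hK _ (by omega)
  have hKu : y (m + 1) ∉ K := hK _ (by omega)
  refine regLE_coverSet_branch hKv ?_ (regLE_coverSet_branch hKu ?_ ?_)
  -- With `y m` zero the marked vertex is isolated, so covers can omit it and the mark is lost.
  · refine (regLE_coverSet_congr (regLE_lineCovers y m (hy.mono (Set.Iio_subset_Iio (by omega)))
      (range (m - 1)) (fun i hi => by have := mem_range.1 hi; omega) k (insert (y m) K)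
      (fun i hi => ?_)) ?_ ?_).mono ?_
    · have := hK i (by omega)
      have h2 := hinj (a := i) (b := m) (by omega) (by omega)
      simp only [mem_insert, h2]
      grind
    · exact fun C hC => ⟨C, lineCovers_anti y (fun i hi => hinner i
        (by have := mem_range.1 hi; omega)) hC, subset_union_left, by simp⟩
    · refine fun C hC => ⟨insert (y m) (C.erase (y (m + 1))), fun i hi => ?_, ?_, ?_⟩
      · have h1 := hI i hi
        by_cases h2 : i < m - 1
        · have h3 := hC i (mem_range.2 h2)
          simp only [mem_insert, mem_erase, Ne, hinj (a := i) (b := m + 1) (by omega) (by omega),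
            hinj (a := i + 1) (b := m + 1) (by omega) (by omega)]
          grind
        · obtain rfl | rfl : i = m ∨ i + 1 = m := by omega
          · simp
          · simp
      · intro x hx; simp at hx ⊢; tauto
      · simp [hpp.symm]
    · rw [card_range]
      gcongr 2 * (k : ℤ) + ?_
      norm_cast
      omega
  -- With the marked vertex zero, a cover needs just one of `y m`, `y (m + 1)`; either gives
  -- discount 1, leaving an unmarked power with exponent lower by one.
  · rcases k with _ | k
    · refine regLE_coverSet_of_le _ _ fun C hC => ?_
      rcases hC m hm with h | h <;> simp [h]
    have hc : I.card = (I.erase m).card + 1 := (card_erase_add_one hm).symm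
    refine (regLE_coverSet_congr (regLE_lineCovers y (m + 1)
      (hy.mono (Set.Iio_subset_Iio (by omega))) (I.erase m) (fun i hi => ?_) k
      (insert (y (m + 1)) K) (fun i hi => ?_)) ?_ ?_).mono ?_
    · have h1 := hI i (mem_of_mem_erase hi)
      have h2 := ne_of_mem_erase hi
      omega
    · have := hK i (by omega)
      have h2 := hinj (a := i) (b := m + 1) (by omega) (by omega)
      simp only [mem_insert, h2]
      grind
    · refine fun C hC => ⟨C, lineCovers_anti y (erase_subset _ _) hC, subset_union_left, ?_⟩
      rcases hC m hm with h | h <;> simp [h]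
    · intro C hC
      have hC' : ∀ i ∈ I, i ≠ m → y i ∈ C.erase (y (m + 1)) ∨ y (i + 1) ∈ C.erase (y (m + 1)) := by
        intro i hi him
        have h1 := hI i hi
        have h3 := hC i (mem_erase.2 ⟨him, hi⟩)
        simp only [mem_erase, Ne, hinj (a := i) (b := m + 1) (by omega) (by omega),
            hinj (a := i + 1) (b := m + 1) (by omega) (by omega)]
        grind
      by_cases hb : y m ∈ C
      · refine ⟨C.erase (y (m + 1)), fun i hi => ?_, ?_, ?_⟩
        · by_cases him : i = m
          · subst him; left; simp [hpp, hb]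
          · exact hC' i hi him
        · intro x hx; simp at hx ⊢; tauto
        · simp [hpp, hb]
      · refine ⟨insert (y (m + 1)) C, fun i hi => ?_, ?_, ?_⟩
        · by_cases him : i = m
          · subst him; simp
          · exact (hC i (mem_erase.2 ⟨him, hi⟩)).imp mem_insert_of_mem mem_insert_of_mem
        · intro x hx; simp at hx ⊢; tauto
        · simp [hpp, hb]
    · push_cast
      omega
  · rcases k with _ | k
    · refine regLE_coverSet_of_le _ _ fun C hC => ?_
      rcases hC m hm with h | h <;> simp [h]
      omega
    refine (regLE_coverSet_congr (ihk k (by omega)) ?_ ?_).mono ?_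
    · refine fun C hC => ⟨C, hC, subset_union_left, ?_⟩
      rcases hC m hm with h | h <;> simp [h]
      omega
    · intro C hC
      by_cases hb : y m ∈ C ∧ y (m + 1) ∈ C
      · refine ⟨C.erase (y (m + 1)), fun i hi => ?_, (erase_subset _ _).trans subset_union_left, ?_⟩
        · have h1 := hI i hi
          by_cases him : i = m
          · subst him; left; simp [hpp, hb.1]
          · have h3 := hC i hi
            simp only [mem_erase, Ne, hinj (a := i) (b := m + 1) (by omega) (by omega),
              hinj (a := i + 1) (b := m + 1) (by omega) (by omega)]
            grind
        · simp [hpp, hb.1]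
      · refine ⟨C, hC, subset_union_left, ?_⟩
        split_ifs <;> first | omega | tauto
    · push_cast; omega

/-- The mark of a set of vertices containing one of `a`, `b`. -/
def endMark (a b : V) (C : Finset V) : ℕ := if a ∈ C ∨ b ∈ C then 1 else 0

/-- Branching on `y 1` and then on `y 0` leaves one case sensitive to the second edge, isolated as
`hF`. Killing `y 1` makes `y 0` superfluous and gives a path marked only at its far end; the colon
by both variables merely lowers k. -/
theorem regLE_markedEnds_of_colon (y : ℕ → V) (m : ℕ) (hy : Set.InjOn y (Set.Iio (m + 3)))
    (I : Finset ℕ) (hI : ∀ i ∈ I, i < m + 2) (h0 : 0 ∈ I) (hlast : ∀ i, i + 1 = m → i + 2 ∈ I)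
    (hinner : ∀ i, i + 2 < m → i + 2 ∈ I) (K : Finset V) (hK : ∀ i < m + 3, y i ∉ K)
    (hF : ∀ k : ℕ, RegLE 𝕜 (coverSet (lineCovers y I)
      (fun C => endMark (y 0) (y (m + 2)) C + if y 1 ∈ C then 1 else 0) (k + 1) ∪
        killSet (insert (y 0) K)) (2 * (k : ℤ) + (m / 3 : ℕ) - 1)) (k : ℕ) :
    RegLE 𝕜 (coverSet (lineCovers y I) (endMark (y 0) (y (m + 2))) (k + 1) ∪ killSet K)
      (2 * (k : ℤ) + (m / 3 : ℕ)) := by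
  have hinj : ∀ {a b : ℕ}, a < m + 3 → b < m + 3 → (y a = y b ↔ a = b) :=
    fun ha hb => ⟨fun h => hy ha hb h, fun h => h ▸ rfl⟩
  have h01 : y 0 ≠ y 1 := by rw [Ne, hinj (by omega) (by omega)]; omega
  induction k using Nat.strong_induction_on with
  | _ k ihk =>
  refine regLE_coverSet_branch (hK 1 (by omega)) ?_
    (regLE_coverSet_branch (hK 0 (by omega)) (hF k) ?_)
  · refine regLE_coverSet_congr (regLE_markedEnd (fun i => y (i + 2)) m ?_
      ((range m).filter fun i => i + 2 ∈ I) (fun i hi => ?_) (fun i hi => ?_) (fun i hi => ?_) k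
      (insert (y 1) K) (fun i hi => ?_)) ?_ ?_
    · intro a ha b hb h
      have := (hinj (a := a + 2) (b := b + 2)
        (by have := Set.mem_Iio.1 ha; omega) (by have := Set.mem_Iio.1 hb; omega)).1 h
      omega
    · exact mem_range.1 (mem_filter.1 hi).1
    · exact mem_filter.2 ⟨mem_range.2 (by omega), hlast i hi⟩
    · exact mem_filter.2 ⟨mem_range.2 (by omega), hinner i hi⟩
    · have := hK (i + 2) (by omega)
      have h2 := hinj (a := i + 2) (b := 1) (by omega) (by omega)
      simp only [mem_insert, h2]
      grind
    · refine fun C hC => ⟨C, fun i hi => hC _ (mem_filter.1 hi).2, subset_union_left, ?_⟩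
      unfold endMark
      split_ifs <;> first | omega | tauto
    · refine fun C hC => ⟨insert (y 1) (C.erase (y 0)), fun i hi => ?_, ?_, ?_⟩
      · have h1 := hI i hi
        obtain rfl | rfl | ⟨j, rfl⟩ : i = 0 ∨ i = 1 ∨ ∃ j, i = j + 2 := by
          rcases i with _ | _ | j
          exacts [Or.inl rfl, Or.inr (Or.inl rfl), Or.inr (Or.inr ⟨j, rfl⟩)]
        · simp
        · simp
        · have h3 := hC j (mem_filter.2 ⟨mem_range.2 (by omega), hi⟩)
          simp only [mem_insert, mem_erase, Ne, hinj (a := j + 2) (b := 0) (by omega) (by omega),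
            hinj (a := j + 2 + 1) (b := 0) (by omega) (by omega)]
          grind
      · intro x hx; simp at hx ⊢; tauto
      · have h3 := hinj (a := m + 2) (b := 0) (by omega) (by omega)
        have h4 := hinj (a := m + 2) (b := 1) (by omega) (by omega)
        simp [endMark, h01, h3, h4]
  · rcases k with _ | k
    · refine regLE_coverSet_of_le _ _ fun C hC => ?_
      rcases hC 0 h0 with h | h <;> simp [endMark, h]
      omega
    refine (regLE_coverSet_congr (ihk k (by omega)) ?_ ?_).mono ?_
    · refine fun C hC => ⟨C, hC, subset_union_left, ?_⟩
      have h := hC 0 h0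
      rw [zero_add] at h
      rcases h with h | h <;> simp [h] <;> omega
    · intro C hC
      by_cases hb : y 0 ∈ C ∧ y 1 ∈ C
      · refine ⟨C.erase (y 0), fun i hi => ?_, (erase_subset _ _).trans subset_union_left, ?_⟩
        · have h1 := hI i hi
          by_cases him : i = 0
          · subst him; right; simp [h01.symm, hb.2]
          · have h3 := hC i hi
            simp only [mem_erase, Ne, hinj (a := i) (b := 0) (by omega) (by omega),
              hinj (a := i + 1) (b := 0) (by omega) (by omega)]
            grind
        · simp only [endMark, hb.1, hb.2, mem_erase]
          split_ifs <;> simp_all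
      · refine ⟨C, hC, subset_union_left, ?_⟩
        split_ifs <;> first | omega | tauto
    · push_cast; omega

/-- The case where the edge between the second and third vertex is missing. -/
theorem regLE_markedEnds_of_gap (y : ℕ → V) (m : ℕ) (hy : Set.InjOn y (Set.Iio (m + 3)))
    (I : Finset ℕ) (hI : ∀ i ∈ I, i < m + 2) (h0 : 0 ∈ I) (h1 : 1 ∉ I)
    (hlast : ∀ i, i + 1 = m → i + 2 ∈ I) (hinner : ∀ i, i + 2 < m → i + 2 ∈ I)
    (K : Finset V) (hK : ∀ i < m + 3, y i ∉ K) (k : ℕ) :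
    RegLE 𝕜 (coverSet (lineCovers y I) (endMark (y 0) (y (m + 2))) (k + 1) ∪ killSet K)
      (2 * (k : ℤ) + (m / 3 : ℕ)) := by
  have hinj : ∀ {a b : ℕ}, a < m + 3 → b < m + 3 → (y a = y b ↔ a = b) :=
    fun ha hb => ⟨fun h => hy ha hb h, fun h => h ▸ rfl⟩
  have h01 : y 0 ≠ y 1 := by rw [Ne, hinj (by omega) (by omega)]; omega
  refine regLE_markedEnds_of_colon y m hy I hI h0 hlast hinner K hK (fun k => ?_) k
  rcases k with _ | k
  · refine regLE_coverSet_of_le _ _ fun C hC => ?_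
    rcases hC 0 h0 with h | h <;> simp [endMark, h]
  have hcard : m - 1 ≤ ((range m).filter fun i => i + 2 ∈ I).card := by
    rcases m with _ | m
    · simp
    have h2 : insert m (range (m - 1)) ⊆ (range (m + 1)).filter fun i => i + 2 ∈ I := by
      intro i hi
      rcases mem_insert.1 hi with rfl | h
      · exact mem_filter.2 ⟨by simp, hlast i rfl⟩
      · have := mem_range.1 h
        exact mem_filter.2 ⟨mem_range.2 (by omega), hinner i (by omega)⟩
    have h3 := card_le_card h2
    rw [card_insert_of_notMem (by simp), card_range] at h3
    omega
  -- As `y 0` is zero and `y 1` has no other edge, covers can take `y 0` and drop `y 1`. The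
  -- discount is then constantly 1.
  refine (regLE_coverSet_congr (regLE_lineCovers (fun i => y (i + 2)) (m + 1) ?_
      ((range m).filter fun i => i + 2 ∈ I) (fun i hi => ?_) k
      (insert (y 0) K) (fun i hi => ?_)) ?_ ?_).mono ?_
  · intro a ha b hb h
    have := (hinj (a := a + 2) (b := b + 2)
      (by have := Set.mem_Iio.1 ha; omega) (by have := Set.mem_Iio.1 hb; omega)).1 h
    omega
  · have := mem_range.1 (mem_filter.1 hi).1
    omega
  · have := hK (i + 2) (by omega)
    have h2 := hinj (a := i + 2) (b := 0) (by omega) (by omega)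
    simp only [mem_insert, h2]
    grind
  · refine fun C hC => ⟨C, fun i hi => hC _ (mem_filter.1 hi).2, subset_union_left, ?_⟩
    have h := hC 0 h0
    rw [zero_add] at h
    rcases h with h | h <;> simp [endMark, h]
  · refine fun C hC => ⟨insert (y 0) (C.erase (y 1)), fun i hi => ?_, ?_, ?_⟩
    · have h1' := hI i hi
      obtain rfl | rfl | ⟨j, rfl⟩ : i = 0 ∨ i = 1 ∨ ∃ j, i = j + 2 := by
        rcases i with _ | _ | j
        exacts [Or.inl rfl, Or.inr (Or.inl rfl), Or.inr (Or.inr ⟨j, rfl⟩)]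
      · simp
      · exact absurd hi h1
      · have h3 := hC j (mem_filter.2 ⟨mem_range.2 (by omega), hi⟩)
        simp only [mem_insert, mem_erase, Ne, hinj (a := j + 2) (b := 1) (by omega) (by omega),
          hinj (a := j + 2 + 1) (b := 1) (by omega) (by omega)]
        grind
    · intro x hx; simp at hx ⊢; tauto
    · simp [endMark, h01.symm]
  · push_cast
    omega

end MarkedPaths

/-! ### Full paths: a joint induction on two kinds of marking. -/

section FullPath

variable {𝕜 V : Type*} [Field 𝕜] [Fintype V] [DecidableEq V]

/-- After the colon by `y m` with the last vertex zero, the discount "both ends" becomes "either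
end" on the path without its last vertex. Hence the bound follows from `hD`, the statement on one
vertex fewer. -/
theorem regLE_bothMarked (y : ℕ → V) (m : ℕ) (hy : Set.InjOn y (Set.Iio (m + 2)))
    (hD : ∀ (k : ℕ) (K : Finset V), (∀ i < m + 1, y i ∉ K) →
      RegLE 𝕜 (coverSet (lineCovers y (range m)) (endMark (y 0) (y m)) (k + 1) ∪ killSet K)
        (2 * (k : ℤ) + ((m + 1) / 3 - 1 : ℕ)))
    (K : Finset V) (hK : ∀ i < m + 2, y i ∉ K) (k : ℕ) :
    RegLE 𝕜 (coverSet (lineCovers y (range (m + 1)))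
      (fun C => if y 0 ∈ C ∧ y (m + 1) ∈ C then 1 else 0) (k + 1) ∪ killSet K)
      (2 * (k : ℤ) + 1 + (m / 3 : ℕ)) := by
  have hinj : ∀ {a b : ℕ}, a < m + 2 → b < m + 2 → (y a = y b ↔ a = b) :=
    fun ha hb => ⟨fun h => hy ha hb h, fun h => h ▸ rfl⟩
  have hpp : y m ≠ y (m + 1) := by rw [Ne, hinj (by omega) (by omega)]; omega
  have h0p : y 0 ≠ y (m + 1) := by rw [Ne, hinj (by omega) (by omega)]; omega
  have herase : ∀ C : Finset V, ∀ i < m, y i ∈ C ∨ y (i + 1) ∈ C →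
      y i ∈ C.erase (y (m + 1)) ∨ y (i + 1) ∈ C.erase (y (m + 1)) := by
    intro C i hi h
    simp only [mem_erase, Ne, hinj (a := i) (b := m + 1) (by omega) (by omega),
      hinj (a := i + 1) (b := m + 1) (by omega) (by omega)]
    grind
  have hmr : m ∈ range (m + 1) := by simp
  induction k using Nat.strong_induction_on with
  | _ k ihk =>
  refine regLE_coverSet_branch (hK m (by omega)) ?_
    (regLE_coverSet_branch (hK (m + 1) (by omega)) ?_ ?_)
  · refine (regLE_coverSet_congr (regLE_lineCovers y m (hy.mono (Set.Iio_subset_Iio (by omega)))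
      (range (m - 1)) (fun i hi => by have := mem_range.1 hi; omega) k (insert (y m) K)
      (fun i hi => ?_)) ?_ ?_).mono ?_
    · have := hK i (by omega)
      have h2 := hinj (a := i) (b := m) (by omega) (by omega)
      simp only [mem_insert, h2]
      grind
    · exact fun C hC => ⟨C, lineCovers_anti y (range_subset_range.2 (by omega)) hC,
        subset_union_left, by simp⟩
    · refine fun C hC => ⟨insert (y m) (C.erase (y (m + 1))), fun i hi => ?_, ?_, ?_⟩
      · have h1 := mem_range.1 hi
        by_cases h2 : i < m - 1
        · exact (herase C i (by omega) (hC i (mem_range.2 h2))).imp mem_insert_of_mem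
            mem_insert_of_mem
        · obtain rfl | rfl : i = m ∨ i + 1 = m := by omega
          · simp
          · simp
      · intro x hx; simp at hx ⊢; tauto
      · simp [hpp.symm]
    · rw [card_range]
      have : (2 * m - (m - 1)) / 3 ≤ m / 3 + 1 := by omega
      omega
  · refine (regLE_coverSet_congr (hD k (insert (y (m + 1)) K) (fun i hi => ?_)) ?_ ?_).mono ?_
    · have := hK i (by omega)
      have h2 := hinj (a := i) (b := m + 1) (by omega) (by omega)
      simp only [mem_insert, h2]
      grind
    · refine fun C hC => ⟨C, lineCovers_anti y (range_subset_range.2 (by omega)) hC,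
        subset_union_left, ?_⟩
      unfold endMark
      rcases hC m hmr with h | h
      · simp only [h]; split_ifs <;> omega
      · simp only [h]; split_ifs <;> first | omega | tauto
    · intro C hC
      by_cases hb : y m ∈ C
      · refine ⟨C.erase (y (m + 1)), fun i hi => ?_, ?_, ?_⟩
        · have h1 := mem_range.1 hi
          by_cases h2 : i = m
          · subst h2; left; simp [hpp, hb]
          · exact herase C i (by omega) (hC i (mem_range.2 (by omega)))
        · exact (erase_subset _ _).trans subset_union_left
        · simp [endMark, hpp, hb]
      · refine ⟨insert (y (m + 1)) C, fun i hi => ?_, ?_, ?_⟩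
        · have h1 := mem_range.1 hi
          by_cases h2 : i = m
          · subst h2; simp
          · exact (hC i (mem_range.2 (by omega))).imp mem_insert_of_mem mem_insert_of_mem
        · intro x hx; simp at hx ⊢; tauto
        · simp [endMark, hpp, hb, h0p]
    · have : (m + 1) / 3 - 1 ≤ m / 3 := by omega
      omega
  · rcases k with _ | k
    · refine regLE_coverSet_of_le _ _ fun C hC => ?_
      rcases hC m hmr with h | h <;> simp [h]
      omega
    refine (regLE_coverSet_congr (ihk k (by omega)) ?_ ?_).mono ?_
    · refine fun C hC => ⟨C, hC, subset_union_left, ?_⟩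
      rcases hC m hmr with h | h <;> simp only [h] <;> split_ifs <;> omega
    · intro C hC
      by_cases hb : y m ∈ C ∧ y (m + 1) ∈ C
      · refine ⟨C.erase (y (m + 1)), fun i hi => ?_, (erase_subset _ _).trans subset_union_left, ?_⟩
        · have h1 := mem_range.1 hi
          by_cases h2 : i = m
          · subst h2; left; simp [hpp, hb.1]
          · exact herase C i (by omega) (hC i hi)
        · simp [hpp, hb.1]
      · refine ⟨C, hC, subset_union_left, ?_⟩
        split_ifs <;> first | omega | tauto
    · push_cast; omega

/-- The colon by `y 1` with `y 0` zero turns "either end" into 1 plus "both ends" on the path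
without `y 0`; `regLE_bothMarked` returns to the present statement for n - 2. -/
theorem regLE_markedEnds_full (n : ℕ) (y : ℕ → V) (hy : Set.InjOn y (Set.Iio (n + 1))) (k : ℕ)
    (K : Finset V) (hK : ∀ i < n + 1, y i ∉ K) :
    RegLE 𝕜 (coverSet (lineCovers y (range n)) (endMark (y 0) (y n)) (k + 1) ∪ killSet K)
      (2 * (k : ℤ) + ((n + 1) / 3 - 1 : ℕ)) := by
  induction n using Nat.strong_induction_on generalizing y k K with
  | _ n ih =>
  obtain rfl | rfl | ⟨m, rfl⟩ : n = 0 ∨ n = 1 ∨ ∃ m, n = m + 2 := by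
    rcases n with _ | _ | j
    exacts [Or.inl rfl, Or.inr (Or.inl rfl), Or.inr (Or.inr ⟨j, rfl⟩)]
  · exact regLE_coverSet_of_empty_mem K (by positivity)
      ⟨∅, by simp [lineCovers], by simp, by simp [endMark]⟩
  · have hmark : ∀ C ∈ lineCovers y (range 1), endMark (y 0) (y 1) C = 1 := fun C hC =>
      if_pos (hC 0 (by simp))
    rcases k with _ | k
    · exact regLE_coverSet_of_le _ _ fun C hC => by rw [hmark C hC]
    refine (regLE_coverSet_congr (regLE_lineCovers y 2 hy (range 1) (by simp) k K hK)
      ?_ ?_).mono ?_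
    · exact fun C hC => ⟨C, hC, subset_union_left, by rw [hmark C hC]⟩
    · exact fun C hC => ⟨C, hC, subset_union_left, by rw [hmark C hC]⟩
    · rw [card_range]; push_cast; omega
  · have hinj : ∀ {a b : ℕ}, a < m + 3 → b < m + 3 → (y a = y b ↔ a = b) :=
      fun ha hb => ⟨fun h => hy ha hb h, fun h => h ▸ rfl⟩
    have hshift : ∀ {c : ℕ}, c ≤ m + 2 → Set.InjOn (fun i => y (i + 1)) (Set.Iio c) := by
      intro c hc a ha b hb h
      have := (hinj (a := a + 1) (b := b + 1)
        (by have := Set.mem_Iio.1 ha; omega) (by have := Set.mem_Iio.1 hb; omega)).1 h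
      omega
    have hbd : (m + 2 + 1) / 3 - 1 = m / 3 := by omega
    rw [hbd]
    refine regLE_markedEnds_of_colon y m hy (range (m + 2)) (fun i hi => mem_range.1 hi)
      (by simp) (fun i hi => mem_range.2 (by omega)) (fun i hi => mem_range.2 (by omega)) K hK
      (fun k => ?_) k
    have h01 : y 0 ≠ y 1 := by rw [Ne, hinj (by omega) (by omega)]; omega
    have h0m : y 0 ≠ y (m + 2) := by rw [Ne, hinj (by omega) (by omega)]; omega
    rcases k with _ | k
    · refine regLE_coverSet_of_le _ _ fun C hC => ?_
      rcases hC 0 (by simp) with h | h <;> simp [endMark, h]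
    refine (regLE_coverSet_congr (regLE_bothMarked (fun i => y (i + 1)) m (hshift le_rfl)
      (fun k K hK => ih m (by omega) (fun i => y (i + 1)) (hshift (by omega)) k K hK)
      (insert (y 0) K) (fun i hi => ?_) k) ?_ ?_).mono ?_
    · have := hK (i + 1) (by omega)
      have h2 := hinj (a := i + 1) (b := 0) (by omega) (by omega)
      simp only [mem_insert, h2]
      grind
    · refine fun C hC => ⟨C, fun i hi => hC _ (mem_range.2 (by have := mem_range.1 hi; omega)),
        subset_union_left, ?_⟩
      have h := hC 0 (by simp)
      simp only [zero_add] at h ⊢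
      unfold endMark
      split_ifs <;> first | omega | tauto
    · intro C hC
      by_cases hb : y 1 ∈ C
      · refine ⟨C.erase (y 0), fun i hi => ?_, ?_, ?_⟩
        · have h1 := mem_range.1 hi
          rcases i with _ | i
          · simp [hb, h01.symm]
          · have h3 := hC i (mem_range.2 (by omega))
            simp only [mem_erase, Ne, hinj (a := i + 1) (b := 0) (by omega) (by omega),
              hinj (a := i + 1 + 1) (b := 0) (by omega) (by omega)]
            grind
        · exact (erase_subset _ _).trans subset_union_left
        · simp only [endMark, zero_add, mem_erase, hb]
          split_ifs <;> simp_all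
      · refine ⟨insert (y 0) C, fun i hi => ?_, ?_, ?_⟩
        · have h1 := mem_range.1 hi
          rcases i with _ | i
          · simp
          · exact (hC i (mem_range.2 (by omega))).imp mem_insert_of_mem mem_insert_of_mem
        · intro x hx; simp at hx ⊢; tauto
        · simp [endMark, hb, h01.symm]
    · push_cast; omega

end FullPath

/-! ### One heavy edge closing a path: the filtration by powers of its monomial. -/

section HeavyEdge

variable {𝕜 V : Type*} [Field 𝕜] [Fintype V] [DecidableEq V]

theorem killSet_empty : killSet (∅ : Finset V) = ∅ := by ext; simp [killSet]

theorem RegLE.of_union_killSet_empty {U : Set (V →₀ ℕ)} {r : ℤ}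
    (h : RegLE 𝕜 (U ∪ killSet ∅) r) : RegLE 𝕜 U r := by
  rwa [killSet_empty, Set.union_empty] at h

theorem lineCovers_reflect (y : ℕ → V) (n : ℕ) (I : Finset ℕ) (hI : ∀ i ∈ I, i < n) :
    lineCovers (fun i => y (n - i)) ((range n).filter fun i => n - 1 - i ∈ I) = lineCovers y I := by
  ext C
  constructor
  · intro h i hi
    have h1 := hI i hi
    have := h (n - 1 - i) (mem_filter.2 ⟨mem_range.2 (by omega),
      by rwa [show n - 1 - (n - 1 - i) = i by omega]⟩)
    dsimp only at this
    rw [show n - (n - 1 - i) = i + 1 by omega, show n - (n - 1 - i + 1) = i by omega] at this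
    exact this.symm
  · intro h i hi
    obtain ⟨h1, h2⟩ := mem_filter.1 hi
    have h1 := mem_range.1 h1
    have := h _ h2
    dsimp only
    rw [show n - 1 - i + 1 = n - i by omega, show n - 1 - i = n - (i + 1) by omega] at this
    exact this.symm

/-- A path on `m + 3` vertices in which only the second edge from either end may be missing. -/
structure IsAlmostPath (m : ℕ) (I : Finset ℕ) : Prop where
  lt : ∀ i ∈ I, i < m + 2
  missing : ∀ i < m + 2, i ∉ I → i = 1 ∨ i = m
  nonempty : I.Nonempty

/-- Either the path is complete, or after a possible reversal its second edge is missing; the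
marking is symmetric in the two ends. -/
theorem regLE_markedEnds {m : ℕ} {I : Finset ℕ} (h : IsAlmostPath m I) (y : ℕ → V)
    (hy : Set.InjOn y (Set.Iio (m + 3))) (k : ℕ) :
    RegLE 𝕜 (coverSet (lineCovers y I) (endMark (y 0) (y (m + 2))) (k + 1))
      (2 * (k : ℤ) + (m / 3 : ℕ)) := by
  obtain ⟨hlt, hmiss, hne⟩ := h
  have gap : ∀ (y : ℕ → V) (I : Finset ℕ), Set.InjOn y (Set.Iio (m + 3)) →
      (∀ i ∈ I, i < m + 2) → (∀ i < m + 2, i ∉ I → i = 1 ∨ i = m) → I.Nonempty → 1 ∉ I →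
      RegLE 𝕜 (coverSet (lineCovers y I) (endMark (y 0) (y (m + 2))) (k + 1))
        (2 * (k : ℤ) + (m / 3 : ℕ)) := by
    intro y I hy hlt hmiss hne h1
    have h0 : 0 ∈ I := by
      by_contra h0
      obtain ⟨i, hi⟩ := hne
      have := hlt i hi
      have h2 := hmiss 0 (by omega) h0
      have : i ≠ 0 := by rintro rfl; exact h0 hi
      have : i ≠ 1 := by rintro rfl; exact h1 hi
      omega
    refine (regLE_markedEnds_of_gap y m hy I hlt h0 h1 (fun i hi => ?_) (fun i hi => ?_) ∅
      (by simp) k).of_union_killSet_empty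
    · by_contra h; have := hmiss (i + 2) (by omega) h; omega
    · by_contra h; have := hmiss (i + 2) (by omega) h; omega
  by_cases h1 : 1 ∈ I
  swap
  · exact gap y I hy hlt hmiss hne h1
  by_cases hm : m ∈ I
  · have hI : I = range (m + 2) := by
      ext i
      rw [mem_range]
      refine ⟨hlt i, fun hi => ?_⟩
      by_contra h
      rcases hmiss i hi h with rfl | rfl
      exacts [h h1, h hm]
    rw [hI]
    refine (regLE_markedEnds_full (m + 2) y hy k ∅ (by simp)).of_union_killSet_empty.mono ?_
    omega
  · have := gap (fun i => y (m + 2 - i)) ((range (m + 2)).filter fun i => m + 2 - 1 - i ∈ I) ?_ ?_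
      ?_ ?_ ?_
    · rw [lineCovers_reflect y (m + 2) I hlt] at this
      have he : endMark (y (m + 2 - 0)) (y (m + 2 - (m + 2))) = endMark (y 0) (y (m + 2)) := by
        funext C; simp [endMark, or_comm]
      rwa [he] at this
    · intro a ha b hb h
      have ha := Set.mem_Iio.1 ha
      have hb := Set.mem_Iio.1 hb
      have := hy (Set.mem_Iio.2 (by omega)) (Set.mem_Iio.2 (by omega)) h
      omega
    · exact fun i hi => mem_range.1 (mem_filter.1 hi).1
    · intro i hi h
      have h2 : m + 2 - 1 - i ∉ I := fun h' => h (mem_filter.2 ⟨mem_range.2 hi, h'⟩)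
      have := hmiss _ (by omega) h2
      omega
    · obtain ⟨i, hi⟩ := hne
      have := hlt i hi
      exact ⟨m + 1 - i, mem_filter.2 ⟨mem_range.2 (by omega),
        by rwa [show m + 2 - 1 - (m + 1 - i) = i by omega]⟩⟩
    · intro h
      have h2 := (mem_filter.1 h).2
      rw [show m + 2 - 1 - 1 = m by omega] at h2
      exact hm h2

theorem IsAlmostPath.card {m : ℕ} {I : Finset ℕ} (h : IsAlmostPath m I) : m ≤ I.card := by
  have h1 : range (m + 2) ⊆ I ∪ {1, m} := by
    intro i hi
    by_cases h' : i ∈ I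
    · exact mem_union_left _ h'
    · have := h.missing i (mem_range.1 hi) h'
      simp only [mem_union, mem_insert, mem_singleton]
      exact Or.inr this
  have h2 := (card_le_card h1).trans (card_union_le _ _)
  have h3 : ({1, m} : Finset ℕ).card ≤ 2 := card_le_two
  rw [card_range] at h2
  omega

theorem regLE_lineCovers_almostPath {m : ℕ} {I : Finset ℕ} (h : IsAlmostPath m I) (y : ℕ → V)
    (hy : Set.InjOn y (Set.Iio (m + 3))) (k : ℕ) :
    RegLE 𝕜 (coverSet (lineCovers y I) (fun _ => 0) (k + 1))
      (2 * (k : ℤ) + (m / 3 : ℕ) + 2) := by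
  refine (regLE_lineCovers y (m + 3) hy I (fun i hi => by have := h.lt i hi; omega) k ∅
    (by simp)).of_union_killSet_empty.mono ?_
  have := h.card
  omega

/-- Exponents of `(f, L) ^ t` where `coverSet 𝒞 0 k` are those of `L ^ k`, using at most `s` copies
of `f`. -/
def heavySet (𝒞 : Set (Finset V)) (f : V →₀ ℕ) (t s : ℕ) : Set (V →₀ ℕ) :=
  {h | ∃ j ≤ s, ∃ g ∈ coverSet 𝒞 (fun _ => 0) (t - j), h = j • f + g}

theorem isUpperSet_heavySet (𝒞 : Set (Finset V)) (f : V →₀ ℕ) (t s : ℕ) :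
    IsUpperSet (heavySet 𝒞 f t s) := by
  rintro _ b hab ⟨j, hj, g, hg, rfl⟩
  obtain ⟨c, rfl⟩ := exists_add_of_le hab
  exact ⟨j, hj, g + c, isUpperSet_coverSet _ _ _ (by simp) hg, add_assoc _ _ _⟩

theorem heavySet_succ (𝒞 : Set (Finset V)) (f : V →₀ ℕ) (t s : ℕ) :
    heavySet 𝒞 f t (s + 1) = heavySet 𝒞 f t s ∪
      (fun g => (s + 1) • f + g) '' coverSet 𝒞 (fun _ => 0) (t - (s + 1)) := by
  ext h
  constructor
  · rintro ⟨j, hj, g, hg, rfl⟩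
    by_cases hjs : j = s + 1
    · subst hjs; exact Or.inr ⟨g, hg, rfl⟩
    · exact Or.inl ⟨j, by omega, g, hg, rfl⟩
  · rintro (⟨j, hj, g, hg, rfl⟩ | ⟨g, hg, rfl⟩)
    · exact ⟨j, by omega, g, hg, rfl⟩
    · exact ⟨s + 1, le_rfl, g, hg, rfl⟩

/-- On a cover avoiding both ends f contributes nothing, so g itself must reach t - s. On any other
cover t - s - 1 suffices, because returning one factor f to the light part adds at least 1. -/
theorem heavySet_inter {𝒞 : Set (Finset V)} {p q : V} {f : V →₀ ℕ}
    (hp : 1 ≤ f p) (hq : 1 ≤ f q) (hf : ∀ v, v ≠ p → v ≠ q → f v = 0) {t s : ℕ} (hs : s < t) :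
    heavySet 𝒞 f t s ∩ (fun g => (s + 1) • f + g) '' coverSet 𝒞 (fun _ => 0) (t - (s + 1)) =
      (fun g => (s + 1) • f + g) '' coverSet 𝒞 (endMark q p) (t - s) := by
  have hpos : ∀ C : Finset V, q ∈ C ∨ p ∈ C → 1 ≤ ∑ v ∈ C, f v := by
    rintro C (h | h)
    · exact hq.trans (single_le_sum (f := fun v => f v) (fun _ _ => Nat.zero_le _) h)
    · exact hp.trans (single_le_sum (f := fun v => f v) (fun _ _ => Nat.zero_le _) h)
  have hzero : ∀ C : Finset V, ¬(q ∈ C ∨ p ∈ C) → ∑ v ∈ C, f v = 0 := by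
    intro C h
    push Not at h
    exact sum_eq_zero fun v hv => hf v (fun e => h.2 (e ▸ hv)) (fun e => h.1 (e ▸ hv))
  apply Set.Subset.antisymm
  · rintro _ ⟨⟨j, hj, g', hg', he⟩, ⟨g, hg, rfl⟩⟩
    refine ⟨g, fun C hC => ?_, rfl⟩
    have h1 : _ ≤ 0 + ∑ v ∈ C, g v := hg C hC
    have h2 : _ ≤ 0 + ∑ v ∈ C, g' v := hg' C hC
    unfold endMark
    split_ifs with hC'
    · omega
    · have h3 : ∑ v ∈ C, ((s + 1) • f + g) v = ∑ v ∈ C, (j • f + g') v :=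
        congrArg (fun h : V →₀ ℕ => ∑ v ∈ C, h v) he
      simp only [Finsupp.add_apply, Finsupp.smul_apply, smul_eq_mul, sum_add_distrib, ← mul_sum,
        hzero C hC', mul_zero, zero_add] at h3
      omega
  · rintro _ ⟨g, hg, rfl⟩
    refine ⟨⟨s, le_rfl, f + g, fun C hC => ?_, ?_⟩, ⟨g, fun C hC => ?_, rfl⟩⟩
    · have h1 := hg C hC
      simp only [Finsupp.add_apply, sum_add_distrib]
      unfold endMark at h1
      split_ifs at h1 with hC'
      · have := hpos C hC'; omega
      · omega
    · dsimp only
      rw [succ_nsmul, add_assoc]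
    · have h1 := hg C hC
      unfold endMark at h1
      split_ifs at h1 <;> omega

/-- Regularity of the powers of a path ideal plus one heavy edge closing the cycle. -/
theorem regLE_heavySet {m : ℕ} {I : Finset ℕ} (h : IsAlmostPath m I) (y : ℕ → V)
    (hy : Set.InjOn y (Set.Iio (m + 3))) {a t : ℕ} (ha : 2 ≤ a) (ht : 1 ≤ t) (s : ℕ)
    (hst : s ≤ t) :
    RegLE 𝕜 (heavySet (lineCovers y I)
      (Finsupp.single (y (m + 2)) a + Finsupp.single (y 0) a) t s)
      (2 * (a : ℤ) * t + (m / 3 : ℕ) - 1) := by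
  set f := Finsupp.single (y (m + 2)) a + Finsupp.single (y 0) a with hf
  have hpq : y (m + 2) ≠ y 0 := fun e => by
    have := hy (Set.mem_Iio.2 (by omega)) (Set.mem_Iio.2 (by omega)) e
    omega
  have hdeg : ∀ j : ℕ, ((j • f).degree : ℤ) = 2 * a * j := by
    intro j
    rw [hf, map_nsmul, map_add, Finsupp.degree_single, Finsupp.degree_single, smul_eq_mul]
    push_cast; ring
  induction s with
  | zero =>
    have h0 : heavySet (lineCovers y I) f t 0 = coverSet (lineCovers y I) (fun _ => 0) t := by
      ext g
      simp [heavySet]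
    obtain ⟨t, rfl⟩ : ∃ t', t = t' + 1 := ⟨t - 1, by omega⟩
    rw [h0]
    refine (regLE_lineCovers_almostPath h y hy t).mono ?_
    -- The summand 2 in the bound for L^t is absorbed because a ≥ 2.
    push_cast
    nlinarith
  | succ s ih =>
    rw [heavySet_succ]
    obtain ⟨d, rfl⟩ : ∃ d, t = s + 1 + d := ⟨t - (s + 1), by omega⟩
    refine regLE_union (isUpperSet_heavySet _ _ _ _) (isUpperSet_image_add
      (isUpperSet_coverSet _ _ _) _) (ih (by omega)) ?_ ?_
    · rcases d with _ | d
      · have h1 := (regLE_of_zero_mem (𝕜 := 𝕜) (U := coverSet (lineCovers y I) (fun _ => 0)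
          (s + 1 + 0 - (s + 1))) (zero_mem_coverSet (by simp)) (-1)).image_add
          (isUpperSet_coverSet _ _ _) le_rfl ((s + 1) • f)
        refine h1.mono ?_
        rw [hdeg]
        simp only [add_zero]
        push_cast
        omega
      · have h1 := (regLE_lineCovers_almostPath (𝕜 := 𝕜) h y hy d).image_add
          (isUpperSet_coverSet _ _ _) (by omega) ((s + 1) • f)
        rw [show s + 1 + (d + 1) - (s + 1) = d + 1 by omega]
        refine h1.mono ?_
        rw [hdeg]
        push_cast
        nlinarith
    -- The intersection is allowed one more; for d = 0 the estimate holds with no slack.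
    · rw [heavySet_inter (p := y (m + 2)) (q := y 0) (by simp [hf, hpq]; omega) (by simp [hf, hpq]; omega)
        (fun v h1 h2 => by simp [hf, h1.symm, h2.symm]) (by omega)]
      have h1 := (regLE_markedEnds (𝕜 := 𝕜) h y hy d).image_add
          (isUpperSet_coverSet _ _ _) (by omega) ((s + 1) • f)
      rw [show s + 1 + d - s = d + 1 by omega]
      refine h1.mono ?_
      rw [hdeg]
      push_cast
      nlinarith

end HeavyEdge

/-! ### Powers of monomial ideals with several heavy generators. -/

section Powers

variable {𝕜 V : Type*} [Field 𝕜] [Fintype V] [DecidableEq V]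

/-- The exponents of the monomials in the `t`-th power of the ideal generated by the monomials with
exponents in `E`. -/
def powSet (E : Set (V →₀ ℕ)) : ℕ → Set (V →₀ ℕ)
  | 0 => Set.univ
  | t + 1 => {g | ∃ e ∈ E, ∃ h ∈ powSet E t, g = e + h}

theorem isUpperSet_powSet (E : Set (V →₀ ℕ)) (t : ℕ) : IsUpperSet (powSet E t) := by
  induction t with
  | zero => exact isUpperSet_univ
  | succ t ih =>
    rintro _ b hab ⟨e, he, h, hh, rfl⟩
    obtain ⟨c, rfl⟩ := exists_add_of_le hab
    exact ⟨e, he, h + c, ih (by simp) hh, add_assoc _ _ _⟩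

theorem monomialIdeal_pow (E : Set (V →₀ ℕ)) (t : ℕ) :
    monomialIdeal 𝕜 E ^ t = monomialIdeal 𝕜 (powSet E t) := by
  induction t with
  | zero =>
    rw [pow_zero, Ideal.one_eq_top, eq_comm, Ideal.eq_top_iff_one]
    exact (mem_monomialIdeal isUpperSet_univ).2 fun m _ => trivial
  | succ t ih =>
    rw [pow_succ', ih, monomialIdeal, monomialIdeal, Ideal.span_mul_span', monomialIdeal]
    congr 1
    ext p
    simp only [Set.mem_mul, Set.mem_image]
    constructor
    · rintro ⟨_, ⟨e, he, rfl⟩, _, ⟨h, hh, rfl⟩, rfl⟩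
      exact ⟨e + h, ⟨e, he, h, hh, rfl⟩, by rw [MvPolynomial.monomial_mul, one_mul]⟩
    · rintro ⟨_, ⟨e, he, h, hh, rfl⟩, rfl⟩
      exact ⟨_, ⟨e, he, rfl⟩, _, ⟨h, hh, rfl⟩, by rw [MvPolynomial.monomial_mul, one_mul]⟩

theorem sum_add_apply (C : Finset V) (f g : V →₀ ℕ) :
    ∑ v ∈ C, (f + g : V →₀ ℕ) v = ∑ v ∈ C, f v + ∑ v ∈ C, g v := by
  simp only [Finsupp.add_apply, sum_add_distrib]

theorem nsmul_add_mem_powSet {E : Set (V →₀ ℕ)} {e h : V →₀ ℕ} (he : e ∈ E) {t : ℕ}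
    (hh : h ∈ powSet E t) (s : ℕ) : s • e + h ∈ powSet E (t + s) := by
  induction s with
  | zero => simpa using hh
  | succ s ih => exact ⟨e, he, s • e + h, ih, by rw [succ_nsmul', add_assoc]⟩

theorem heavySet_subset_powSet {𝒞 : Set (Finset V)} {E : Set (V →₀ ℕ)} {f : V →₀ ℕ}
    (hf : f ∈ E) (h : ∀ k, coverSet 𝒞 (fun _ => 0) k ⊆ powSet E k) {t s : ℕ} (hst : s ≤ t) :
    heavySet 𝒞 f t s ⊆ powSet E t := by
  rintro _ ⟨j, hj, g, hg, rfl⟩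
  have := nsmul_add_mem_powSet hf (h _ hg) j
  rwa [Nat.sub_add_cancel (hj.trans hst)] at this

variable {ι : Type*} {𝒞 : Set (Finset V)} {E : Set (V →₀ ℕ)} {H : Finset ι} {f : ι → V →₀ ℕ}

/-- Two different heavy generators multiply to weight at least 2 on every cover, so they can be
traded for two light factors until a single heavy generator is left. -/
theorem powSet_subset_iUnion_heavySet (hH : H.Nonempty)
    (hE : ∀ e ∈ E, (∀ C ∈ 𝒞, 1 ≤ ∑ v ∈ C, e v) ∨ ∃ i ∈ H, e = f i)
    (hlink : ∀ i ∈ H, ∀ j ∈ H, i ≠ j → ∀ C ∈ 𝒞, 2 ≤ ∑ v ∈ C, f i v ∨ 2 ≤ ∑ v ∈ C, f j v) (t : ℕ) :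
    powSet E t ⊆ ⋃ i ∈ H, heavySet 𝒞 (f i) t t := by
  induction t with
  | zero =>
    obtain ⟨i, hi⟩ := hH
    intro g _
    exact Set.mem_biUnion hi ⟨0, le_rfl, g, fun C _ => by simp, by simp⟩
  | succ t ih =>
    rintro _ ⟨e, he, h, hh, rfl⟩
    obtain ⟨j, hj, s, hs, g, hg, rfl⟩ := Set.mem_iUnion₂.1 (ih hh)
    rcases hE e he with he | ⟨i, hi, rfl⟩
    · refine Set.mem_biUnion hj ⟨s, by omega, e + g, fun C hC => ?_, add_left_comm _ _ _⟩
      have h1 := he C hC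
      have h2 := hg C hC
      rw [sum_add_apply]
      omega
    · by_cases hij : i = j
      · subst hij
        refine Set.mem_biUnion hi ⟨s + 1, by omega, g, fun C hC => ?_, ?_⟩
        · have h2 := hg C hC
          omega
        · rw [succ_nsmul', add_assoc]
      rcases s with _ | s
      · exact Set.mem_biUnion hi ⟨1, by omega, g, by simpa using hg, by simp⟩
      · refine Set.mem_biUnion hj ⟨s, by omega, f i + f j + g, fun C hC => ?_, ?_⟩
        · have h1 := hlink i hi j hj hij C hC
          have h2 := hg C hC
          rw [sum_add_apply, sum_add_apply]
          omega
        · rw [succ_nsmul]; abel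

/-- On each cover one of the two generators has weight at least 2, so replacing its factors by light
ones costs nothing there. -/
theorem heavySet_inter_heavySet {f f' : V →₀ ℕ}
    (hlink : ∀ C ∈ 𝒞, 2 ≤ ∑ v ∈ C, f v ∨ 2 ≤ ∑ v ∈ C, f' v) (t : ℕ) :
    heavySet 𝒞 f t t ∩ heavySet 𝒞 f' t t = coverSet 𝒞 (fun _ => 0) t := by
  have key : ∀ (f : V →₀ ℕ) (x) (C : Finset V), C ∈ 𝒞 → x ∈ heavySet 𝒞 f t t →
      2 ≤ ∑ v ∈ C, f v → t ≤ 0 + ∑ v ∈ C, x v := by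
    rintro f _ C hC ⟨s, hs, g, hg, rfl⟩ h
    have h1 := hg C hC
    rw [sum_add_apply]
    simp only [Finsupp.smul_apply, smul_eq_mul, ← mul_sum]
    have := Nat.mul_le_mul_left s h
    dsimp only at h1
    omega
  apply Set.Subset.antisymm
  · rintro x ⟨h1, h2⟩ C hC
    exact (hlink C hC).elim (key f x C hC h1) (key f' x C hC h2)
  · exact fun x hx => ⟨⟨0, by omega, x, hx, by simp⟩, ⟨0, by omega, x, hx, by simp⟩⟩

theorem regLE_iUnion_heavySet (hH : H.Nonempty)
    (hlink : ∀ i ∈ H, ∀ j ∈ H, i ≠ j → ∀ C ∈ 𝒞, 2 ≤ ∑ v ∈ C, f i v ∨ 2 ≤ ∑ v ∈ C, f j v)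
    {t : ℕ} {r : ℤ} (h : ∀ i ∈ H, RegLE 𝕜 (heavySet 𝒞 (f i) t t) r)
    (h0 : RegLE 𝕜 (coverSet 𝒞 (fun _ => 0) t) (r + 1)) :
    RegLE 𝕜 (⋃ i ∈ H, heavySet 𝒞 (f i) t t) r := by
  classical
  induction hH using Finset.Nonempty.cons_induction with
  | singleton a => simpa using h a
  | cons a s ha hs ih =>
    rw [cons_eq_insert, set_biUnion_insert]
    refine regLE_union (isUpperSet_heavySet _ _ _ _)
      (isUpperSet_iUnion₂ fun i _ => isUpperSet_heavySet _ _ _ _) (h a (by simp))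
      (ih (fun i hi j hj => hlink i (by simp [hi]) j (by simp [hj]))
        fun i hi => h i (by simp [hi])) ?_
    have : heavySet 𝒞 (f a) t t ∩ ⋃ i ∈ s, heavySet 𝒞 (f i) t t =
        coverSet 𝒞 (fun _ => 0) t := by
      rw [Set.inter_iUnion₂]
      obtain ⟨b, hb⟩ := hs
      have : ∀ i ∈ s, heavySet 𝒞 (f a) t t ∩ heavySet 𝒞 (f i) t t = coverSet 𝒞 (fun _ => 0) t :=
        fun i hi => heavySet_inter_heavySet (hlink a (by simp) i (by simp [hi])
          (fun e => ha (e ▸ hi))) t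
      rw [Set.iUnion₂_congr this]
      exact Set.biUnion_const ⟨b, hb⟩ _
    rwa [this]

/-- A path is bipartite, so the powers of its edge ideal are given by its vertex covers. -/
theorem exists_edge_of_mem_coverSet {y : ℕ → V} {ℓ : ℕ} (hy : Set.InjOn y (Set.Iio ℓ))
    {I : Finset ℕ} (hI : ∀ i ∈ I, i + 1 < ℓ) {k : ℕ} {g : V →₀ ℕ}
    (hg : g ∈ coverSet (lineCovers y I) (fun _ => 0) (k + 1)) :
    ∃ i ∈ I, ∃ h ∈ coverSet (lineCovers y I) (fun _ => 0) k,
      g = Finsupp.single (y i) 1 + Finsupp.single (y (i + 1)) 1 + h := by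
  -- Otherwise the vertices where g vanishes would form a cover of weight 0.
  have hex : ∃ i, i ∈ I ∧ 0 < g (y i) ∧ 0 < g (y (i + 1)) := by
    by_contra! hcon
    have := hg (univ.filter fun v => g v = 0) fun i hi => by
      simp only [mem_filter, mem_univ, true_and]
      have := hcon i hi
      omega
    rw [sum_eq_zero fun v hv => (mem_filter.1 hv).2] at this
    dsimp only at this
    omega
  classical
  -- The leftmost such edge is divided out: g then vanishes at the left neighbour of `y i`, if there
  -- is one.
  obtain ⟨i, ⟨hiI, h0, h1⟩, hmin⟩ : ∃ i, (i ∈ I ∧ 0 < g (y i) ∧ 0 < g (y (i + 1))) ∧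
      ∀ j < i, ¬(j ∈ I ∧ 0 < g (y j) ∧ 0 < g (y (j + 1))) :=
    ⟨Nat.find hex, Nat.find_spec hex, fun j => Nat.find_min hex⟩
  have hil := hI i hiI
  have hne : y i ≠ y (i + 1) := fun e => by
    have := hy (Set.mem_Iio.2 (by omega)) (Set.mem_Iio.2 (by omega)) e
    omega
  have hle : Finsupp.single (y i) 1 + Finsupp.single (y (i + 1)) 1 ≤ g := by
    intro v
    by_cases hv : v = y i
    · subst hv; simp [hne]; omega
    · by_cases hv' : v = y (i + 1)
      · subst hv'; simp [hne]; omega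
      · simp [Ne.symm hv, Ne.symm hv']
  obtain ⟨h, rfl⟩ := exists_add_of_le hle
  refine ⟨i, hiI, h, fun C hC => ?_, rfl⟩
  have hsum : ∀ D : Finset V, ∑ v ∈ D, (Finsupp.single (y i) 1 + Finsupp.single (y (i + 1)) 1
      + h : V →₀ ℕ) v = (if y i ∈ D then 1 else 0) + (if y (i + 1) ∈ D then 1 else 0) +
        ∑ v ∈ D, h v := by
    intro D
    rw [add_assoc, sum_single_add, sum_single_add, add_assoc]
  by_cases hb : y i ∈ C ∧ y (i + 1) ∈ C
  swap
  · have := hg C hC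
    rw [hsum] at this
    split_ifs at this <;> first | omega | tauto
  -- Exchanging `y i` for its left neighbour costs nothing, so g weighs at least k + 1 + g (y i) ≥ k
  -- + 2 on C, and 2 may be subtracted.
  let D : Finset V := C.erase (y i) ∪ univ.filter fun v => ∃ j ∈ I, j + 1 = i ∧ v = y j
  have hD : D ∈ lineCovers y I := by
    intro j hj
    have hjl := hI j hj
    simp only [D, mem_union, mem_erase, mem_filter, mem_univ, true_and]
    by_cases hji : j = i
    · subst hji
      exact Or.inr (Or.inl ⟨hne.symm, hb.2⟩)
    by_cases hji' : j + 1 = i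
    · exact Or.inl (Or.inr ⟨j, hj, hji', rfl⟩)
    have h1 : y j ≠ y i := fun e => hji (hy (Set.mem_Iio.2 (by omega)) (Set.mem_Iio.2 (by omega)) e)
    have h2 : y (j + 1) ≠ y i := fun e =>
      hji' (hy (Set.mem_Iio.2 (by omega)) (Set.mem_Iio.2 (by omega)) e)
    exact (hC j hj).imp (fun h => Or.inl ⟨h1, h⟩) fun h => Or.inl ⟨h2, h⟩
  have hDle := hg D hD
  have h1 : ∑ v ∈ D, (Finsupp.single (y i) 1 + Finsupp.single (y (i + 1)) 1 + h : V →₀ ℕ) v ≤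
      ∑ v ∈ C.erase (y i),
        (Finsupp.single (y i) 1 + Finsupp.single (y (i + 1)) 1 + h : V →₀ ℕ) v := by
    refine sum_le_sum_of_ne_zero fun v hv hgv => ?_
    rcases mem_union.1 hv with hv | hv
    · exact hv
    · obtain ⟨j, hj, hji, rfl⟩ := (mem_filter.1 hv).2
      refine absurd ⟨hj, Nat.pos_of_ne_zero hgv, ?_⟩ (hmin j (by omega))
      rwa [hji]
  have h2 := add_sum_erase C
    (fun v => (Finsupp.single (y i) 1 + Finsupp.single (y (i + 1)) 1 + h : V →₀ ℕ) v) hb.1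
  have h3 := hsum C
  rw [if_pos hb.1, if_pos hb.2] at h3
  dsimp only at h2 hDle ⊢
  omega

theorem coverSet_subset_powSet {y : ℕ → V} {ℓ : ℕ} (hy : Set.InjOn y (Set.Iio ℓ))
    {I : Finset ℕ} (hI : ∀ i ∈ I, i + 1 < ℓ) {E : Set (V →₀ ℕ)}
    (hE : ∀ i ∈ I, Finsupp.single (y i) 1 + Finsupp.single (y (i + 1)) 1 ∈ E) (k : ℕ) :
    coverSet (lineCovers y I) (fun _ => 0) k ⊆ powSet E k := by
  induction k with
  | zero => exact fun _ _ => trivial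
  | succ k ih =>
    intro g hg
    obtain ⟨i, hi, h, hh, rfl⟩ := exists_edge_of_mem_coverSet hy hI hg
    exact ⟨_, hE i hi, h, ih hh, rfl⟩

end Powers

/-! ### A nonvanishing criterion: Koszul classes on a cross-polytope. -/

section Pairing

variable {𝕜 V : Type*} [Field 𝕜] [Fintype V] [DecidableEq V]

/-- The sets containing exactly one element of every pair `{v, κ v}` in `P`, and nothing else. -/
def transversals (P : Finset V) (κ : V → V) : Finset (Finset V) :=
  P.powerset.filter fun σ => ∀ v ∈ P, v ∈ σ ↔ κ v ∉ σ

theorem mem_transversals {P : Finset V} {κ : V → V} {σ : Finset V} :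
    σ ∈ transversals P κ ↔ σ ⊆ P ∧ ∀ v ∈ P, v ∈ σ ↔ κ v ∉ σ := by
  rw [transversals, mem_filter, mem_powerset]

/-- The exponent `a` with one subtracted at the elements of `σ`. -/
noncomputable def lowerOn (a : V →₀ ℕ) (σ : Finset V) : V →₀ ℕ := a - ∑ v ∈ σ, Finsupp.single v 1

theorem lowerOn_apply (a : V →₀ ℕ) (σ : Finset V) (v : V) :
    lowerOn a σ v = a v - if v ∈ σ then 1 else 0 := by
  rw [lowerOn, Finsupp.tsub_apply, Finsupp.finsetSum_apply]
  simp only [Finsupp.single_apply]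
  rw [sum_ite_eq']

theorem lowerOn_insert_add {a : V →₀ ℕ} {σ : Finset V} {v : V} (hv : v ∉ σ) (ha : 1 ≤ a v) :
    Finsupp.single v 1 + lowerOn a (insert v σ) = lowerOn a σ := by
  ext u
  rw [Finsupp.add_apply, lowerOn_apply, lowerOn_apply, Finsupp.single_apply]
  by_cases h : v = u
  · subst h; simp [hv]; omega
  · simp [h, Ne.symm h]

theorem degree_lowerOn {a : V →₀ ℕ} {σ : Finset V} (h : ∀ v ∈ σ, 1 ≤ a v) :
    ((lowerOn a σ).degree : ℤ) = a.degree - σ.card := by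
  induction σ using Finset.induction_on with
  | empty => simp [lowerOn]
  | insert v σ hv ih =>
    have h1 := ih fun u hu => h u (mem_insert_of_mem hu)
    have h2 := congrArg Finsupp.degree (lowerOn_insert_add hv (h v (mem_insert_self _ _)))
    rw [map_add, Finsupp.degree_single] at h2
    rw [card_insert_of_notMem hv]
    push_cast
    omega

theorem coeff_lowerOn_mul {a : V →₀ ℕ} {σ : Finset V} {v : V} (hv : v ∉ σ) (ρ : V → ℕ)
    (p : MvPolynomial V 𝕜) :
    ((koszulSign 𝕜 ρ v σ * MvPolynomial.X v) • p).coeff (lowerOn a σ) =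
      if a v = 0 then 0 else (koszulSign 𝕜 ρ v σ * p).coeff (lowerOn a (insert v σ)) := by
  rw [smul_eq_mul, mul_right_comm, MvPolynomial.coeff_mul_X']
  split_ifs with h1 h2 h2
  · rw [Finsupp.mem_support_iff, lowerOn_apply] at h1; omega
  · rw [← lowerOn_insert_add hv (by omega), add_tsub_cancel_left]
  · rfl
  · rw [Finsupp.mem_support_iff, lowerOn_apply, if_neg hv] at h1; omega

/-- As no other vertex lies between u and v in the order, both see the same predecessors outside the
pair; only their mutual position produces the sign. -/
theorem koszulSign_exchange {ρ : V → ℕ} (hρ : Function.Injective ρ) {u v : V} {σ : Finset V}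
    (hu : u ∈ σ) (hv : v ∉ σ) (h : ∀ x, x ≠ u → x ≠ v → (ρ x < ρ u ↔ ρ x < ρ v)) :
    koszulSign 𝕜 ρ u (insert v (σ.erase u)) = -koszulSign 𝕜 ρ v σ := by
  have huv : u ≠ v := fun e => hv (e ▸ hu)
  have hv' : v ∉ σ.erase u := fun h => hv (mem_of_mem_erase h)
  have h1 := koszulSign_swap' (𝕜 := 𝕜) hρ (notMem_erase u σ) hv' huv
  have h2 : koszulSign 𝕜 ρ u (σ.erase u) = koszulSign 𝕜 ρ v (σ.erase u) := by
    unfold koszulSign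
    congr 2
    exact filter_congr fun x hx => h x (ne_of_mem_erase hx) fun e => hv' (e ▸ hx)
  rw [h2, koszulSign_mul_self, insert_erase hu] at h1
  have h3 := koszulSign_mul_self (𝕜 := 𝕜) ρ v σ
  linear_combination koszulSign 𝕜 ρ v σ * h1 - koszulSign 𝕜 ρ u (insert v (σ.erase u)) * h3

/-- A set containing one full pair and one element of each other pair arises from exactly two
transversals, with opposite signs by `koszulSign_exchange`. Thus the sum over transversals is a
functional killing boundaries. -/
theorem sum_transversals_koszulD {P : Finset V} {κ : V → V} {ρ : V → ℕ}
    (hρ : Function.Injective ρ) (hP : ∀ v ∈ P, κ v ∈ P ∧ κ (κ v) = v)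
    (hadj : ∀ v ∈ P, ∀ u, u ≠ v → u ≠ κ v → (ρ u < ρ v ↔ ρ u < ρ (κ v)))
    {a : V →₀ ℕ} (ha : ∀ v, v ∈ P ↔ a v ≠ 0) (z : Finset V → MvPolynomial V 𝕜) :
    ∑ σ ∈ transversals P κ, (koszulD (𝕜 := 𝕜) ρ z σ).coeff (lowerOn a σ) = 0 := by
  have h1 : ∀ σ ∈ transversals P κ, (koszulD (𝕜 := 𝕜) ρ z σ).coeff (lowerOn a σ) =
      ∑ v ∈ P \ σ, (koszulSign 𝕜 ρ v σ * z (insert v σ)).coeff (lowerOn a (insert v σ)) := by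
    intro σ _
    rw [koszulD_apply, MvPolynomial.coeff_sum]
    symm
    refine sum_subset_zero_on_sdiff (fun v hv => ?_) (fun v hv => ?_) fun v hv => ?_
    · exact mem_compl.2 (mem_sdiff.1 hv).2
    · obtain ⟨h1, h2⟩ := mem_sdiff.1 hv
      have hv := mem_compl.1 h1
      have : v ∉ P := fun h => h2 (mem_sdiff.2 ⟨h, hv⟩)
      rw [coeff_lowerOn_mul hv, if_pos]
      by_contra h
      exact this ((ha v).2 h)
    · obtain ⟨h1, h2⟩ := mem_sdiff.1 hv
      rw [coeff_lowerOn_mul h2, if_neg ((ha v).1 h1)]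
  rw [sum_congr rfl h1, sum_sigma']
  have key : ∀ x : (_ : Finset V) × V, x ∈ (transversals P κ).sigma (fun σ => P \ σ) →
      x.1 ⊆ P ∧ (∀ v ∈ P, v ∈ x.1 ↔ κ v ∉ x.1) ∧ x.2 ∈ P ∧ x.2 ∉ x.1 ∧ κ x.2 ∈ P ∧
        κ x.2 ∈ x.1 ∧ κ (κ x.2) = x.2 ∧ κ x.2 ≠ x.2 := by
    rintro ⟨σ, v⟩ hx
    obtain ⟨h1, h2⟩ := mem_sigma.1 hx
    obtain ⟨h3, h4⟩ := mem_transversals.1 h1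
    obtain ⟨h5, h6⟩ := mem_sdiff.1 h2
    have h7 : κ v ∈ σ := by
      by_contra h
      exact h6 ((h4 v h5).2 h)
    exact ⟨h3, h4, h5, h6, (hP v h5).1, h7, (hP v h5).2, fun e => h6 (e ▸ h7)⟩
  refine sum_involution (fun x _ => ⟨insert x.2 (x.1.erase (κ x.2)), κ x.2⟩) ?_ ?_ ?_ ?_
  · rintro ⟨σ, v⟩ hx
    obtain ⟨h3, h4, h5, h6, h7, h8, h9, h10⟩ := key _ hx
    dsimp only at *
    rw [koszulSign_exchange hρ h8 h6 fun x hx hx' => (hadj v h5 x hx' hx).symm,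
      insert_comm, insert_erase h8, neg_mul, MvPolynomial.coeff_neg, add_neg_cancel]
  · rintro ⟨σ, v⟩ hx _ he
    obtain ⟨h3, h4, h5, h6, h7, h8, h9, h10⟩ := key _ hx
    exact h10 (congrArg Sigma.snd he)
  · rintro ⟨σ, v⟩ hx
    obtain ⟨h3, h4, h5, h6, h7, h8, h9, h10⟩ := key _ hx
    dsimp only at *
    rw [mem_sigma, mem_transversals, mem_sdiff]
    refine ⟨⟨insert_subset h5 ((erase_subset _ _).trans h3), fun u hu => ?_⟩, h7, ?_⟩
    · by_cases hu1 : u = v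
      · subst hu1; simp [h10]
      by_cases hu2 : u = κ v
      · subst hu2; simp [h9, h10]
      · have h11 : κ u ≠ v := fun e => hu2 (by rw [← e, (hP u hu).2])
        have h12 : κ u ≠ κ v := fun e => hu1 (by rw [← (hP u hu).2, e, h9])
        simp [hu1, hu2, h11, h12, h4 u hu]
    · simp [h10]
  · rintro ⟨σ, v⟩ hx
    obtain ⟨h3, h4, h5, h6, h7, h8, h9, h10⟩ := key _ hx
    dsimp only at *
    rw [h9, erase_insert (fun h => h6 (mem_of_mem_erase h)), insert_erase h8]

/-- By `hcycle` the single wedge σ₀ with coefficient x^(a - σ₀) is a cycle modulo the ideal. The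
functional of `sum_transversals_koszulD` kills boundaries, vanishes on the ideal by `hnot`, and
equals 1 on this cycle. -/
theorem not_koszulVanishing_of_pairing {P : Finset V} {κ : V → V} {ρ : V → ℕ}
    (hρ : Function.Injective ρ) (hP : ∀ v ∈ P, κ v ∈ P ∧ κ (κ v) = v)
    (hadj : ∀ v ∈ P, ∀ u, u ≠ v → u ≠ κ v → (ρ u < ρ v ↔ ρ u < ρ (κ v)))
    {a : V →₀ ℕ} (ha : ∀ v, v ∈ P ↔ a v ≠ 0) {U : Set (V →₀ ℕ)} (hU : IsUpperSet U)
    {σ₀ : Finset V} (hσ₀ : σ₀ ∈ transversals P κ)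
    (hcycle : ∀ v ∈ σ₀, lowerOn a (σ₀.erase v) ∈ U)
    (hnot : ∀ σ ∈ transversals P κ, lowerOn a σ ∉ U) :
    ¬KoszulVanishing ρ (polyDegree 𝕜 V) (monomialIdeal 𝕜 U) σ₀.card a.degree := by
  intro hvan
  have hpos : ∀ v ∈ σ₀, 1 ≤ a v := fun v hv =>
    Nat.one_le_iff_ne_zero.2 ((ha v).1 ((mem_transversals.1 hσ₀).1 hv))
  let z : Finset V → MvPolynomial V 𝕜 := fun σ =>
    if σ = σ₀ then MvPolynomial.monomial (lowerOn a σ₀) 1 else 0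
  have hz : z ∈ koszulChain V (polyDegree 𝕜 V) σ₀.card a.degree := by
    refine ⟨fun σ _ => ?_, fun σ hσ => if_neg fun e : σ = σ₀ => hσ (by rw [e])⟩
    by_cases h : σ = σ₀
    · simp only [z, if_pos h]
      rw [← degree_lowerOn hpos]
      exact monomial_mem_polyDegree _ _
    · simp only [z, if_neg h]
      exact zero_mem _
  obtain ⟨y, _, hy⟩ := hvan z hz fun τ => by
    rw [koszulD_apply]
    refine sum_mem fun v hv => ?_
    have hv := mem_compl.1 hv
    by_cases h : insert v τ = σ₀
    · simp only [z, if_pos h]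
      rw [smul_eq_mul, mul_assoc]
      refine Ideal.mul_mem_left _ _ (Ideal.subset_span ⟨lowerOn a τ, ?_, ?_⟩)
      · have := hcycle v (h ▸ mem_insert_self _ _)
        rwa [← h, erase_insert hv] at this
      · rw [← h, MvPolynomial.X, MvPolynomial.monomial_mul, one_mul,
          lowerOn_insert_add hv (hpos v (h ▸ mem_insert_self _ _))]
    · simp only [z, if_neg h, smul_zero]
      exact zero_mem _
  have h0 : ∀ σ ∈ transversals P κ, ((z - koszulD (𝕜 := 𝕜) ρ y) σ).coeff (lowerOn a σ) = 0 := by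
    intro σ hσ
    by_contra h
    exact hnot σ hσ ((mem_monomialIdeal hU).1 (hy σ) _ h)
  have h1 := sum_eq_zero h0
  simp only [Pi.sub_apply, MvPolynomial.coeff_sub, sum_sub_distrib,
    sum_transversals_koszulD hρ hP hadj ha, sub_zero] at h1
  rw [sum_eq_single_of_mem σ₀ hσ₀ fun σ _ h => by simp [z, h]] at h1
  simp [z] at h1

end Pairing

/-! ### Weighted cycles with linked heavy edges, and the upper bound. -/

section Cycle

variable {𝕜 V : Type*} [Field 𝕜] [Fintype V] [DecidableEq V]

/-- `z` runs periodically through the vertices of a cycle of length `n`, and `W i` is the weight of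
the edge joining `z i` and `z (i + 1)`. -/
structure IsWeightedCycle (n : ℕ) (z : ℕ → V) (W : ℕ → ℕ) : Prop where
  three_le : 3 ≤ n
  vertex : ∀ a b, z a = z b ↔ a ≡ b [MOD n]
  weight : ∀ a b, a ≡ b [MOD n] → W a = W b
  pos : ∀ a, 1 ≤ W a
  surjective : Function.Surjective z

/-- The exponent of the `i`-th generator of the weighted edge ideal. -/
noncomputable def cycleEdge (z : ℕ → V) (W : ℕ → ℕ) (i : ℕ) : V →₀ ℕ :=
  Finsupp.single (z i) (W i) + Finsupp.single (z (i + 1)) (W i)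

/-- Any two edges of weight at least two are joined by an edge of weight one. -/
def HeavyLinked (n : ℕ) (W : ℕ → ℕ) : Prop :=
  ∀ i j, 2 ≤ W i → 2 ≤ W j → ¬i ≡ j [MOD n] →
    ∃ k, W k = 1 ∧ (k ≡ i + 1 [MOD n] ∧ k + 1 ≡ j [MOD n] ∨ k ≡ j + 1 [MOD n] ∧ k + 1 ≡ i [MOD n])

/-- The vertex covers of the graph formed by the edges of weight one. -/
def lightCovers (z : ℕ → V) (W : ℕ → ℕ) : Set (Finset V) :=
  {C | ∀ j, W j = 1 → z j ∈ C ∨ z (j + 1) ∈ C}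

theorem sum_cycleEdge (z : ℕ → V) (W : ℕ → ℕ) (i : ℕ) (C : Finset V) :
    ∑ v ∈ C, cycleEdge z W i v = (if z i ∈ C then W i else 0) + if z (i + 1) ∈ C then W i else 0 := by
  rw [cycleEdge, sum_add_apply]
  simp only [Finsupp.single_apply]
  rw [sum_ite_eq, sum_ite_eq]

theorem exists_offset (n : ℕ) (hn : 0 < n) (i j : ℕ) : ∃ d < n, j ≡ i + d [MOD n] := by
  refine ⟨(j + (n - 1) * i) % n, Nat.mod_lt _ hn, ?_⟩
  have h : i + (j + (n - 1) * i) = j + n * i := by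
    obtain ⟨k, rfl⟩ : ∃ k, n = k + 1 := ⟨n - 1, by omega⟩
    simp; ring
  have h1 : i + (j + (n - 1) * i) % n ≡ i + (j + (n - 1) * i) [MOD n] :=
    (Nat.ModEq.refl i).add (Nat.mod_modEq _ _)
  rw [h] at h1
  refine (h1.trans ?_).symm
  simp [Nat.ModEq]

namespace IsWeightedCycle

variable {n : ℕ} {z : ℕ → V} {W : ℕ → ℕ}

theorem eq_of_add_modEq_add {i a b : ℕ} (ha : a < n) (hb : b < n) (h : i + a ≡ i + b [MOD n]) :
    a = b :=
  Nat.ModEq.eq_of_lt_of_lt (Nat.ModEq.add_left_cancel' i h) ha hb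

theorem not_modEq_add {i d : ℕ} (h0 : 0 < d) (hd : d < n) :
    ¬i + d ≡ i [MOD n] := fun h => by
  have := eq_of_add_modEq_add hd (by omega) (show i + d ≡ i + 0 [MOD n] from h)
  omega

theorem injOn (hc : IsWeightedCycle n z W) (i : ℕ) :
    Set.InjOn (fun j => z (i + j)) (Set.Iio n) := fun _ ha _ hb h =>
  eq_of_add_modEq_add ha hb ((hc.vertex _ _).1 h)

theorem vertex_ne (hc : IsWeightedCycle n z W) (i : ℕ) : z i ≠ z (i + 1) := fun h =>
  not_modEq_add one_pos (by have := hc.three_le; omega) ((hc.vertex _ _).1 h).symm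

theorem cycleEdge_apply (hc : IsWeightedCycle n z W) (W' : ℕ → ℕ) (i : ℕ) (v : V) :
    cycleEdge z W' i v = if v = z i ∨ v = z (i + 1) then W' i else 0 := by
  have := hc.vertex_ne i
  rw [cycleEdge, Finsupp.add_apply, Finsupp.single_apply, Finsupp.single_apply]
  by_cases h1 : v = z i
  · subst h1; simp [this.symm]
  · by_cases h2 : v = z (i + 1)
    · subst h2; simp [this]
    · simp [h1, h2, Ne.symm h1, Ne.symm h2]

theorem cycleEdge_congr (hc : IsWeightedCycle n z W) {i j : ℕ} (h : i ≡ j [MOD n]) :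
    cycleEdge z W i = cycleEdge z W j := by
  rw [cycleEdge, cycleEdge, hc.weight _ _ h, (hc.vertex _ _).2 h,
    (hc.vertex _ _).2 (h.add_right 1)]

theorem modEq_of_ends (hc : IsWeightedCycle n z W) {i k : ℕ} (h1 : z k = z i ∨ z k = z (i + 1))
    (h2 : z (k + 1) = z i ∨ z (k + 1) = z (i + 1)) : k ≡ i [MOD n] := by
  have hn := hc.three_le
  simp only [hc.vertex] at h1 h2
  rcases h1 with h1 | h1
  · exact h1
  rcases h2 with h2 | h2
  · exact absurd ((h1.add_right 1).symm.trans h2) (not_modEq_add (d := 2) (by omega) hn)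
  · exact Nat.ModEq.add_right_cancel' 1 h2

/-- Edges of weight at least two other than the `i`-th are at distance two from it. -/
theorem heavy_offset (hc : IsWeightedCycle n z W) (hW : HeavyLinked n W) {i d : ℕ} (hi : 2 ≤ W i)
    (h0 : 0 < d) (hd : d < n) (h : 2 ≤ W (i + d)) : d = 2 ∨ d + 2 = n := by
  have hn := hc.three_le
  obtain ⟨k, -, ⟨h1, h2⟩ | ⟨h1, h2⟩⟩ := hW i (i + d) hi h
    fun h => not_modEq_add h0 hd h.symm
  · left
    have h3 : i + 2 ≡ i + d [MOD n] := (h1.add_right 1).symm.trans h2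
    exact (eq_of_add_modEq_add (by omega) hd h3).symm
  · right
    have h3 : i + (d + 2) ≡ i + 0 [MOD n] := (h1.add_right 1).symm.trans h2
    obtain ⟨c, hc'⟩ := (Nat.modEq_zero_iff_dvd).1 (Nat.ModEq.add_left_cancel' i h3)
    have h4 : 0 < c := by
      rcases Nat.eq_zero_or_pos c with rfl | h
      · omega
      · exact h
    have h5 : c < 2 := by
      by_contra h
      have := Nat.mul_le_mul_left n (show 2 ≤ c by omega)
      omega
    obtain rfl : c = 1 := by omega
    omega

/-- Other heavy edges sit at distance two from the i-th, hence at positions 1 and m after the cut. A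
light edge exists: if the next edge is heavy, linking supplies one. -/
theorem isAlmostPath {m : ℕ} (hc : IsWeightedCycle (m + 3) z W) (hW : HeavyLinked (m + 3) W)
    {i : ℕ} (hi : 2 ≤ W i) :
    IsAlmostPath m ((range (m + 2)).filter fun j => W (i + 1 + j) = 1) := by
  refine ⟨fun j hj => mem_range.1 (mem_filter.1 hj).1, fun j hj hj' => ?_, ?_⟩
  · have h1 : W (i + 1 + j) ≠ 1 := fun h => hj' (mem_filter.2 ⟨mem_range.2 hj, h⟩)
    have h2 := hc.pos (i + 1 + j)
    rw [add_assoc] at h1 h2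
    have := hc.heavy_offset hW (d := 1 + j) hi (by omega) (by omega) (by omega)
    omega
  · by_cases h : W (i + 1) = 1
    · exact ⟨0, mem_filter.2 ⟨mem_range.2 (by omega), h⟩⟩
    · obtain ⟨k, hk, -⟩ := hW i (i + 1) hi (by have := hc.pos (i + 1); omega)
        fun h => not_modEq_add one_pos (by omega) h.symm
      obtain ⟨d, hd, hkd⟩ := exists_offset (m + 3) (by omega) i k
      have hWk := hc.weight _ _ hkd
      rcases d with _ | d
      · rw [add_zero] at hWk; omega
      · refine ⟨d, mem_filter.2 ⟨mem_range.2 (by omega), ?_⟩⟩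
        rw [show i + 1 + d = i + (d + 1) by omega, ← hWk, hk]

theorem lightCovers_eq {m : ℕ} (hc : IsWeightedCycle (m + 3) z W) {i : ℕ} (hi : 2 ≤ W i) :
    lightCovers z W = lineCovers (fun j => z (i + 1 + j))
      ((range (m + 2)).filter fun j => W (i + 1 + j) = 1) := by
  ext C
  constructor
  · exact fun h j hj => h _ (mem_filter.1 hj).2
  · intro h k hk
    obtain ⟨d, hd, hkd⟩ := exists_offset (m + 3) (by omega) i k
    have hWk := hc.weight _ _ hkd
    rcases d with _ | d
    · rw [add_zero] at hWk; omega
    · rw [show i + (d + 1) = i + 1 + d by omega] at hkd hWk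
      rw [(hc.vertex _ _).2 hkd, (hc.vertex _ _).2 (hkd.add_right 1)]
      exact h d (mem_filter.2 ⟨mem_range.2 (by omega), by rw [← hWk, hk]⟩)

/-- The edges of weight at least two. -/
def heavyEdges (n : ℕ) (W : ℕ → ℕ) : Finset ℕ := (range n).filter fun i => 2 ≤ W i

theorem exists_mem_heavyEdges (hc : IsWeightedCycle n z W) {i : ℕ} (hi : 2 ≤ W i) :
    ∃ j ∈ heavyEdges n W, i ≡ j [MOD n] := by
  have hn := hc.three_le
  have h := (Nat.mod_modEq i n).symm
  exact ⟨i % n, mem_filter.2 ⟨mem_range.2 (Nat.mod_lt _ (by omega)), by rwa [← hc.weight _ _ h]⟩, h⟩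

/-- A light cover contains an end of the linking edge, and that vertex carries exponent at least 2
in one of the two heavy generators. -/
theorem two_le_sum_cycleEdge (hc : IsWeightedCycle n z W) (hW : HeavyLinked n W) :
    ∀ i ∈ heavyEdges n W, ∀ j ∈ heavyEdges n W, i ≠ j → ∀ C ∈ lightCovers z W,
      2 ≤ ∑ v ∈ C, cycleEdge z W i v ∨ 2 ≤ ∑ v ∈ C, cycleEdge z W j v := by
  intro i hi j hj hij C hC
  obtain ⟨hi, hi'⟩ := mem_filter.1 hi
  obtain ⟨hj, hj'⟩ := mem_filter.1 hj
  obtain ⟨k, hk, h⟩ := hW i j hi' hj' fun h =>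
    hij (Nat.ModEq.eq_of_lt_of_lt h (mem_range.1 hi) (mem_range.1 hj))
  simp only [← hc.vertex] at h
  rw [sum_cycleEdge, sum_cycleEdge]
  rcases hC k hk with h' | h' <;> rcases h with ⟨h1, h2⟩ | ⟨h1, h2⟩ <;>
    rw [‹z _ = z _›] at h' <;> simp only [if_pos h'] <;> omega

theorem powSet_subset (hc : IsWeightedCycle n z W) (hW : HeavyLinked n W) (hex : ∃ i, 2 ≤ W i)
    (t : ℕ) : powSet (Set.range (cycleEdge z W)) t ⊆
      ⋃ i ∈ heavyEdges n W, heavySet (lightCovers z W) (cycleEdge z W i) t t := by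
  refine powSet_subset_iUnion_heavySet ?_ ?_ (hc.two_le_sum_cycleEdge hW) t
  · obtain ⟨i, hi⟩ := hex
    obtain ⟨j, hj, -⟩ := hc.exists_mem_heavyEdges hi
    exact ⟨j, hj⟩
  · rintro _ ⟨i, rfl⟩
    by_cases hi : W i = 1
    · left
      intro C hC
      rw [sum_cycleEdge, hi]
      rcases hC i hi with h | h <;> simp [h]
    · right
      obtain ⟨j, hj, hij⟩ := hc.exists_mem_heavyEdges
        (show 2 ≤ W i by have := hc.pos i; omega)
      exact ⟨j, hj, hc.cycleEdge_congr hij⟩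

theorem powSet_eq {m : ℕ} (hc : IsWeightedCycle (m + 3) z W) (hW : HeavyLinked (m + 3) W)
    (hex : ∃ i, 2 ≤ W i) (t : ℕ) : powSet (Set.range (cycleEdge z W)) t =
      ⋃ i ∈ heavyEdges (m + 3) W, heavySet (lightCovers z W) (cycleEdge z W i) t t := by
  refine (hc.powSet_subset hW hex t).antisymm (Set.iUnion₂_subset fun i hi => ?_)
  refine heavySet_subset_powSet (Set.mem_range_self i) (fun k => ?_) le_rfl
  rw [hc.lightCovers_eq (mem_filter.1 hi).2]
  refine coverSet_subset_powSet (ℓ := m + 3) (hc.injOn _) (fun j hj => ?_) (fun j hj => ?_) k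
  · have := mem_range.1 (mem_filter.1 hj).1
    omega
  · refine ⟨i + 1 + j, ?_⟩
    rw [cycleEdge, (mem_filter.1 hj).2, add_assoc (i + 1)]

theorem regLE_powSet {m : ℕ} (hc : IsWeightedCycle (m + 3) z W) (hW : HeavyLinked (m + 3) W)
    (hex : ∃ i, 2 ≤ W i) {ω : ℕ} (hω : ∀ i, W i ≤ ω) {t : ℕ} (ht : 1 ≤ t) :
    RegLE 𝕜 (powSet (Set.range (cycleEdge z W)) t) (2 * (ω : ℤ) * t + (m / 3 : ℕ) - 1) := by
  rw [hc.powSet_eq hW hex]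
  obtain ⟨i₀, hi₀⟩ := hex
  obtain ⟨j₀, hj₀, -⟩ := hc.exists_mem_heavyEdges hi₀
  have hω2 : 2 ≤ ω := hi₀.trans (hω i₀)
  refine regLE_iUnion_heavySet ⟨j₀, hj₀⟩ (hc.two_le_sum_cycleEdge hW) (fun i hi => ?_) ?_
  · have hi := (mem_filter.1 hi).2
    rw [hc.lightCovers_eq hi]
    have h1 := regLE_heavySet (𝕜 := 𝕜) (hc.isAlmostPath hW hi) (fun j => z (i + 1 + j))
      (hc.injOn _) hi ht t le_rfl
    have h2 : z (i + 1 + (m + 2)) = z i := (hc.vertex _ _).2 (by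
      rw [show i + 1 + (m + 2) = i + (m + 3) by omega]; simp [Nat.ModEq])
    simp only [h2, add_zero] at h1
    refine h1.mono ?_
    have := hω i
    gcongr
  · obtain ⟨t, rfl⟩ : ∃ t', t = t' + 1 := ⟨t - 1, by omega⟩
    rw [hc.lightCovers_eq hi₀]
    refine (regLE_lineCovers_almostPath (𝕜 := 𝕜) (hc.isAlmostPath hW hi₀)
      (fun j => z (i₀ + 1 + j)) (hc.injOn _) t).mono ?_
    push_cast
    nlinarith

end IsWeightedCycle

end Cycle

/-! ### Integral closedness forces heavy edges to be linked. -/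

section IntegrallyClosed

variable {𝕜 V : Type*} [Field 𝕜] [Fintype V] [DecidableEq V]

theorem isIntegralOverIdeal_of_pow_mem {R : Type*} [CommRing R] {I : Ideal R} {f : R} {k : ℕ}
    (hk : 1 ≤ k) (h : f ^ k ∈ I ^ k) : IsIntegralOverIdeal I f := by
  refine ⟨k, fun i => if i = k then -f ^ k else 0, hk, fun i _ => ?_, ?_⟩
  · dsimp only
    split_ifs with hi
    · subst hi; exact neg_mem h
    · exact zero_mem _
  · rw [sum_eq_single_of_mem k (mem_Icc.2 ⟨hk, le_rfl⟩) fun i _ hi => by simp [hi]]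
    simp

namespace IsWeightedCycle

variable {n : ℕ} {z : ℕ → V} {W : ℕ → ℕ}

/-- With a = W i - 1, the monomial (x_i x_{i+1})^a x_j x_{j+1} has its (a + 1)-st power divisible by
a copies of the i-th generator and one of the j-th, as W j ≤ a + 1. It is therefore integral, hence
divisible by some generator, and that generator must be a light link. -/
theorem exists_light_edge (hc : IsWeightedCycle n z W)
    (hI : IsIntegrallyClosedIdeal (monomialIdeal 𝕜 (Set.range (cycleEdge z W)))) {i j : ℕ}
    (hj : 2 ≤ W j) (hij : W j ≤ W i) (hne : ¬i ≡ j [MOD n]) :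
    ∃ k, W k = 1 ∧
      (k ≡ i + 1 [MOD n] ∧ k + 1 ≡ j [MOD n] ∨ k ≡ j + 1 [MOD n] ∧ k + 1 ≡ i [MOD n]) := by
  obtain ⟨a, ha⟩ : ∃ a, W i = a + 1 := ⟨W i - 1, by omega⟩
  let g : V →₀ ℕ := a • cycleEdge z (fun _ => 1) i + cycleEdge z (fun _ => 1) j
  have hg : ∀ v, g v = (if v = z i ∨ v = z (i + 1) then a else 0) +
      if v = z j ∨ v = z (j + 1) then 1 else 0 := by
    intro v
    simp only [g, Finsupp.add_apply, Finsupp.smul_apply, hc.cycleEdge_apply, smul_eq_mul, mul_ite,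
      mul_one, mul_zero]
  have hmem : (a + 1) • g ∈ powSet (Set.range (cycleEdge z W)) (a + 1) := by
    refine isUpperSet_powSet _ _ ?_ (b := (a + 1) • g) (a := a • cycleEdge z W i + cycleEdge z W j)
      ?_
    · intro v
      rw [Finsupp.add_apply, Finsupp.smul_apply, Finsupp.smul_apply, hg, hc.cycleEdge_apply,
        hc.cycleEdge_apply, smul_eq_mul, smul_eq_mul, mul_add, ha]
      refine add_le_add (le_of_eq ?_) ?_
      · split_ifs <;> ring
      · split_ifs <;> omega
    · have : cycleEdge z W j ∈ powSet (Set.range (cycleEdge z W)) 1 :=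
        ⟨_, Set.mem_range_self j, 0, trivial, (add_zero _).symm⟩
      rw [add_comm a 1]
      exact nsmul_add_mem_powSet (Set.mem_range_self i) this a
  have hint : MvPolynomial.monomial g (1 : 𝕜) ∈ monomialIdeal 𝕜 (Set.range (cycleEdge z W)) := by
    have h1 : IsIntegralOverIdeal (monomialIdeal 𝕜 (Set.range (cycleEdge z W)))
        (MvPolynomial.monomial g (1 : 𝕜)) := by
      refine isIntegralOverIdeal_of_pow_mem (k := a + 1) (by omega) ?_
      rw [MvPolynomial.monomial_pow, one_pow, monomialIdeal_pow]
      exact Ideal.subset_span ⟨_, hmem, rfl⟩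
    have h2 : MvPolynomial.monomial g (1 : 𝕜) ∈ {f | IsIntegralOverIdeal
      (monomialIdeal 𝕜 (Set.range (cycleEdge z W))) f} := h1
    rw [hI] at h2
    exact h2
  rw [monomialIdeal, MvPolynomial.mem_ideal_span_monomial_image] at hint
  obtain ⟨_, ⟨k, rfl⟩, hk⟩ := hint g (by simp [MvPolynomial.mem_support_iff])
  have h1 := hk (z k)
  have h2 := hk (z (k + 1))
  rw [hg, hc.cycleEdge_apply] at h1 h2
  simp only [true_or, or_true, if_true] at h1 h2
  have hi' := hc.modEq_of_ends (i := i) (k := k)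
  have hj' := hc.modEq_of_ends (i := j) (k := k)
  have hpos := hc.pos k
  have hki : k ≡ i [MOD n] → W k = a + 1 := fun h => by rw [hc.weight _ _ h, ha]
  have hkj : k ≡ j [MOD n] → W k = W j := hc.weight _ _
  have hkij : k ≡ i [MOD n] → k ≡ j [MOD n] → False := fun h h' => hne (h.symm.trans h')
  have hv1 : z k = z i → k ≡ i [MOD n] := (hc.vertex _ _).1
  have hv2 : z k = z j → k ≡ j [MOD n] := (hc.vertex _ _).1
  have hv3 : z (k + 1) = z (i + 1) → k ≡ i [MOD n] := fun h =>
    Nat.ModEq.add_right_cancel' 1 ((hc.vertex _ _).1 h)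
  have hv4 : z (k + 1) = z (j + 1) → k ≡ j [MOD n] := fun h =>
    Nat.ModEq.add_right_cancel' 1 ((hc.vertex _ _).1 h)
  -- Neither the i-th nor the j-th generator divides: each would need its full weight at both ends,
  -- which only a vertex shared by the two edges provides.
  by_cases hA : k ≡ i [MOD n]
  · have h3 := hki hA
    rw [h3] at h1 h2
    exact (hkij hA (hj' (by by_contra h; rw [if_neg h] at h1; split_ifs at h1 <;> omega)
      (by by_contra h; rw [if_neg h] at h2; split_ifs at h2 <;> omega))).elim
  by_cases hB : k ≡ j [MOD n]
  · have h3 := hkj hB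
    rw [h3] at h1 h2
    exact (hA (hi' (by by_contra h; rw [if_neg h] at h1; split_ifs at h1 <;> omega)
      (by by_contra h; rw [if_neg h] at h2; split_ifs at h2 <;> omega))).elim
  have e1 : z k ≠ z i := fun h => hA (hv1 h)
  have e2 : z k ≠ z j := fun h => hB (hv2 h)
  have e3 : z (k + 1) ≠ z (i + 1) := fun h => hA (hv3 h)
  have e4 : z (k + 1) ≠ z (j + 1) := fun h => hB (hv4 h)
  simp only [e1, e2, false_or] at h1
  simp only [e3, e4, or_false] at h2
  refine ⟨k, ?_⟩
  simp only [← hc.vertex]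
  by_cases hP : z k = z (i + 1)
  · have hQ : z (k + 1) ≠ z i := fun h => hA (hi' (Or.inr hP) (Or.inl h))
    rw [if_neg hQ, zero_add] at h2
    have hR : z (k + 1) = z j := by
      by_contra h
      rw [if_neg h] at h2
      omega
    rw [if_pos hR] at h2
    exact ⟨by omega, Or.inl ⟨hP, hR⟩⟩
  · rw [if_neg hP, zero_add] at h1
    have hS : z k = z (j + 1) := by
      by_contra h
      rw [if_neg h] at h1
      omega
    rw [if_pos hS] at h1
    have hR : z (k + 1) ≠ z j := fun h => hB (hj' (Or.inr hS) (Or.inl h))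
    rw [if_neg hR, add_zero] at h2
    have hQ : z (k + 1) = z i := by
      by_contra h
      rw [if_neg h] at h2
      omega
    exact ⟨by omega, Or.inr ⟨hS, hQ⟩⟩

theorem heavyLinked (hc : IsWeightedCycle n z W)
    (hI : IsIntegrallyClosedIdeal (monomialIdeal 𝕜 (Set.range (cycleEdge z W)))) :
    HeavyLinked n W := by
  intro i j hi hj hne
  rcases le_total (W j) (W i) with h | h
  · exact hc.exists_light_edge hI hj h hne
  · obtain ⟨k, hk, h⟩ := hc.exists_light_edge hI hi h fun h => hne h.symm
    exact ⟨k, hk, h.symm⟩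

end IsWeightedCycle

end IntegrallyClosed

/-! ### The extremal multidegree and the lower bound. -/

section LowerBound

variable {𝕜 V : Type*} [Field 𝕜] [Fintype V] [DecidableEq V]

theorem sum_range_third (K n : ℕ) (h : 3 * K ≤ n) :
    ∑ j ∈ range n, (if j % 3 = 0 ∧ j < 3 * K then 1 else 0) = K := by
  rw [← sum_subset (range_subset_range.2 h) fun j _ hj => if_neg fun h => hj (mem_range.2 h.2),
    sum_congr rfl fun j hj => if_congr (and_iff_left (mem_range.1 hj)) rfl rfl]
  clear h
  induction K with
  | zero => rfl
  | succ K ih =>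
    rw [show 3 * (K + 1) = 3 * K + 1 + 1 + 1 by ring, sum_range_succ, sum_range_succ,
      sum_range_succ, ih, if_pos (by omega), if_neg (by omega), if_neg (by omega)]
    rfl

/-- The entries of the extremal multidegree: `c` twice, then ones at pairs of neighbours. -/
def extremalEntry (c N j : ℕ) : ℕ :=
  if j < 2 then c else if j % 3 ≠ 2 ∧ j < 3 * N then 1 else 0

theorem sum_extremalEntry (c K n : ℕ) (h : 3 * (K + 1) ≤ n) :
    ∑ j ∈ range n, extremalEntry c (K + 1) j = 2 * c + 2 * K := by
  unfold extremalEntry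
  have h0 : ∀ j ∈ range n, j ∉ range (3 * (K + 1)) →
      (if j < 2 then c else if j % 3 ≠ 2 ∧ j < 3 * (K + 1) then 1 else 0) = 0 := by
    intro j _ hj
    rw [mem_range] at hj
    rw [if_neg (by omega), if_neg (by omega)]
  rw [← sum_subset (range_subset_range.2 h) h0,
    sum_congr rfl fun j hj => if_congr Iff.rfl rfl (if_congr (and_iff_left (mem_range.1 hj)) rfl rfl)]
  clear h h0
  induction K with
  | zero => simp [sum_range_succ]; ring
  | succ K ih =>
    rw [show 3 * (K + 1 + 1) = 3 * (K + 1) + 1 + 1 + 1 by ring, sum_range_succ, sum_range_succ,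
      sum_range_succ, ih, if_neg (by omega), if_pos (by omega), if_neg (by omega),
      if_pos (by omega), if_neg (by omega), if_neg (by omega)]
    ring

namespace IsWeightedCycle

variable {n : ℕ} {z : ℕ → V} {W : ℕ → ℕ}

/-- The pairing matches offsets 3q and 3q + 1 from p for q < ⌊n/3⌋, and σ₀ takes the first of each
pair. With K + 1 = ⌊n/3⌋ the multidegree has total degree 2ωt + 2K, in homological degree K + 1. -/
theorem not_koszulVanishing_powSet (hc : IsWeightedCycle n z W) (hW : HeavyLinked n W) {p : ℕ}
    (hp : 2 ≤ W p) {t : ℕ} (ht : 1 ≤ t) :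
    ∃ ρ : V → ℕ, Function.Injective ρ ∧ ∃ (i : ℕ) (j : ℤ),
      j - i = 2 * (W p : ℤ) * t + (n / 3 : ℕ) - 2 ∧
      ¬KoszulVanishing ρ (polyDegree 𝕜 V)
        (monomialIdeal 𝕜 (powSet (Set.range (cycleEdge z W)) t)) i j := by
  have hn := hc.three_le
  -- Ordering the vertices by their offset from p makes paired vertices adjacent.
  have hρex : ∀ v : V, ∃ d < n, z (p + d) = v := fun v => by
    obtain ⟨j, rfl⟩ := hc.surjective v
    obtain ⟨d, hd, h⟩ := exists_offset n (by omega) p j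
    exact ⟨d, hd, (hc.vertex _ _).2 h.symm⟩
  choose ρ hρn hρz using hρex
  have hρ : ∀ j < n, ρ (z (p + j)) = j := fun j hj =>
    hc.injOn p (Set.mem_Iio.2 (hρn _)) (Set.mem_Iio.2 hj) (hρz _)
  have hρinj : Function.Injective ρ := fun u v h => by rw [← hρz u, h, hρz]
  have hsum : ∀ F : ℕ → ℕ, ∑ v, F (ρ v) = ∑ j ∈ range n, F j := fun F =>
    sum_nbij' ρ (fun j => z (p + j)) (fun v _ => mem_range.2 (hρn v)) (fun _ _ => mem_univ _)
      (fun v _ => hρz v) (fun j hj => hρ j (mem_range.1 hj)) fun _ _ => rfl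
  have hedge : ∀ d, d + 1 < n → ∀ W' v, cycleEdge z W' (p + d) v =
      if ρ v = d ∨ ρ v = d + 1 then W' (p + d) else 0 := by
    intro d hd W' v
    rw [hc.cycleEdge_apply]
    refine if_congr (or_congr ⟨?_, ?_⟩ ⟨?_, ?_⟩) rfl rfl
    · rintro rfl; exact hρ _ (by omega)
    · rintro rfl; exact (hρz v).symm
    · rintro rfl; exact hρ (d + 1) hd
    · intro h; rw [add_assoc, ← h, hρz]
  obtain ⟨K, hK⟩ : ∃ K, n / 3 = K + 1 := ⟨n / 3 - 1, by omega⟩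
  set ω := W p with hω
  let a : V →₀ ℕ := Finsupp.equivFunOnFinite.symm fun v => extremalEntry (ω * t) (K + 1) (ρ v)
  have ha : ∀ v, a v = extremalEntry (ω * t) (K + 1) (ρ v) := fun v => rfl
  let P : Finset V := univ.filter fun v => ρ v % 3 ≠ 2 ∧ ρ v < 3 * (K + 1)
  have hP : ∀ v, v ∈ P ↔ ρ v % 3 ≠ 2 ∧ ρ v < 3 * (K + 1) := fun v => by simp [P]
  let κ : V → V := fun v => z (p + if ρ v % 3 = 0 then ρ v + 1 else ρ v - 1)
  have hκ : ∀ v, v ∈ P → ρ (κ v) = if ρ v % 3 = 0 then ρ v + 1 else ρ v - 1 := fun v hv => by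
    have := (hP v).1 hv
    exact hρ _ (by split_ifs <;> omega)
  let σ₀ : Finset V := univ.filter fun v => ρ v % 3 = 0 ∧ ρ v < 3 * (K + 1)
  have hσ₀ : ∀ v, v ∈ σ₀ ↔ ρ v % 3 = 0 ∧ ρ v < 3 * (K + 1) := fun v => by simp [σ₀]
  have hcard : σ₀.card = K + 1 := by
    rw [card_filter, hsum fun j => if j % 3 = 0 ∧ j < 3 * (K + 1) then 1 else 0,
      sum_range_third _ _ (by omega)]
  have hdeg : a.degree = 2 * (ω * t) + 2 * K := by
    rw [Finsupp.degree_eq_sum]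
    simp only [ha]
    rw [hsum, sum_extremalEntry _ _ _ (by omega)]
  have hωt : 2 ≤ ω * t := by nlinarith
  have hPa : ∀ v, v ∈ P ↔ a v ≠ 0 := fun v => by
    rw [hP, ha, extremalEntry]
    split_ifs <;> omega
  have hκP : ∀ v ∈ P, κ v ∈ P ∧ κ (κ v) = v := fun v hv => by
    have h1 := (hP v).1 hv
    have h2 := hκ v hv
    have h3 : κ v ∈ P := by
      rw [hP, h2]
      split_ifs <;> omega
    refine ⟨h3, hρinj ?_⟩
    rw [hκ _ h3, h2]
    split_ifs <;> omega
  have hadj : ∀ v ∈ P, ∀ u, u ≠ v → u ≠ κ v → (ρ u < ρ v ↔ ρ u < ρ (κ v)) := by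
    intro v hv u h1 h2
    have h1 := hρinj.ne h1
    have h2 := hρinj.ne h2
    rw [hκ v hv] at h2 ⊢
    split_ifs at h2 ⊢ <;> omega
  have hmem₀ : σ₀ ∈ transversals P κ := by
    refine mem_transversals.2 ⟨fun v hv => ?_, fun v hv => ?_⟩
    · rw [hσ₀] at hv; rw [hP]; omega
    · have h1 := (hP v).1 hv
      rw [hσ₀, hσ₀, hκ v hv]
      split_ifs <;> omega
  refine ⟨ρ, hρinj, σ₀.card, a.degree, ?_, not_koszulVanishing_of_pairing hρinj hκP hadj hPa
    (isUpperSet_powSet _ _) hmem₀ (fun v hv => ?_) fun σ hσ hmem => ?_⟩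
  · rw [hcard, hdeg, hK]; push_cast; ring
  · have hvd := (hσ₀ v).1 hv
    have herase : ∀ u, u ∈ σ₀.erase v ↔ ρ u ≠ ρ v ∧ ρ u % 3 = 0 ∧ ρ u < 3 * (K + 1) := fun u => by
      rw [mem_erase, hσ₀, hρinj.ne_iff]
    rcases Nat.eq_zero_or_pos (ρ v) with h0 | h0
    -- Restoring offset 0 leaves exponent ωt at both ends of the heavy edge, so its t-th power
    -- divides.
    · refine isUpperSet_powSet _ _ (a := t • cycleEdge z W p) (fun u => ?_) ?_
      · rw [Finsupp.smul_apply, smul_eq_mul, lowerOn_apply, ha, extremalEntry,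
          if_congr (herase u) rfl rfl, h0, show p = p + 0 from rfl, hedge 0 (by omega), add_zero,
          ← hω, mul_comm ω t]
        split_ifs <;> (try simp only [mul_zero]) <;> omega
      · have := nsmul_add_mem_powSet (E := Set.range (cycleEdge z W)) (Set.mem_range_self p)
          (h := 0) (t := 0) trivial t
        simpa using this
    -- Restoring another pair makes its light edge available; with exponents at least ωt - 1 ≥ ω(t -
    -- 1) at the heavy edge this is again t factors.
    · have hlight : W (p + ρ v) = 1 := by
        have h1 := hc.pos (p + ρ v)
        by_contra h2
        have := hc.heavy_offset hW hp h0 (hρn v) (by omega)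
        omega
      obtain ⟨t, rfl⟩ : ∃ t', t = t' + 1 := ⟨t - 1, by omega⟩
      refine isUpperSet_powSet _ _ (a := t • cycleEdge z W p + cycleEdge z W (p + ρ v))
        (fun u => ?_) ?_
      · rw [Finsupp.add_apply, Finsupp.smul_apply, smul_eq_mul, lowerOn_apply, ha, extremalEntry,
          if_congr (herase u) rfl rfl, hedge (ρ v) (by omega), hlight, show p = p + 0 from rfl,
          hedge 0 (by omega), add_zero, ← hω, mul_add, mul_comm ω t]
        split_ifs <;> (try simp only [mul_zero, add_zero, zero_add, mul_one]) <;> omega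
      · have h1 : cycleEdge z W (p + ρ v) ∈ powSet (Set.range (cycleEdge z W)) 1 :=
          ⟨_, Set.mem_range_self _, 0, trivial, (add_zero _).symm⟩
        rw [add_comm t 1]
        exact nsmul_add_mem_powSet (Set.mem_range_self p) h1 t
  · obtain ⟨hσP, hσκ⟩ := mem_transversals.1 hσ
    have hpair : ∀ d, d % 3 = 0 → d < 3 * (K + 1) → (z (p + d) ∈ σ ↔ z (p + (d + 1)) ∉ σ) := by
      intro d hd hd'
      have h1 := hσκ (z (p + d)) ((hP _).2 (by rw [hρ _ (by omega)]; omega))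
      simp only [κ] at h1
      rwa [hρ _ (by omega), if_pos hd] at h1
    obtain ⟨i, hi, s, hs, g, hg, he⟩ := Set.mem_iUnion₂.1 (hc.powSet_subset hW ⟨p, hp⟩ t hmem)
    have hi := (mem_filter.1 hi).2
    have hle : ∀ v, s * cycleEdge z W i v ≤ lowerOn a σ v := fun v => by
      rw [he, Finsupp.add_apply, Finsupp.smul_apply, smul_eq_mul]
      omega
    -- With t heavy factors the edge must be the p-th, the only place with exponents at least 2; but
    -- a transversal lowers one of its ends below ωt.
    have hst : s < t := by
      by_contra hst
      obtain rfl : s = t := by omega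
      have h1 := hle (z i)
      have h2 := hle (z (i + 1))
      rw [hc.cycleEdge_apply, if_pos (Or.inl rfl), lowerOn_apply] at h1
      rw [hc.cycleEdge_apply, if_pos (Or.inr rfl), lowerOn_apply] at h2
      have h3 : 2 ≤ s * W i := by nlinarith
      have hend : ∀ v, 2 ≤ a v → v = z p ∨ v = z (p + 1) := by
        intro v hv
        rw [ha, extremalEntry] at hv
        have : ρ v = 0 ∨ ρ v = 1 := by split_ifs at hv <;> omega
        exact this.imp (fun h => by rw [← hρz v, h, add_zero]) fun h => by rw [← hρz v, h]
      have hip := hc.modEq_of_ends (hend (z i) (by omega)) (hend (z (i + 1)) (by omega))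
      rw [hc.weight _ _ hip, ← hω, (hc.vertex _ _).2 hip, ha] at h1
      rw [hc.weight _ _ hip, ← hω, (hc.vertex _ _).2 (hip.add_right 1), ha] at h2
      have h4 := hpair 0 rfl (by omega)
      have h5 : ρ (z p) = 0 := hρ 0 (by omega)
      have h6 : ρ (z (p + 1)) = 1 := hρ 1 (by omega)
      rw [add_zero, zero_add] at h4
      rw [h5, extremalEntry, if_pos (by omega), mul_comm] at h1
      rw [h6, extremalEntry, if_pos (by omega), mul_comm] at h2
      by_cases h7 : z p ∈ σ
      · rw [if_pos h7] at h1; omega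
      · rw [if_pos (by tauto)] at h2; omega
    -- The zeros form a light cover: offsets congruent to 2 mod 3 and those past the last pair are
    -- zero already, and in each later pair σ removes one end. The light part g vanishes there,
    -- contradicting t - s ≥ 1.
    have hcov : (univ.filter fun v => lowerOn a σ v = 0) ∈ lightCovers z W := by
      intro j hj
      simp only [mem_filter, mem_univ, true_and, lowerOn_apply, ha]
      obtain ⟨d, hd, hjd⟩ := exists_offset n (by omega) p j
      have hWj := hc.weight _ _ hjd
      have hd0 : d ≠ 0 := by
        rintro rfl
        rw [add_zero] at hWj
        omega
      rw [(hc.vertex _ _).2 hjd, (hc.vertex _ _).2 (hjd.add_right 1), hρ d hd]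
      by_cases hlast : d + 1 = n
      · left
        rw [extremalEntry, if_neg (by omega), if_neg (by omega), Nat.zero_sub]
      rw [add_assoc, hρ (d + 1) (by omega)]
      by_cases h1 : d % 3 = 2
      · left
        rw [extremalEntry, if_neg (by omega), if_neg (by omega), Nat.zero_sub]
      by_cases h2 : d % 3 = 1
      · right
        rw [extremalEntry, if_neg (by omega), if_neg (by omega), Nat.zero_sub]
      by_cases h3 : d < 3 * (K + 1)
      · have h4 := hpair d (by omega) h3
        by_cases h5 : z (p + d) ∈ σ
        · left
          rw [extremalEntry, if_neg (by omega), if_pos (by omega), if_pos h5]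
        · right
          rw [extremalEntry, if_neg (by omega), if_pos (by omega), if_pos (by tauto)]
      · left
        rw [extremalEntry, if_neg (by omega), if_neg (by omega), Nat.zero_sub]
    have h1 := hg _ hcov
    have h2 : ∑ v ∈ univ.filter (fun v => lowerOn a σ v = 0), g v = 0 :=
      sum_eq_zero fun v hv => by
        have h3 := (mem_filter.1 hv).2
        rw [he, Finsupp.add_apply] at h3
        omega
    rw [h2] at h1
    dsimp only at h1
    omega

end IsWeightedCycle

end LowerBound

/-! ### Translation to `SimpleGraph.cycleGraph`. -/

section CycleGraph

/-- The vertices of the cycle graph on `m + 3` vertices, in cyclic order. -/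
def cycleVertex (m i : ℕ) : Fin (m + 3) := Fin.ofNat (m + 3) i

theorem cycleVertex_eq_iff {m a b : ℕ} :
    cycleVertex m a = cycleVertex m b ↔ a ≡ b [MOD m + 3] := by
  rw [Fin.ext_iff]; rfl

theorem cycleVertex_val {m : ℕ} (u : Fin (m + 3)) : cycleVertex m u = u :=
  Fin.ext (Nat.mod_eq_of_lt u.2)

theorem cycleVertex_succ (m i : ℕ) : cycleVertex m (i + 1) = cycleVertex m i + 1 := by
  apply Fin.ext
  rw [Fin.val_add]
  simp [cycleVertex, Fin.ofNat]

theorem cycleGraph_adj_cycleVertex (m i : ℕ) :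
    (SimpleGraph.cycleGraph (m + 3)).Adj (cycleVertex m i) (cycleVertex m (i + 1)) := by
  rw [SimpleGraph.cycleGraph_adj, cycleVertex_succ, add_sub_cancel_left]
  exact Or.inr rfl

theorem exists_cycleVertex_of_adj {m : ℕ} {u v : Fin (m + 3)}
    (h : (SimpleGraph.cycleGraph (m + 3)).Adj u v) :
    ∃ i, (u = cycleVertex m i ∧ v = cycleVertex m (i + 1)) ∨
      (v = cycleVertex m i ∧ u = cycleVertex m (i + 1)) := by
  rw [SimpleGraph.cycleGraph_adj] at h
  simp only [cycleVertex_succ]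
  rcases h with h | h
  · exact ⟨v, Or.inr ⟨(cycleVertex_val v).symm, by rw [cycleVertex_val, ← h, add_sub_cancel]⟩⟩
  · exact ⟨u, Or.inl ⟨(cycleVertex_val u).symm, by rw [cycleVertex_val, ← h, add_sub_cancel]⟩⟩

/-- The weights of the edges of the cycle graph, in cyclic order. -/
def cycleWeight {m : ℕ} (w : (SimpleGraph.cycleGraph (m + 3)).edgeSet → ℕ+) (i : ℕ) : ℕ :=
  w ⟨s(cycleVertex m i, cycleVertex m (i + 1)), cycleGraph_adj_cycleVertex m i⟩

variable {m : ℕ} (w : (SimpleGraph.cycleGraph (m + 3)).edgeSet → ℕ+)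

theorem exists_cycleWeight (e : (SimpleGraph.cycleGraph (m + 3)).edgeSet) :
    ∃ i, (w e : ℕ) = cycleWeight w i := by
  obtain ⟨e, he⟩ := e
  induction e using Sym2.ind with
  | _ u v =>
  obtain ⟨i, ⟨rfl, rfl⟩ | ⟨rfl, rfl⟩⟩ := exists_cycleVertex_of_adj he
  · exact ⟨i, rfl⟩
  · exact ⟨i, congrArg (fun e => (w e : ℕ)) (Subtype.ext Sym2.eq_swap)⟩

theorem isWeightedCycle_cycleGraph : IsWeightedCycle (m + 3) (cycleVertex m) (cycleWeight w) where
  three_le := by omega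
  vertex _ _ := cycleVertex_eq_iff
  weight a b h := congrArg (fun e => (w e : ℕ)) (Subtype.ext
    (congrArg₂ (fun u v => s(u, v)) (cycleVertex_eq_iff.2 h) (cycleVertex_eq_iff.2 (h.add_right 1))))
  pos i := (w _).pos
  surjective u := ⟨u, cycleVertex_val u⟩

theorem weightedEdgeIdeal_cycleGraph (𝕜 : Type*) [Field 𝕜] :
    weightedEdgeIdeal 𝕜 w =
      monomialIdeal 𝕜 (Set.range (cycleEdge (cycleVertex m) (cycleWeight w))) := by
  have key : ∀ (u v : Fin (m + 3)) (a : ℕ), MvPolynomial.monomial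
      (Finsupp.single u a + Finsupp.single v a) (1 : 𝕜) =
        MvPolynomial.X u ^ a * MvPolynomial.X v ^ a := by
    intro u v a
    rw [MvPolynomial.X_pow_eq_monomial, MvPolynomial.X_pow_eq_monomial, MvPolynomial.monomial_mul,
      one_mul]
  rw [weightedEdgeIdeal, monomialIdeal]
  congr 1
  ext p
  constructor
  · rintro ⟨u, v, h, rfl⟩
    obtain ⟨i, ⟨rfl, rfl⟩ | ⟨rfl, rfl⟩⟩ := exists_cycleVertex_of_adj h
    · exact ⟨_, Set.mem_range_self i, key _ _ _⟩
    · refine ⟨_, Set.mem_range_self i, (key _ _ _).trans ?_⟩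
      rw [mul_comm]
      have : cycleWeight w i = w ⟨s(cycleVertex m (i + 1), cycleVertex m i), h⟩ :=
        congrArg (fun e => (w e : ℕ)) (Subtype.ext Sym2.eq_swap)
      rw [this]
  · rintro ⟨_, ⟨i, rfl⟩, rfl⟩
    exact ⟨_, _, cycleGraph_adj_cycleVertex m i, key _ _ _⟩

end CycleGraph

theorem mainTheorem1 {𝕜 : Type*} [Field 𝕜] (n : ℕ) (hn : 3 ≤ n)
    (w : (SimpleGraph.cycleGraph n).edgeSet → ℕ+)
    (hw : IsNontrivialWeight w)
    (hI : IsIntegrallyClosedIdeal (weightedEdgeIdeal 𝕜 w))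
    (ω : ℕ) (hω : IsGreatest (Set.range fun e => (w e : ℕ)) ω)
    (t : ℕ) (ht : 1 ≤ t) :
    QuotientHasRegularity (weightedEdgeIdeal 𝕜 w ^ t)
      (2 * (ω : ℤ) * (t : ℤ) + ((n / 3 : ℕ) : ℤ) - 2) := by
  obtain ⟨m, rfl⟩ : ∃ m, n = m + 3 := ⟨n - 3, by omega⟩
  have hc := isWeightedCycle_cycleGraph w
  rw [weightedEdgeIdeal_cycleGraph] at hI ⊢
  rw [monomialIdeal_pow]
  have hW := hc.heavyLinked hI
  obtain ⟨p, hp⟩ : ∃ p, cycleWeight w p = ω := by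
    obtain ⟨e, he⟩ := hω.1
    obtain ⟨i, hi⟩ := exists_cycleWeight w e
    exact ⟨i, hi.symm.trans he⟩
  have hle : ∀ i, cycleWeight w i ≤ ω := fun i => hω.2 ⟨_, rfl⟩
  have hω2 : 2 ≤ cycleWeight w p := by
    obtain ⟨e, he⟩ := hw
    rw [hp]
    exact (show 2 ≤ (w e : ℕ) from he).trans (hω.2 ⟨e, rfl⟩)
  set U := powSet (Set.range (cycleEdge (cycleVertex m) (cycleWeight w))) t with hUdef
  have hU : IsUpperSet U := isUpperSet_powSet _ _
  have hhom : ∀ q ∈ monomialIdeal 𝕜 U, ∀ d, intComponent d q ∈ monomialIdeal 𝕜 U :=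
    fun q hq d => intComponent_mem_monomialIdeal hU hq d
  have hreg : RegLE 𝕜 U (2 * (ω : ℤ) * t + ((m + 3) / 3 : ℕ) - 2) := by
    refine (hc.regLE_powSet hW ⟨p, hω2⟩ hle ht).mono ?_
    omega
  refine ⟨nonempty_minimalGradedFreeResolution hhom fun q hq => ?_, fun F => ⟨?_, ?_⟩⟩
  -- The ideal is proper: as t ≥ 1, each exponent in U contains a generator with positive entries.
  · by_contra h
    have h0 := (mem_monomialIdeal hU).1 hq 0 h
    obtain ⟨t, rfl⟩ : ∃ t', t = t' + 1 := ⟨t - 1, by omega⟩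
    obtain ⟨_, ⟨i, rfl⟩, g, -, h1⟩ := h0
    have h2 := DFunLike.congr_fun h1 (cycleVertex m i)
    have h3 := hc.pos i
    rw [Finsupp.add_apply, hc.cycleEdge_apply, if_pos (Or.inl rfl), Finsupp.coe_zero,
      Pi.zero_apply] at h2
    omega
  · obtain ⟨ρ, hρ, i, j, hij, h⟩ := hc.not_koszulVanishing_powSet (𝕜 := 𝕜) hW hω2 ht
    rw [hp] at hij
    exact ⟨i, j, fun h0 => h ((F.betti_eq_zero_iff hhom hρ i j).1 h0), hij.symm⟩
  · rintro s ⟨i, j, hβ, rfl⟩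
    by_contra hlt
    refine hβ ((F.betti_eq_zero_iff hhom Fin.val_injective i j).2 (hreg _ Fin.val_injective i j ?_))
    omega
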